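/- Let $\sigma^{(1)},\sigma^{(2)},\sigma^{(3)}$ be the Pauli matrices and, on $(\mathbb{C}^2)^{\otimes n}$, let $\sigma_j^{(a)}=I_2^{\otimes(j-1)}\otimes\sigma^{(a)}\otimes I_2^{\otimes(n-j)}$. For probability measures $\mu,\nu$ on $\mathbb{R}$ let $d_{BL}(\mu,\nu)=\sup\{|\int f\,d\mu-\int f\,d\nu| : \|f\|_\infty+|f|_{L}\le 1\}$, where $|f|_L$ is the Lipschitz constant of $f$. The empirical spectral measure of a Hermitian matrix puts equal mass at each of its eigenvalues, counted with multiplicity. **Arbitrary coupling geometry.** For a finite simple graph $\Gamma$ on $\{1,\dots,n\}$ with $e(\Gamma)$ edges and $\mathbf{x}=(x_{a,b,(ij)})\in\mathbb{R}^{9e(\Gamma)}$ (with one index $(ij)$, $i<j$, for each edge, and $1\le a,b\le 3$), let $$H^{\Gamma}(\mathbf{x})=\frac{1}{3\sqrt{e(\Gamma)}}\sum_{(ij)\in\Gamma}\sum_{a,b=1}^3 x_{a,b,(ij)}\,\sigma_i^{(a)}\sigma_j^{(b)}$$ (the zero matrix if $\Gamma$ has no edges), with empirical spectral measure $\mu^{\Gamma}(\mathbf{x})$.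 1. For every $n$, every $\Gamma$ and every probability measure $\rho$ on $\mathbb{R}$, the map $\mathbf{x}\mapsto d_{BL}(\mu^\Gamma(\mathbf{x}),\rho)$ is Lipschitz for the Euclidean norm, with constant $\frac{1}{3\sqrt{e(\Gamma)}}$. 2. There are universal constants $C,c>0$ such that, for every $n$, every $\Gamma$ and every probability measure $\rho$ on $\mathbb{R}$, if the coefficients $\mathbf{x}$ are independent standard Gaussian random variables and $\mu=\mu^\Gamma(\mathbf{x})$, then $d_{BL}(\mu,\rho)$ is integrable and, for all $t\ge 0$, $$\mathbb{P}\big[|d_{BL}(\mu,\rho)-\mathbb{E}\,d_{BL}(\mu,\rho)|>t\big]\le C e^{-c\,e(\Gamma)t^2}.$$ 3. For each $n$ let $\Gamma_n$ be a graph on $\{1,\dots,n\}$, and let the coefficients of $H^{\Gamma_n}$ be independent standard Gaussians for each $n$ (the joint distribution for different $n$ is arbitrary). Suppose that the maximal degree of $\Gamma_n$ is $o(e(\Gamma_n))$ and that $\sum_n e^{-s\,e(\Gamma_n)}<\infty$ for every $s>0$ (for instance $e(\Gamma_n)/\log n\to\infty$, which holds whenever the $\Gamma_n$ have no isolated vertices).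 Then almost surely the empirical spectral measures $\mu_n$ of $H^{\Gamma_n}$ converge weakly to the standard Gaussian distribution as $n\to\infty$. **$p$-spin model.** For integers $n,p\ge0$ and real coefficients $\mathbf{x}$ indexed by $1\le i_1<\dots<i_p\le n$ and $a_1,\dots,a_p\in\{1,2,3\}$, let $$H^{(n,p)}(\mathbf{x})=3^{-p/2}\binom{n}{p}^{-1/2}\sum_{1\le i_1<\dots<i_p\le n}\ \sum_{a_1,\dots,a_p=1}^3 x_{a_1,\dots,a_p,(i_1\dots i_p)}\,\sigma_{i_1}^{(a_1)}\cdots\sigma_{i_p}^{(a_p)}$$ (the zero matrix if $p>n$), with empirical spectral measure $\mu^{(n,p)}(\mathbf{x})$. 4. For every probability measure $\rho$ on $\mathbb{R}$, the map $\mathbf{x}\mapsto d_{BL}(\mu^{(n,p)}(\mathbf{x}),\rho)$ is Lipschitz for the Euclidean norm, with constant $3^{-p/2}\binom{n}{p}^{-1/2}$. 5. Let $(p_n)$ be integers with $1\le p_n\le n$ for all sufficiently large $n$, and for each $n$ let the coefficients of $H^{(n,p_n)}$ be independent standard Gaussians (the joint distribution for different $n$ is arbitrary). Almost surely, as $n\to\infty$,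 the empirical spectral measures of $H^{(n,p_n)}$ converge weakly to (a) the standard Gaussian distribution, if $p_n/\sqrt n\to 0$; (b) the semicircle law $\frac{1}{2\pi}\sqrt{4-x^2}\,\mathbf{1}_{|x|\le2}\,dx$, if $p_n/\sqrt n\to\infty$; (c) the $q$-Gaussian law with $q=e^{-4\lambda^2/3}$, if $p_n/\sqrt n\to\lambda\in(0,\infty)$; that is, the probability measure with density $$\frac{\sqrt{1-q}}{2\pi\sqrt{4-(1-q)x^2}}\ \prod_{k=0}^\infty\big((1+q^k)^2-(1-q)x^2q^k\big)\ \prod_{k=0}^\infty(1-q^{k+1}),\qquad |x|<\frac{2}{\sqrt{1-q}},$$ and $0$ elsewhere. -/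

import Mathlib

open MeasureTheory ProbabilityTheory Filter Topology

namespace SpinGlass

noncomputable section

/-! ### Spin operators on `(ℂ²)^{⊗ n}` -/

/-- The Pauli matrices `σ⁽¹⁾, σ⁽²⁾, σ⁽³⁾`, numbered `0, 1, 2`. -/
def pauli : Fin 3 → Matrix (Fin 2) (Fin 2) ℂ
  | 0 => !![0, 1; 1, 0]
  | 1 => !![0, -Complex.I; Complex.I, 0]
  | 2 => !![1, 0; 0, -1]

/-- The tensor (Kronecker) product `A 0 ⊗ ⋯ ⊗ A (n - 1)` of `n` matrices of size `2 × 2`; the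
standard basis of `(ℂ²)^{⊗ n}` is indexed by `Fin n → Fin 2`. -/
def tensor {n : ℕ} (A : Fin n → Matrix (Fin 2) (Fin 2) ℂ) :
    Matrix (Fin n → Fin 2) (Fin n → Fin 2) ℂ :=
  Matrix.of fun s t => ∏ k, A k (s k) (t k)

/-- The operator `σ_j⁽ᵃ⁾ = I ⊗ ⋯ ⊗ I ⊗ σ⁽ᵃ⁾ ⊗ I ⊗ ⋯ ⊗ I`, with the Pauli matrix in place `j`. -/
def spin {n : ℕ} (j : Fin n) (a : Fin 3) : Matrix (Fin n → Fin 2) (Fin n → Fin 2) ℂ :=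
  tensor (Function.update (fun _ => 1) j (pauli a))

theorem pauli_isHermitian (a : Fin 3) : (pauli a).IsHermitian := by
  ext i j
  fin_cases a <;> fin_cases i <;> fin_cases j <;> simp [pauli]

theorem tensor_isHermitian {n : ℕ} {A : Fin n → Matrix (Fin 2) (Fin 2) ℂ}
    (hA : ∀ k, (A k).IsHermitian) : (tensor A).IsHermitian := by
  ext s t
  simp only [tensor, Matrix.conjTranspose_apply, Matrix.of_apply, star_prod]
  exact Finset.prod_congr rfl fun k _ => (hA k).apply (s k) (t k)

theorem tensor_mul {n : ℕ} (A B : Fin n → Matrix (Fin 2) (Fin 2) ℂ) :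
    tensor A * tensor B = tensor fun k => A k * B k := by
  ext s t
  simp only [tensor, Matrix.mul_apply, Matrix.of_apply, ← Finset.prod_mul_distrib]
  exact (Fintype.prod_sum fun k r => A k (s k) r * B k r (t k)).symm

theorem spin_isHermitian {n : ℕ} (j : Fin n) (a : Fin 3) : (spin j a).IsHermitian := by
  refine tensor_isHermitian fun k => ?_
  by_cases h : k = j
  · subst h
    simpa using pauli_isHermitian a
  · simp [Function.update_of_ne h, Matrix.isHermitian_one]

theorem spin_commute {n : ℕ} {i j : Fin n} (h : i ≠ j) (a b : Fin 3) :
    Commute (spin i a) (spin j b) := by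
  unfold Commute SemiconjBy spin
  rw [tensor_mul, tensor_mul]
  congr 1
  funext k
  by_cases hi : k = i
  · subst hi
    simp [Function.update_of_ne h]
  · simp [Function.update_of_ne hi]

/-! ### Hamiltonians -/

/-- The index set of the coefficients `α_{a,b,(ij)}`: an edge `(ij)` of `Γ`, listed once, as
`i < j`, together with `a, b ∈ {1, 2, 3}`. -/
abbrev GraphCoupling {n : ℕ} (Γ : SimpleGraph (Fin n)) : Type :=
  {e : Fin n × Fin n // e.1 < e.2 ∧ Γ.Adj e.1 e.2} × Fin 3 × Fin 3

/-- The Hamiltonian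
`H^Γ(x) = (3 √e(Γ))⁻¹ ∑_{(ij) ∈ Γ} ∑_{a,b} x_{a,b,(ij)} σ_i⁽ᵃ⁾ σ_j⁽ᵇ⁾`. -/
def graphHamiltonian {n : ℕ} (Γ : SimpleGraph (Fin n)) [DecidableRel Γ.Adj]
    (x : GraphCoupling Γ → ℝ) : Matrix (Fin n → Fin 2) (Fin n → Fin 2) ℂ :=
  (1 / (3 * √(Γ.edgeFinset.card : ℝ)) : ℝ) •
    ∑ c : GraphCoupling Γ, x c • (spin c.1.1.1 c.2.1 * spin c.1.1.2 c.2.2)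

/-- The index set of the coefficients of the `p`-spin model: sites `i_1 < ⋯ < i_p` together with
`a_1, …, a_p ∈ {1, 2, 3}`. -/
abbrev GlassCoupling (n p : ℕ) : Type :=
  {i : Fin p → Fin n // ∀ k l, k < l → i k < i l} × (Fin p → Fin 3)

/-- The `p`-spin Hamiltonian
`3^{-p/2} (n choose p)^{-1/2} ∑_{i_1 < ⋯ < i_p} ∑_{a_1, …, a_p} x_{a,i} σ_{i_1}^{(a_1)} ⋯ σ_{i_p}^{(a_p)}`. -/
def glassHamiltonian (n p : ℕ) (x : GlassCoupling n p → ℝ) :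
    Matrix (Fin n → Fin 2) (Fin n → Fin 2) ℂ :=
  ((3 : ℝ) ^ (-(p : ℝ) / 2) * (n.choose p : ℝ) ^ (-(1 : ℝ) / 2)) •
    ∑ c : GlassCoupling n p, x c • (List.ofFn fun k => spin (c.1.1 k) (c.2 k)).prod

theorem real_smul_isHermitian {ι : Type*} {A : Matrix ι ι ℂ} (hA : A.IsHermitian) (r : ℝ) :
    (r • A).IsHermitian := by
  unfold Matrix.IsHermitian
  rw [Matrix.conjTranspose_smul, hA.eq, star_trivial]

theorem sum_isHermitian {ι κ : Type*} [Fintype κ] {A : κ → Matrix ι ι ℂ}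
    (hA : ∀ k, (A k).IsHermitian) : (∑ k, A k).IsHermitian := by
  unfold Matrix.IsHermitian
  rw [Matrix.conjTranspose_sum]
  exact Finset.sum_congr rfl fun k _ => (hA k).eq

theorem graphHamiltonian_isHermitian {n : ℕ} (Γ : SimpleGraph (Fin n)) [DecidableRel Γ.Adj]
    (x : GraphCoupling Γ → ℝ) : (graphHamiltonian Γ x).IsHermitian := by
  refine real_smul_isHermitian (sum_isHermitian fun c => real_smul_isHermitian ?_ _) _
  unfold Matrix.IsHermitian
  rw [Matrix.conjTranspose_mul, (spin_isHermitian _ _).eq, (spin_isHermitian _ _).eq]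
  exact (spin_commute (ne_of_lt c.1.2.1) _ _).eq.symm

theorem glassHamiltonian_isHermitian (n p : ℕ) (x : GlassCoupling n p → ℝ) :
    (glassHamiltonian n p x).IsHermitian := by
  refine real_smul_isHermitian (sum_isHermitian fun c => real_smul_isHermitian ?_ _) _
  unfold Matrix.IsHermitian
  have hmap : (List.ofFn fun k => spin (c.1.1 k) (c.2 k)).map Matrix.conjTranspose
      = List.ofFn fun k => spin (c.1.1 k) (c.2 k) := by
    rw [List.map_ofFn]
    congr 1
    funext k
    exact (spin_isHermitian _ _).eq
  rw [Matrix.conjTranspose_list_prod, hmap]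
  refine (List.reverse_perm _).prod_eq' ?_
  rw [List.pairwise_reverse, List.pairwise_ofFn]
  intro k l hkl
  exact spin_commute (ne_of_gt (c.1.2 k l hkl)) _ _

/-! ### Spectral measures and limit laws -/

/-- The empirical spectral measure of a Hermitian matrix: equal mass at each eigenvalue, with
multiplicity. -/
def spectralMeasure {ι : Type*} [Fintype ι] [DecidableEq ι] [Nonempty ι] {A : Matrix ι ι ℂ}
    (hA : A.IsHermitian) : ProbabilityMeasure ℝ :=
  ⟨(Fintype.card ι : ENNReal)⁻¹ • ∑ i, Measure.dirac (hA.eigenvalues i), ⟨by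
    simp [ENNReal.inv_mul_cancel]⟩⟩

/-- The spectral measure of `H^Γ(x)`. -/
def graphSpectral {n : ℕ} (Γ : SimpleGraph (Fin n)) [DecidableRel Γ.Adj]
    (x : GraphCoupling Γ → ℝ) : ProbabilityMeasure ℝ :=
  spectralMeasure (graphHamiltonian_isHermitian Γ x)

/-- The spectral measure of the `p`-spin Hamiltonian with coefficients `x`. -/
def glassSpectral (n p : ℕ) (x : GlassCoupling n p → ℝ) : ProbabilityMeasure ℝ :=
  spectralMeasure (glassHamiltonian_isHermitian n p x)

/-- The bounded-Lipschitz distance: the supremum of `|∫ f dμ - ∫ f dν|` over all `f : ℝ → ℝ` with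
`‖f‖_∞ + |f|_L ≤ 1`, where `|f|_L` is the Lipschitz constant of `f`. -/
def dBL (μ ν : ProbabilityMeasure ℝ) : ℝ :=
  sSup {r : ℝ | ∃ (f : ℝ → ℝ) (M L : NNReal), (∀ x, |f x| ≤ M) ∧ LipschitzWith L f ∧ M + L ≤ 1 ∧
    r = |(∫ x, f x ∂(μ : Measure ℝ)) - ∫ x, f x ∂(ν : Measure ℝ)|}

/-- Weak convergence of `μ n` to `ν`, where `ν` is a probability measure. -/
def ConvergesWeakly (μ : ℕ → ProbabilityMeasure ℝ) (ν : Measure ℝ) : Prop :=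
  ∃ h : IsProbabilityMeasure ν, Tendsto μ atTop (𝓝 (⟨ν, h⟩ : ProbabilityMeasure ℝ))

/-- The family `α` consists of independent standard Gaussian random variables. -/
def IsStdGaussianFamily {Ω ι : Type*} [MeasurableSpace Ω] (P : Measure Ω) (α : ι → Ω → ℝ) : Prop :=
  (∀ i, HasLaw (α i) (gaussianReal 0 1) P) ∧ iIndepFun α P

/-- The Wigner semicircle law on `[-2, 2]` (the square root vanishes outside this interval). -/
def semicircleLaw : Measure ℝ :=
  volume.withDensity fun x => ENNReal.ofReal (√(4 - x ^ 2) / (2 * Real.pi))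

/-- The density of the `q`-Gaussian (`q`-Hermite) law, `0 < q < 1`:
`√(1-q) / (2π √(4 - (1-q)x²)) ∏_{k ≥ 0} ((1 + q^k)² - (1-q) x² q^k) ∏_{k ≥ 0} (1 - q^{k+1})` for
`|x| < 2 / √(1-q)`, and `0` elsewhere. -/
def qGaussianDensity (q x : ℝ) : ℝ :=
  if (1 - q) * x ^ 2 < 4 then
    √(1 - q) / (2 * Real.pi * √(4 - (1 - q) * x ^ 2)) *
      (∏' k : ℕ, ((1 + q ^ k) ^ 2 - (1 - q) * x ^ 2 * q ^ k)) * (∏' k : ℕ, (1 - q ^ (k + 1)))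
  else 0

/-- The `q`-Gaussian law, `0 < q < 1`. -/
def qGaussianLaw (q : ℝ) : Measure ℝ :=
  volume.withDensity fun x => ENNReal.ofReal (qGaussianDensity q x)

end

end SpinGlass

open SpinGlass

namespace SpinGlass

/-! ### Gaussian concentration -/

/-! Both Hamiltonians have the form `M^{-1/2} ∑ x_c S_c`, where the `M` operators `S_c` are distinct
Pauli strings: Hermitian involutions, orthogonal for the trace, any two of which commute up to a
sign `ε c d = ±1` (`IsSpinFamily`, `isSpinFamily_pauliString`). Everything except the size of these
signs is proved at that level.

Lipschitz bounds. The squared overlaps of two eigenbases form a doubly stochastic matrix that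
couples the two spectra, with quadratic cost equal to the squared Frobenius distance
(`exists_spectral_coupling`). Trace orthogonality makes the normalised Frobenius norm of `H(x) -
H(y)` equal to `M^{-1/2} |x - y|`, so spectral integrals of Lipschitz functions are Lipschitz in
`x`.

Concentration. The one-dimensional Prékopa-Leindler inequality gives Maurey's property `(τ)` of the
Gaussian; it tensorises, and yields exponential moments and Gaussian tails for Lipschitz functions
of any number of variables.

Almost sure limits. By concentration and Borel-Cantelli it suffices to find the limit of the
expected characteristic function, hence of the expected moments. Gaussian integration by parts
computes these by a recursion on words with pending operators (`wickMoment`), in which an operator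
inserted behind `i` pending ones picks up `i` commutation signs. If the sign of a random operator
against `m` other random ones averages to nearly `q ^ m` for most choices of these, the recursion
converges to `qMoment q` (`tendsto_wickMoment`), whose recursion encodes the three-term recurrence
of the `q`-Hermite polynomials.

Signs. In a graph of small maximal degree most edges are disjoint, so `q = 1`. In the `p`-spin
model, averaging over Pauli labels gives `-1/3` for each site where a random string meets the
support `W` of a product of `m` strings, so the average sign is the mean of `(-1/3)^{|I ∩ W|}` over
`p`-subsets `I`. When `p` is of order at most `√n`, `|W|` is nearly `mp` and this mean is about `(1
- 4p/(3n))^{mp}`, which tends to `e^{-4λ²m/3}`. When `p` is much larger than `√n`, the support is so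
large that the mean tends to `0`.

Limit laws. Moments equal to `qMoment q` follow from orthogonality of the law to the `q`-Hermite
polynomials of positive degree. For `q = 1` this is integration by parts, for `q = 0` Chebyshev
polynomials in the angle; for `0 < q < 1` a finite form of Jacobi's triple product gives the Fourier
coefficients of the weight. -/

theorem volume_add_le_two_mul_of_isCompact {A B C : Set ℝ} (hA : IsCompact A) (hB : IsCompact B)
    (hA' : A.Nonempty) (hB' : B.Nonempty) (h : ∀ a ∈ A, ∀ b ∈ B, (a + b) / 2 ∈ C) :
    volume A + volume B ≤ 2 * volume C := by
  set a := sSup A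
  set b := sInf B
  have ha : a ∈ A := hA.sSup_mem hA'
  have hb : b ∈ B := hB.sInf_mem hB'
  have himg : ∀ (S : Set ℝ) (c : ℝ), volume ((fun x => 2⁻¹ * (x + c)) '' S) = 2⁻¹ * volume S := by
    intro S c
    have : (fun x : ℝ => 2⁻¹ * (x + c)) '' S = (fun x => (2⁻¹ : ℝ) • x) '' ((fun x => x + c) '' S) := by
      rw [Set.image_image]; rfl
    rw [this, Set.image_smul, Measure.addHaar_smul]
    simp only [Module.finrank_self, pow_one]
    rw [abs_of_pos (by norm_num), Set.image_add_right, measure_preimage_add_right,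
      ENNReal.ofReal_inv_of_pos (by norm_num)]
    norm_num
  -- With `a = max A` and `b = min B`, the half-size copies `(A + b)/2` and `(a + B)/2` lie in `C`
  -- on either side of their only possible common point `(a + b)/2`, which is removed from the
  -- first.
  have hsub : (fun x => 2⁻¹ * (x + b)) '' (A \ {a}) ∪ (fun x => 2⁻¹ * (x + a)) '' B ⊆ C := by
    rintro z (⟨x, hx, rfl⟩ | ⟨y, hy, rfl⟩)
    · have := h x hx.1 b hb
      convert this using 1
      ring
    · have := h a ha y hy
      convert this using 1
      ring
  have hdisj : Disjoint ((fun x => 2⁻¹ * (x + b)) '' (A \ {a})) ((fun x => 2⁻¹ * (x + a)) '' B) := by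
    rw [Set.disjoint_left]
    rintro z ⟨x, hx, rfl⟩ ⟨y, hy, hxy⟩
    have h1 : x ≤ a := le_csSup hA.bddAbove hx.1
    have h2 : b ≤ y := csInf_le hB.bddBelow hy
    have h3 : x ≠ a := hx.2
    have h4 : x < a := lt_of_le_of_ne h1 h3
    simp only at hxy
    linarith
  have hmeas : MeasurableSet ((fun x => 2⁻¹ * (x + a)) '' B) :=
    (hB.image (by fun_prop)).measurableSet
  have := measure_mono (μ := volume) hsub
  rw [measure_union hdisj hmeas, himg, himg, measure_sdiff_null (by simp), ← mul_add] at this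
  calc volume A + volume B = 2 * (2⁻¹ * (volume A + volume B)) := by
        rw [← mul_assoc, ENNReal.mul_inv_cancel (by simp) (by simp), one_mul]
    _ ≤ _ := by gcongr

/-- The one-dimensional Brunn-Minkowski inequality. -/
theorem volume_add_le_two_mul {A B C : Set ℝ} (hA : MeasurableSet A) (hB : MeasurableSet B)
    (hA' : A.Nonempty) (hB' : B.Nonempty) (h : ∀ a ∈ A, ∀ b ∈ B, (a + b) / 2 ∈ C) :
    volume A + volume B ≤ 2 * volume C := by
  obtain ⟨a, ha⟩ := hA'
  obtain ⟨b, hb⟩ := hB'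
  rw [hA.measure_eq_iSup_isCompact, hB.measure_eq_iSup_isCompact]
  simp only [iSup_and']
  refine ENNReal.biSup_add_biSup_le' ⟨∅, by simp⟩ ⟨∅, by simp⟩ ?_
  rintro K ⟨hKA, hK⟩ K' ⟨hKB, hK'⟩
  refine le_trans (add_le_add (measure_mono (Set.subset_insert a K))
    (measure_mono (Set.subset_insert b K'))) ?_
  refine volume_add_le_two_mul_of_isCompact (hK.insert a) (hK'.insert b) (Set.insert_nonempty _ _)
    (Set.insert_nonempty _ _) fun x hx y hy => h x ?_ y ?_
  · exact Set.insert_subset ha hKA hx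
  · exact Set.insert_subset hb hKB hy

/-- Layer-cake argument. Midpoints of `{f > t}` and `{g > t}` lie in `{h > t}`, so the
one-dimensional Brunn-Minkowski inequality can be integrated over `t`. Both suprema are equal to `1`
so that the two superlevel sets are nonempty for the same `t`, which Brunn-Minkowski requires. -/
theorem lintegral_add_le_two_mul {f g h : ℝ → ℝ} (hf : Measurable f) (hg : Measurable g)
    (hh : Measurable h) (hf0 : ∀ x, 0 ≤ f x) (hg0 : ∀ x, 0 ≤ g x) (hh0 : ∀ x, 0 ≤ h x)
    (hf1 : ∀ x, f x ≤ 1) (hg1 : ∀ x, g x ≤ 1) (hf' : ∀ t < 1, ∃ x, t < f x)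
    (hg' : ∀ t < 1, ∃ x, t < g x) (hfg : ∀ x y, f x * g y ≤ h ((x + y) / 2) ^ 2) :
    (∫⁻ x, ENNReal.ofReal (f x)) + ∫⁻ x, ENNReal.ofReal (g x)
      ≤ 2 * ∫⁻ x, ENNReal.ofReal (h x) := by
  rw [lintegral_eq_lintegral_meas_lt _ (.of_forall hf0) hf.aemeasurable,
    lintegral_eq_lintegral_meas_lt _ (.of_forall hg0) hg.aemeasurable,
    lintegral_eq_lintegral_meas_lt _ (.of_forall hh0) hh.aemeasurable,
    ← lintegral_const_mul' _ _ (by simp), ← lintegral_add_left']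
  · refine setLIntegral_mono' measurableSet_Ioi fun t (ht : 0 < t) => ?_
    by_cases h1 : t < 1
    · refine volume_add_le_two_mul (measurableSet_lt measurable_const hf)
        (measurableSet_lt measurable_const hg) (hf' t h1) (hg' t h1) ?_
      intro x (hx : t < f x) y (hy : t < g y)
      have h2 : t * t < h ((x + y) / 2) ^ 2 :=
        lt_of_lt_of_le (mul_lt_mul'' hx hy ht.le ht.le) (hfg x y)
      show t < h ((x + y) / 2)
      nlinarith [hh0 ((x + y) / 2)]
    · have e1 : {a | t < f a} = ∅ := by
        ext x; simpa using (hf1 x).trans (not_lt.mp h1)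
      have e2 : {a | t < g a} = ∅ := by
        ext x; simpa using (hg1 x).trans (not_lt.mp h1)
      rw [e1, e2]
      simp
  · refine Antitone.measurable (f := fun t => volume {a | t < f a}) ?_ |>.aemeasurable
    exact fun s t hst => measure_mono fun x (hx : t < f x) => lt_of_le_of_lt hst hx

theorem ENNReal.mul_le_sq_of_add_le {a b c : ENNReal} (h : a + b ≤ 2 * c) : a * b ≤ c ^ 2 := by
  by_cases hc : c = ⊤
  · simp [hc]
  have h2 : 2 * c ≠ ⊤ := ENNReal.mul_ne_top (by simp) hc
  have hab : a + b ≠ ⊤ := ne_top_of_le_ne_top h2 h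
  have ha : a ≠ ⊤ := fun h => hab (by simp [h])
  have hb : b ≠ ⊤ := fun h => hab (by simp [h])
  lift a to NNReal using ha
  lift b to NNReal using hb
  lift c to NNReal using hc
  norm_cast at h ⊢
  rw [← NNReal.coe_le_coe] at h ⊢
  push_cast at h ⊢
  nlinarith [sq_nonneg ((a : ℝ) - b), a.2, b.2, c.2]

/-- The one-dimensional Prékopa-Leindler inequality, for bounded functions. -/
theorem lintegral_mul_lintegral_le_sq {f g h : ℝ → ℝ} (hf : Measurable f) (hg : Measurable g)
    (hh : Measurable h) (hf0 : ∀ x, 0 ≤ f x) (hg0 : ∀ x, 0 ≤ g x) (hh0 : ∀ x, 0 ≤ h x)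
    (hfb : BddAbove (Set.range f)) (hgb : BddAbove (Set.range g))
    (hfp : ∃ x, 0 < f x) (hgp : ∃ x, 0 < g x)
    (hfg : ∀ x y, f x * g y ≤ h ((x + y) / 2) ^ 2) :
    (∫⁻ x, ENNReal.ofReal (f x)) * ∫⁻ x, ENNReal.ofReal (g x)
      ≤ (∫⁻ x, ENNReal.ofReal (h x)) ^ 2 := by
  set a := ⨆ x, f x
  set b := ⨆ x, g x
  have ha : 0 < a := by
    obtain ⟨x, hx⟩ := hfp
    exact lt_of_lt_of_le hx (le_ciSup hfb x)
  have hb : 0 < b := by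
    obtain ⟨x, hx⟩ := hgp
    exact lt_of_lt_of_le hx (le_ciSup hgb x)
  set c := √(a * b)
  have hc : 0 < c := Real.sqrt_pos.mpr (mul_pos ha hb)
  have hcc : c ^ 2 = a * b := Real.sq_sqrt (mul_pos ha hb).le
  -- Dividing `f`, `g`, `h` by `a`, `b` and `√(a b)` normalises both suprema to `1` and preserves
  -- the midpoint hypothesis. The additive inequality becomes multiplicative by the
  -- arithmetic-geometric mean inequality.
  have key := lintegral_add_le_two_mul (f := fun x => a⁻¹ * f x) (g := fun x => b⁻¹ * g x)
    (h := fun x => c⁻¹ * h x) (by fun_prop) (by fun_prop) (by fun_prop)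
    (fun x => mul_nonneg (inv_nonneg.2 ha.le) (hf0 x))
    (fun x => mul_nonneg (inv_nonneg.2 hb.le) (hg0 x))
    (fun x => mul_nonneg (inv_nonneg.2 hc.le) (hh0 x))
    (fun x => by rw [inv_mul_le_one₀ ha]; exact le_ciSup hfb x)
    (fun x => by rw [inv_mul_le_one₀ hb]; exact le_ciSup hgb x)
    (fun t ht => by
      obtain ⟨x, hx⟩ := exists_lt_of_lt_ciSup (show a * t < a by nlinarith)
      exact ⟨x, by rw [lt_inv_mul_iff₀ ha]; exact hx⟩)
    (fun t ht => by
      obtain ⟨x, hx⟩ := exists_lt_of_lt_ciSup (show b * t < b by nlinarith)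
      exact ⟨x, by rw [lt_inv_mul_iff₀ hb]; exact hx⟩)
    (fun x y => by
      rw [mul_pow, inv_pow, hcc, mul_inv, mul_mul_mul_comm]
      exact mul_le_mul_of_nonneg_left (hfg x y) (by positivity))
  have key2 := ENNReal.mul_le_sq_of_add_le key
  simp_rw [ENNReal.ofReal_mul (inv_nonneg.2 ha.le), ENNReal.ofReal_mul (inv_nonneg.2 hb.le),
    ENNReal.ofReal_mul (inv_nonneg.2 hc.le)] at key2
  rw [lintegral_const_mul' _ _ (by simp), lintegral_const_mul' _ _ (by simp),
    lintegral_const_mul' _ _ (by simp), mul_pow, mul_mul_mul_comm,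
    ← ENNReal.ofReal_mul (inv_nonneg.2 ha.le), ← ENNReal.ofReal_pow (inv_nonneg.2 hc.le),
    inv_pow, hcc, mul_inv] at key2
  have hne : ENNReal.ofReal (a⁻¹ * b⁻¹) ≠ 0 := by
    rw [ne_eq, ENNReal.ofReal_eq_zero, not_le]; positivity
  exact (ENNReal.mul_le_mul_iff_right hne (by simp)).1 key2

/-- Maurey's property `(τ)` of the Gaussian measure on the line. -/
theorem gaussianReal_lintegral_mul_le_one {u v : ℝ → ENNReal} (hu : Measurable u)
    (hv : Measurable v)
    (huv : ∀ x y, u x * v y ≤ ENNReal.ofReal (Real.exp ((x - y) ^ 2 / 4))) :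
    (∫⁻ x, u x ∂gaussianReal 0 1) * ∫⁻ x, v x ∂gaussianReal 0 1 ≤ 1 := by
  by_cases hu0 : ∃ x, u x ≠ 0
  swap
  · push Not at hu0
    simp [hu0]
  by_cases hv0 : ∃ x, v x ≠ 0
  swap
  · push Not at hv0
    simp [hv0]
  obtain ⟨x₀, hx₀⟩ := hu0
  obtain ⟨y₀, hy₀⟩ := hv0
  have hut : ∀ x, u x ≠ ⊤ := by
    intro x hx
    have := huv x y₀
    rw [hx, ENNReal.top_mul hy₀] at this
    simp at this
  have hvt : ∀ x, v x ≠ ⊤ := by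
    intro x hx
    have := huv x₀ x
    rw [hx, ENNReal.mul_top hx₀] at this
    simp at this
  set φ := gaussianPDFReal 0 1
  have hφ : ∀ x, φ x = (√(2 * Real.pi))⁻¹ * Real.exp (-x ^ 2 / 2) := by
    intro x; simp [φ, gaussianPDFReal]
  have hφ0 : ∀ x, 0 < φ x := fun x => gaussianPDFReal_pos _ _ _ (by simp)
  have hφm : Measurable φ := measurable_gaussianPDFReal _ _
  -- By the parallelogram identity `φ x * φ y = φ ((x + y) / 2) ^ 2 * exp (-(x - y) ^ 2 / 4)`, so
  -- the allowed growth of `u x * v y` is exactly compensated.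
  have huv' : ∀ x y, (u x).toReal * φ x * ((v y).toReal * φ y) ≤ φ ((x + y) / 2) ^ 2 := by
    intro x y
    have h1 : (u x).toReal * (v y).toReal ≤ Real.exp ((x - y) ^ 2 / 4) := by
      rw [← ENNReal.toReal_mul]
      exact ENNReal.toReal_le_of_le_ofReal (Real.exp_pos _).le (huv x y)
    calc (u x).toReal * φ x * ((v y).toReal * φ y)
        = (u x).toReal * (v y).toReal * (φ x * φ y) := by ring
      _ ≤ Real.exp ((x - y) ^ 2 / 4) * (φ x * φ y) :=
          mul_le_mul_of_nonneg_right h1 (mul_pos (hφ0 x) (hφ0 y)).le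
      _ = φ ((x + y) / 2) ^ 2 := by
          rw [hφ, hφ, hφ, mul_pow, ← Real.exp_nat_mul, mul_mul_mul_comm, ← Real.exp_add,
            mul_left_comm, ← Real.exp_add, ← sq]
          congr 2
          push_cast
          ring
  have hφsq : ∀ x, φ x ≤ (√(2 * Real.pi))⁻¹ := by
    intro x
    rw [hφ]
    exact mul_le_of_le_one_right (by positivity) (by
      rw [Real.exp_le_one_iff]; nlinarith [sq_nonneg x])
  have hφsq2 : ∀ x, φ x ^ 2 ≤ (√(2 * Real.pi))⁻¹ ^ 2 := fun x =>
    pow_le_pow_left₀ (hφ0 x).le (hφsq x) 2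
  have hup : 0 < (u x₀).toReal * φ x₀ := mul_pos (ENNReal.toReal_pos hx₀ (hut _)) (hφ0 _)
  have hvp : 0 < (v y₀).toReal * φ y₀ := mul_pos (ENNReal.toReal_pos hy₀ (hvt _)) (hφ0 _)
  have hint : ∀ w : ℝ → ENNReal, Measurable w → (∀ x, w x ≠ ⊤) →
      ∫⁻ x, w x ∂gaussianReal 0 1 = ∫⁻ x, ENNReal.ofReal ((w x).toReal * φ x) := by
    intro w hw hwt
    rw [gaussianReal_of_var_ne_zero _ (by simp),
      lintegral_withDensity_eq_lintegral_mul _ (measurable_gaussianPDF _ _) hw]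
    refine lintegral_congr fun x => ?_
    rw [ENNReal.ofReal_mul ENNReal.toReal_nonneg, ENNReal.ofReal_toReal (hwt x), mul_comm]
    rfl
  rw [hint u hu hut, hint v hv hvt]
  refine (lintegral_mul_lintegral_le_sq (h := φ) (by fun_prop) (by fun_prop) hφm
    (fun x => mul_nonneg ENNReal.toReal_nonneg (hφ0 x).le)
    (fun x => mul_nonneg ENNReal.toReal_nonneg (hφ0 x).le) (fun x => (hφ0 x).le) ?_ ?_
    ⟨x₀, hup⟩ ⟨y₀, hvp⟩ huv').trans ?_
  -- Fixing a point where the other function is positive turns the midpoint inequality into an upper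
  -- bound for this one.
  · refine ⟨(√(2 * Real.pi))⁻¹ ^ 2 / ((v y₀).toReal * φ y₀), ?_⟩
    rintro _ ⟨x, rfl⟩
    rw [le_div_iff₀ hvp]
    exact (huv' x y₀).trans (hφsq2 _)
  · refine ⟨(√(2 * Real.pi))⁻¹ ^ 2 / ((u x₀).toReal * φ x₀), ?_⟩
    rintro _ ⟨y, rfl⟩
    rw [le_div_iff₀ hup, mul_comm]
    exact (huv' x₀ y).trans (hφsq2 _)
  · have : ∫⁻ x, ENNReal.ofReal (φ x) = 1 := lintegral_gaussianPDFReal_eq_one 0 (by simp)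
    rw [this]
    simp

end SpinGlass

/-! ### Property `(τ)` for product Gaussian measures. -/

namespace SpinGlass

/-- The standard Gaussian measure on `ι → ℝ`. -/
noncomputable abbrev stdGaussianPi (ι : Type*) [Fintype ι] : Measure (ι → ℝ) :=
  Measure.pi fun _ => gaussianReal 0 1

theorem stdGaussianPi_lintegral_fin_succ {n : ℕ} {w : (Fin (n + 1) → ℝ) → ENNReal}
    (hw : Measurable w) :
    ∫⁻ x, w x ∂stdGaussianPi (Fin (n + 1))
      = ∫⁻ a, ∫⁻ x, w (Fin.cons a x) ∂stdGaussianPi (Fin n) ∂gaussianReal 0 1 := by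
  have h := (measurePreserving_piFinSuccAbove (fun _ : Fin (n + 1) => gaussianReal 0 1) 0).symm
  rw [← h.lintegral_comp hw, lintegral_prod _ (by
    exact (hw.comp h.measurable).aemeasurable)]
  refine lintegral_congr fun a => lintegral_congr fun x => congrArg w ?_
  exact Fin.insertNth_zero' a x

/-- Property `(τ)` tensorises. For fixed first coordinates `a`, `b`, the induction hypothesis on the
remaining ones, applied after dividing `u` by `exp ((a - b)² / 4)`, bounds the product of the
partial integrals by that factor. This is the hypothesis of the one-dimensional case. -/
theorem stdGaussianPi_fin_lintegral_mul_le_one (n : ℕ) {u v : (Fin n → ℝ) → ENNReal}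
    (hu : Measurable u) (hv : Measurable v)
    (huv : ∀ x y, u x * v y ≤ ENNReal.ofReal (Real.exp ((∑ i, (x i - y i) ^ 2) / 4))) :
    (∫⁻ x, u x ∂stdGaussianPi (Fin n)) * ∫⁻ x, v x ∂stdGaussianPi (Fin n) ≤ 1 := by
  induction n with
  | zero =>
    rw [stdGaussianPi, Measure.pi_of_empty _ (0 : Fin 0 → ℝ), lintegral_dirac' _ hu,
      lintegral_dirac' _ hv]
    simpa using huv 0 0
  | succ n ih =>
    have hcons : Measurable fun p : ℝ × (Fin n → ℝ) => (Fin.cons p.1 p.2 : Fin (n + 1) → ℝ) := by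
      rw [measurable_pi_iff]
      intro i
      refine Fin.cases ?_ (fun j => ?_) i
      · simpa using measurable_fst
      · simp only [Fin.cons_succ]
        exact (measurable_pi_apply j).comp measurable_snd
    rw [stdGaussianPi_lintegral_fin_succ hu, stdGaussianPi_lintegral_fin_succ hv]
    refine gaussianReal_lintegral_mul_le_one
      (hu.comp hcons).lintegral_prod_right' (hv.comp hcons).lintegral_prod_right' fun a b => ?_
    set E := ENNReal.ofReal (Real.exp ((a - b) ^ 2 / 4))
    have hE0 : E ≠ 0 := by
      simp only [E, ne_eq, ENNReal.ofReal_eq_zero, not_le]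
      exact Real.exp_pos _
    have hEt : E ≠ ⊤ := ENNReal.ofReal_ne_top
    have hca : Measurable fun x : Fin n → ℝ => (Fin.cons a x : Fin (n + 1) → ℝ) :=
      hcons.comp measurable_prodMk_left
    have hcb : Measurable fun x : Fin n → ℝ => (Fin.cons b x : Fin (n + 1) → ℝ) :=
      hcons.comp measurable_prodMk_left
    have key := ih (u := fun x => E⁻¹ * u (Fin.cons a x)) (v := fun x => v (Fin.cons b x))
      ((hu.comp hca).const_mul _) (hv.comp hcb) fun x y => by
        have := huv (Fin.cons a x) (Fin.cons b y)
        rw [mul_assoc]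
        simp only [Fin.sum_univ_succ, Fin.cons_zero, Fin.cons_succ, add_div, Real.exp_add] at this
        rw [ENNReal.ofReal_mul (Real.exp_pos _).le] at this
        calc _ ≤ E⁻¹ * (E * _) := mul_le_mul_right this _
          _ = _ := by rw [← mul_assoc, ENNReal.inv_mul_cancel hE0 hEt, one_mul]
    rw [lintegral_const_mul' _ _ (by simpa using hE0), mul_assoc] at key
    calc _ = E * (E⁻¹ * _) := by rw [← mul_assoc, ENNReal.mul_inv_cancel hE0 hEt, one_mul]
      _ ≤ E * 1 := mul_le_mul_right key _
      _ = E := mul_one _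

theorem stdGaussianPi_lintegral_mul_le_one {ι : Type*} [Fintype ι] {u v : (ι → ℝ) → ENNReal}
    (hu : Measurable u) (hv : Measurable v)
    (huv : ∀ x y, u x * v y ≤ ENNReal.ofReal (Real.exp ((∑ i, (x i - y i) ^ 2) / 4))) :
    (∫⁻ x, u x ∂stdGaussianPi ι) * ∫⁻ x, v x ∂stdGaussianPi ι ≤ 1 := by
  have h := measurePreserving_piCongrLeft (fun _ : ι => gaussianReal 0 1) (Fintype.equivFin ι).symm
  rw [← h.lintegral_comp hu, ← h.lintegral_comp hv]
  refine stdGaussianPi_fin_lintegral_mul_le_one _ (hu.comp h.measurable) (hv.comp h.measurable)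
    fun x y => (huv _ _).trans (le_of_eq ?_)
  congr 3
  rw [← Equiv.sum_comp (Fintype.equivFin ι).symm]
  refine Finset.sum_congr rfl fun i _ => ?_
  simp only [MeasurableEquiv.piCongrLeft, MeasurableEquiv.coe_mk]
  rw [Equiv.piCongrLeft_apply_apply, Equiv.piCongrLeft_apply_apply]

theorem continuous_of_abs_sub_le {ι : Type*} [Fintype ι] {F : (ι → ℝ) → ℝ} {K : ℝ}
    (hF : ∀ x y, |F x - F y| ≤ K * √(∑ i, (x i - y i) ^ 2)) : Continuous F := by
  rw [continuous_iff_continuousAt]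
  intro y
  rw [ContinuousAt, tendsto_iff_dist_tendsto_zero]
  refine squeeze_zero (fun _ => dist_nonneg) (fun x => hF x y) ?_
  have : Continuous fun x : ι → ℝ => K * √(∑ i, (x i - y i) ^ 2) := by fun_prop
  have h := this.tendsto y
  simp only [sub_self, ne_eq, OfNat.ofNat_ne_zero, not_false_eq_true, zero_pow,
    Finset.sum_const_zero, Real.sqrt_zero, mul_zero] at h
  exact h

/-! ### Concentration of Lipschitz functions of Gaussian vectors. -/

section Lipschitz

variable {ι : Type*} [Fintype ι] {F : (ι → ℝ) → ℝ} {K : ℝ}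

/-- Property `(τ)` for `e^{-s²K²} e^{sF}` and `e^{-sF}`. The required pointwise bound is `|s| K d ≤
s² K² + d² / 4` at distance `d`, a completed square. -/
theorem stdGaussianPi_lintegral_exp_mul_le
    (hF : ∀ x y, |F x - F y| ≤ K * √(∑ i, (x i - y i) ^ 2)) (s : ℝ) :
    (∫⁻ x, ENNReal.ofReal (Real.exp (s * F x)) ∂stdGaussianPi ι) *
      ∫⁻ x, ENNReal.ofReal (Real.exp (-(s * F x))) ∂stdGaussianPi ι
        ≤ ENNReal.ofReal (Real.exp (s ^ 2 * K ^ 2)) := by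
  have hFc := continuous_of_abs_sub_le hF
  set E := ENNReal.ofReal (Real.exp (s ^ 2 * K ^ 2))
  have hE0 : E ≠ 0 := by
    simp only [E, ne_eq, ENNReal.ofReal_eq_zero, not_le]
    exact Real.exp_pos _
  have hEt : E ≠ ⊤ := ENNReal.ofReal_ne_top
  have key := stdGaussianPi_lintegral_mul_le_one
    (u := fun x : ι → ℝ => E⁻¹ * ENNReal.ofReal (Real.exp (s * F x)))
    (v := fun x => ENNReal.ofReal (Real.exp (-(s * F x))))
    (by have := hFc.measurable; fun_prop) (by have := hFc.measurable; fun_prop) fun x y => by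
      simp only [E]
      rw [← ENNReal.ofReal_inv_of_pos (Real.exp_pos _), ← Real.exp_neg,
        ← ENNReal.ofReal_mul (Real.exp_pos _).le, ← ENNReal.ofReal_mul (by positivity),
        ← Real.exp_add, ← Real.exp_add]
      refine ENNReal.ofReal_le_ofReal (Real.exp_le_exp.2 ?_)
      set d := √(∑ i, (x i - y i) ^ 2)
      have hd : d ^ 2 = ∑ i, (x i - y i) ^ 2 :=
        Real.sq_sqrt (Finset.sum_nonneg fun i _ => sq_nonneg _)
      rw [← hd]
      have h1 : s * F x - s * F y ≤ |s| * (K * d) := by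
        calc s * F x - s * F y = s * (F x - F y) := by ring
          _ ≤ |s * (F x - F y)| := le_abs_self _
          _ = |s| * |F x - F y| := abs_mul _ _
          _ ≤ _ := mul_le_mul_of_nonneg_left (hF x y) (abs_nonneg _)
      nlinarith [sq_nonneg (d / 2 - |s| * K), sq_abs s]
  rw [lintegral_const_mul' _ _ (by simpa using hE0), mul_assoc] at key
  calc _ = E * (E⁻¹ * _) := by rw [← mul_assoc, ENNReal.mul_inv_cancel hE0 hEt, one_mul]
    _ ≤ E * 1 := mul_le_mul_right key _
    _ = E := mul_one _

/-- The bound on the product of the two exponential integrals needs no prior integrability. As the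
second factor is positive, the first cannot be infinite. -/
theorem stdGaussianPi_integrable_exp (hF : ∀ x y, |F x - F y| ≤ K * √(∑ i, (x i - y i) ^ 2))
    (s : ℝ) : Integrable (fun x => Real.exp (s * F x)) (stdGaussianPi ι) := by
  have hFm := (continuous_of_abs_sub_le hF).measurable
  refine ⟨by fun_prop, ?_⟩
  rw [hasFiniteIntegral_iff_ofReal (.of_forall fun x => (Real.exp_pos _).le)]
  have h := stdGaussianPi_lintegral_exp_mul_le hF s
  by_contra hT
  rw [not_lt, top_le_iff] at hT
  rw [hT, ENNReal.top_mul] at h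
  · simp at h
  · intro h0
    rw [lintegral_eq_zero_iff (by fun_prop)] at h0
    obtain ⟨x, hx⟩ := h0.exists
    simp only [Pi.zero_apply, ENNReal.ofReal_eq_zero] at hx
    exact absurd (Real.exp_pos _) (not_lt.2 hx)

theorem stdGaussianPi_integrable (hF : ∀ x y, |F x - F y| ≤ K * √(∑ i, (x i - y i) ^ 2)) :
    Integrable F (stdGaussianPi ι) := by
  have hFm := (continuous_of_abs_sub_le hF).measurable
  refine ((stdGaussianPi_integrable_exp hF 1).add (stdGaussianPi_integrable_exp hF (-1))).mono'
    hFm.aestronglyMeasurable (.of_forall fun x => ?_)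
  rw [Real.norm_eq_abs, Pi.add_apply]
  have h1 := Real.add_one_le_exp (1 * F x)
  have h2 := Real.add_one_le_exp (-1 * F x)
  have h3 := Real.exp_pos (1 * F x)
  have h4 := Real.exp_pos (-1 * F x)
  rw [abs_le]
  constructor <;> linarith

/-- Jensen's inequality bounds the integral of `e^{-sF}` below by `e^{-s E F}`, which is then moved
to the other side. -/
theorem stdGaussianPi_integral_exp_le (hF : ∀ x y, |F x - F y| ≤ K * √(∑ i, (x i - y i) ^ 2))
    (s : ℝ) :
    ∫ x, Real.exp (s * F x) ∂stdGaussianPi ι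
      ≤ Real.exp (s * (∫ x, F x ∂stdGaussianPi ι) + s ^ 2 * K ^ 2) := by
  have hi := stdGaussianPi_integrable hF
  have h1 := stdGaussianPi_integrable_exp hF s
  have h2 := stdGaussianPi_integrable_exp hF (-s)
  have h := stdGaussianPi_lintegral_exp_mul_le hF s
  simp_rw [← neg_mul] at h
  rw [← ofReal_integral_eq_lintegral_ofReal h1 (.of_forall fun x => (Real.exp_pos _).le),
    ← ofReal_integral_eq_lintegral_ofReal h2 (.of_forall fun x => (Real.exp_pos _).le),
    ← ENNReal.ofReal_mul (integral_nonneg fun x => (Real.exp_pos _).le),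
    ENNReal.ofReal_le_ofReal_iff (Real.exp_pos _).le] at h
  have hJ : Real.exp (-s * ∫ x, F x ∂stdGaussianPi ι) ≤ ∫ x, Real.exp (-s * F x) ∂stdGaussianPi ι := by
    rw [← integral_const_mul]
    exact convexOn_exp.map_integral_le Real.continuous_exp.continuousOn isClosed_univ
      (.of_forall fun _ => Set.mem_univ _) (hi.const_mul _) h2
  have hpos : 0 ≤ ∫ x, Real.exp (s * F x) ∂stdGaussianPi ι :=
    integral_nonneg fun x => (Real.exp_pos _).le
  have h3 := (mul_le_mul_of_nonneg_left hJ hpos).trans h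
  rw [neg_mul, Real.exp_neg, ← div_eq_mul_inv, div_le_iff₀ (Real.exp_pos _), ← Real.exp_add] at h3
  rwa [add_comm]

theorem stdGaussianPi_measureReal_lt_le (hK : 0 < K)
    (hF : ∀ x y, |F x - F y| ≤ K * √(∑ i, (x i - y i) ^ 2)) {t : ℝ} (ht : 0 ≤ t) :
    (stdGaussianPi ι).real {x | t < F x - ∫ y, F y ∂stdGaussianPi ι}
      ≤ Real.exp (-(t ^ 2 / (4 * K ^ 2))) := by
  set m := ∫ y, F y ∂stdGaussianPi ι
  -- Chernoff's method: this `s` minimises the exponent `s² K² - s t`, with value `-t² / (4 K²)`.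
  set s := t / (2 * K ^ 2)
  have hs : 0 ≤ s := by positivity
  have h1 := stdGaussianPi_integrable_exp hF s
  have hM := mul_meas_ge_le_integral_of_nonneg (.of_forall fun x => (Real.exp_pos _).le) h1
    (Real.exp (s * (t + m)))
  have hsub : (stdGaussianPi ι).real {x | t < F x - m}
      ≤ (stdGaussianPi ι).real {x | Real.exp (s * (t + m)) ≤ Real.exp (s * F x)} := by
    refine measureReal_mono fun x (hx : t < F x - m) => Real.exp_le_exp.2 ?_
    exact mul_le_mul_of_nonneg_left (by linarith) hs
  have h2 := hM.trans (stdGaussianPi_integral_exp_le hF s)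
  rw [← le_div_iff₀' (Real.exp_pos _), ← Real.exp_sub] at h2
  refine hsub.trans (h2.trans (le_of_eq ?_))
  congr 1
  simp only [s]
  field_simp
  ring

/-- Gaussian concentration for functions that are Lipschitz for the Euclidean norm. -/
theorem stdGaussianPi_measureReal_lt_abs_le (hK : 0 ≤ K)
    (hF : ∀ x y, |F x - F y| ≤ K * √(∑ i, (x i - y i) ^ 2)) {t : ℝ} (ht : 0 ≤ t) :
    (stdGaussianPi ι).real {x | t < |F x - ∫ y, F y ∂stdGaussianPi ι|}
      ≤ 2 * Real.exp (-(t ^ 2 / (4 * K ^ 2))) := by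
  -- For `K = 0` the quotient in the exponent is `0` by convention, so the right-hand side is `2`.
  -- This case covers graphs without edges.
  rcases hK.eq_or_lt with rfl | hK
  · refine measureReal_le_one.trans ?_
    simp
  have h1 := stdGaussianPi_measureReal_lt_le hK hF ht
  have h2 := stdGaussianPi_measureReal_lt_le (F := fun x => -F x) hK (fun x y => by
    rw [neg_sub_neg, abs_sub_comm]; exact hF x y) ht
  rw [integral_neg] at h2
  have hsub : {x | t < |F x - ∫ y, F y ∂stdGaussianPi ι|}
      ⊆ {x | t < F x - ∫ y, F y ∂stdGaussianPi ι} ∪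
        {x | t < -F x - -∫ y, F y ∂stdGaussianPi ι} := by
    intro x hx
    rcases lt_abs.1 (show t < |_| from hx) with h | h
    · exact Or.inl h
    · exact Or.inr (show t < _ by linarith)
  refine (measureReal_mono hsub).trans ((measureReal_union_le _ _).trans ?_)
  linarith

end Lipschitz

end SpinGlass

namespace SpinGlass

/-! ### Spectral measures are Lipschitz functions of the matrix -/

section Spectral

variable {κ : Type*} [Fintype κ] [DecidableEq κ]

theorem integral_spectralMeasure [Nonempty κ] {A : Matrix κ κ ℂ} (hA : A.IsHermitian)
    {E : Type*} [NormedAddCommGroup E] [NormedSpace ℝ E] [CompleteSpace E]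
    (f : ℝ → E) :
    ∫ x, f x ∂(spectralMeasure hA : Measure ℝ)
      = (Fintype.card κ : ℝ)⁻¹ • ∑ i, f (hA.eigenvalues i) := by
  have hf : ∀ i ∈ Finset.univ, Integrable f (Measure.dirac (hA.eigenvalues i)) := fun i _ =>
    integrable_dirac (by simp [enorm_lt_top])
  change ∫ x, f x ∂((Fintype.card κ : ENNReal)⁻¹ • ∑ i, Measure.dirac (hA.eigenvalues i)) = _
  rw [integral_smul_measure, integral_finsetSum_measure hf]
  simp

theorem integrable_spectralMeasure [Nonempty κ] {A : Matrix κ κ ℂ} (hA : A.IsHermitian)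
    {E : Type*} [NormedAddCommGroup E] (f : ℝ → E) :
    Integrable f (spectralMeasure hA : Measure ℝ) := by
  change Integrable f ((Fintype.card κ : ENNReal)⁻¹ • ∑ i, Measure.dirac (hA.eigenvalues i))
  refine Integrable.smul_measure ?_ (by simp)
  rw [integrable_finsetSum_measure]
  exact fun i _ => integrable_dirac (by simp [enorm_lt_top])

omit [DecidableEq κ] in
theorem trace_mul_conjTranspose_eq_sum (A : Matrix κ κ ℂ) :
    (A * A.conjTranspose).trace = ((∑ i, ∑ j, ‖A i j‖ ^ 2 : ℝ) : ℂ) := by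
  simp only [Matrix.trace, Matrix.diag, Matrix.mul_apply, Matrix.conjTranspose_apply]
  push_cast
  refine Finset.sum_congr rfl fun i _ => Finset.sum_congr rfl fun j _ => ?_
  exact Complex.mul_conj' (A i j)

theorem sum_norm_sq_eq_one_of_mem_unitary {W : Matrix κ κ ℂ} (hW : W * W.conjTranspose = 1)
    (i : κ) : ∑ j, ‖W i j‖ ^ 2 = 1 := by
  have h := congrFun (congrFun hW i) i
  rw [Matrix.mul_apply, Matrix.one_apply_eq] at h
  have h2 : ((∑ j, ‖W i j‖ ^ 2 : ℝ) : ℂ) = 1 := by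
    rw [← h]
    push_cast
    refine Finset.sum_congr rfl fun j _ => ?_
    rw [Matrix.conjTranspose_apply]
    exact (Complex.mul_conj' (W i j)).symm
  exact_mod_cast h2

theorem exists_unitary_diagonalization {A : Matrix κ κ ℂ} (hA : A.IsHermitian) :
    ∃ U : Matrix κ κ ℂ, U.conjTranspose * U = 1 ∧ U * U.conjTranspose = 1 ∧
      A = U * Matrix.diagonal (fun i => (hA.eigenvalues i : ℂ)) * U.conjTranspose :=
  ⟨hA.eigenvectorUnitary, Unitary.coe_star_mul_self hA.eigenvectorUnitary,
    Unitary.coe_mul_star_self hA.eigenvectorUnitary, hA.spectral_theorem⟩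

/-- The overlaps of eigenbases of two Hermitian matrices form a doubly stochastic matrix, and
they couple the two spectra with quadratic cost at most the Frobenius distance. -/
theorem exists_spectral_coupling {A B : Matrix κ κ ℂ} (hA : A.IsHermitian) (hB : B.IsHermitian) :
    ∃ w : κ → κ → ℝ, (∀ i j, 0 ≤ w i j) ∧ (∀ i, ∑ j, w i j = 1) ∧ (∀ j, ∑ i, w i j = 1) ∧
      ∑ i, ∑ j, w i j * (hA.eigenvalues i - hB.eigenvalues j) ^ 2
        = ∑ i, ∑ j, ‖(A - B) i j‖ ^ 2 := by
  obtain ⟨U, hU1, hU2, hAd⟩ := exists_unitary_diagonalization hA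
  obtain ⟨V, hV1, hV2, hBd⟩ := exists_unitary_diagonalization hB
  set W := U.conjTranspose * V
  have hW1 : W * W.conjTranspose = 1 := by
    simp only [W, Matrix.conjTranspose_mul, Matrix.conjTranspose_conjTranspose]
    rw [Matrix.mul_assoc, ← Matrix.mul_assoc V, hV2, Matrix.one_mul, hU1]
  have hW2 : W.conjTranspose * W = 1 := by
    simp only [W, Matrix.conjTranspose_mul, Matrix.conjTranspose_conjTranspose]
    rw [Matrix.mul_assoc, ← Matrix.mul_assoc U, hU2, Matrix.one_mul, hV1]
  refine ⟨fun i j => ‖W i j‖ ^ 2, fun i j => by positivity,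
    sum_norm_sq_eq_one_of_mem_unitary hW1, fun j => ?_, ?_⟩
  · have := sum_norm_sq_eq_one_of_mem_unitary (W := W.conjTranspose)
      (by rw [Matrix.conjTranspose_conjTranspose]; exact hW2) j
    simpa [Matrix.conjTranspose_apply] using this
  -- `X` is `A - B` written in an eigenbasis of `A` on the left and of `B` on the right. Its entries
  -- are `W i j (a_i - b_j)`, and unitarity preserves the Frobenius norm.
  · set X := U.conjTranspose * (A - B) * V
    have hX : X = Matrix.diagonal (fun i => (hA.eigenvalues i : ℂ)) * W
        - W * Matrix.diagonal (fun i => (hB.eigenvalues i : ℂ)) := by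
      simp only [X, W, Matrix.mul_sub, Matrix.sub_mul]
      congr 1
      · conv_lhs => rw [hAd]
        simp only [← Matrix.mul_assoc]
        rw [hU1, Matrix.one_mul]
      · conv_lhs => rw [hBd]
        simp only [Matrix.mul_assoc]
        rw [hV1, Matrix.mul_one]
    have hXe : ∀ i j, ‖X i j‖ ^ 2 = ‖W i j‖ ^ 2 * (hA.eigenvalues i - hB.eigenvalues j) ^ 2 := by
      intro i j
      rw [hX, Matrix.sub_apply, Matrix.diagonal_mul, Matrix.mul_diagonal]
      have : (hA.eigenvalues i : ℂ) * W i j - W i j * (hB.eigenvalues j : ℂ)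
          = W i j * ((hA.eigenvalues i - hB.eigenvalues j : ℝ) : ℂ) := by
        push_cast; ring
      rw [this, norm_mul, mul_pow, Complex.norm_real, Real.norm_eq_abs, sq_abs]
    have htr : (X * X.conjTranspose).trace = ((A - B) * (A - B).conjTranspose).trace := by
      have : X * X.conjTranspose = U.conjTranspose * ((A - B) * (A - B).conjTranspose) * U := by
        simp only [X, Matrix.conjTranspose_mul, Matrix.conjTranspose_conjTranspose]
        simp only [Matrix.mul_assoc]
        rw [← Matrix.mul_assoc V, hV2, Matrix.one_mul]
      rw [this, Matrix.trace_mul_comm, ← Matrix.mul_assoc, hU2, Matrix.one_mul]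
    rw [trace_mul_conjTranspose_eq_sum, trace_mul_conjTranspose_eq_sum] at htr
    have htr' := Complex.ofReal_injective htr
    rw [← htr']
    exact Finset.sum_congr rfl fun i _ => Finset.sum_congr rfl fun j _ => (hXe i j).symm

/-- The doubly stochastic coupling acts as a transport plan between the two spectra, and
Cauchy-Schwarz passes from its linear to its quadratic cost. This weak form of the Hoffman-Wielandt
inequality needs no ordering of eigenvalues and no optimal matching. -/
theorem abs_integral_spectralMeasure_sub_le [Nonempty κ] {A B : Matrix κ κ ℂ}
    (hA : A.IsHermitian) (hB : B.IsHermitian) {f : ℝ → ℝ} {K : ℝ} (hK : 0 ≤ K)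
    (hf : ∀ x y, |f x - f y| ≤ K * |x - y|) :
    |(∫ x, f x ∂(spectralMeasure hA : Measure ℝ)) - ∫ x, f x ∂(spectralMeasure hB : Measure ℝ)|
      ≤ K * √((Fintype.card κ : ℝ)⁻¹ * ∑ i, ∑ j, ‖(A - B) i j‖ ^ 2) := by
  obtain ⟨w, hw0, hw1, hw2, hw⟩ := exists_spectral_coupling hA hB
  set N : ℝ := (Fintype.card κ : ℝ)
  have hN : 0 < N := by simp [N, Fintype.card_pos]
  set a := hA.eigenvalues
  set b := hB.eigenvalues
  rw [integral_spectralMeasure, integral_spectralMeasure, ← smul_sub, smul_eq_mul, abs_mul,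
    abs_of_pos (inv_pos.2 hN), ← hw]
  have h1 : (∑ i, f (a i)) - ∑ j, f (b j) = ∑ i, ∑ j, w i j * (f (a i) - f (b j)) := by
    simp_rw [mul_sub, Finset.sum_sub_distrib, ← Finset.sum_mul, hw1, one_mul]
    rw [Finset.sum_comm]
    simp_rw [← Finset.sum_mul, hw2, one_mul]
  have h2 : |(∑ i, f (a i)) - ∑ j, f (b j)| ≤ K * ∑ i, ∑ j, w i j * |a i - b j| := by
    rw [h1, Finset.mul_sum]
    refine (Finset.abs_sum_le_sum_abs _ _).trans (Finset.sum_le_sum fun i _ => ?_)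
    rw [Finset.mul_sum]
    refine (Finset.abs_sum_le_sum_abs _ _).trans (Finset.sum_le_sum fun j _ => ?_)
    rw [abs_mul, abs_of_nonneg (hw0 i j)]
    nlinarith [hf (a i) (b j), hw0 i j, mul_le_mul_of_nonneg_left (hf (a i) (b j)) (hw0 i j)]
  -- Cauchy-Schwarz for the weights `w`, whose total mass is `N`.
  have h3 : (∑ i, ∑ j, w i j * |a i - b j|) ≤ √(N * ∑ i, ∑ j, w i j * (a i - b j) ^ 2) := by
    refine Real.le_sqrt_of_sq_le ?_
    have hcs := Finset.sum_mul_sq_le_sq_mul_sq (Finset.univ : Finset (κ × κ))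
      (fun p => √(w p.1 p.2)) (fun p => √(w p.1 p.2) * |a p.1 - b p.2|)
    simp only [← mul_assoc, Real.mul_self_sqrt (hw0 _ _), mul_pow, Real.sq_sqrt (hw0 _ _), sq_abs,
      Fintype.sum_prod_type, hw1] at hcs
    simpa [N] using hcs
  calc N⁻¹ * |(∑ i, f (a i)) - ∑ j, f (b j)|
      ≤ N⁻¹ * (K * √(N * ∑ i, ∑ j, w i j * (a i - b j) ^ 2)) :=
        mul_le_mul_of_nonneg_left (h2.trans (mul_le_mul_of_nonneg_left h3 hK)) (inv_pos.2 hN).le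
    _ = K * √(N⁻¹ * ∑ i, ∑ j, w i j * (a i - b j) ^ 2) := by
        have : N⁻¹ * ∑ i, ∑ j, w i j * (a i - b j) ^ 2
            = N⁻¹ ^ 2 * (N * ∑ i, ∑ j, w i j * (a i - b j) ^ 2) := by
          field_simp
        rw [this, Real.sqrt_mul (sq_nonneg N⁻¹), Real.sqrt_sq (inv_pos.2 hN).le]
        ring

end Spectral

theorem bddAbove_dBL_set (μ ν : ProbabilityMeasure ℝ) :
    BddAbove {r : ℝ | ∃ (f : ℝ → ℝ) (M L : NNReal), (∀ x, |f x| ≤ M) ∧ LipschitzWith L f ∧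
      M + L ≤ 1 ∧ r = |(∫ x, f x ∂(μ : Measure ℝ)) - ∫ x, f x ∂(ν : Measure ℝ)|} := by
  refine ⟨2, ?_⟩
  rintro r ⟨f, M, L, hM, -, hML, rfl⟩
  have hM1 : (M : ℝ) ≤ 1 := by
    have : M ≤ 1 := le_trans (le_add_of_nonneg_right (zero_le)) hML
    exact_mod_cast this
  have hb : ∀ ρ : ProbabilityMeasure ℝ, |∫ x, f x ∂(ρ : Measure ℝ)| ≤ 1 := fun ρ => by
    have h := norm_integral_le_of_norm_le_const (μ := (ρ : Measure ℝ)) (f := f) (C := M)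
      (.of_forall hM)
    simp only [probReal_univ, mul_one] at h
    exact h.trans hM1
  calc _ ≤ |∫ x, f x ∂(μ : Measure ℝ)| + |∫ x, f x ∂(ν : Measure ℝ)| := abs_sub _ _
    _ ≤ 2 := by linarith [hb μ, hb ν]

theorem dBL_le_add {μ ν ρ : ProbabilityMeasure ℝ} {D : ℝ}
    (h : ∀ f : ℝ → ℝ, (∀ x y, |f x - f y| ≤ 1 * |x - y|) →
      |(∫ x, f x ∂(μ : Measure ℝ)) - ∫ x, f x ∂(ν : Measure ℝ)| ≤ D) :
    dBL μ ρ ≤ D + dBL ν ρ := by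
  refine csSup_le ⟨0, fun _ => 0, 0, 0, by simp, LipschitzWith.const' 0, by simp, by simp⟩ ?_
  rintro r ⟨f, M, L, hM, hL, hML, rfl⟩
  have h1 := h f fun x y => by
    have hL1 : (L : ℝ) ≤ 1 := by
      have : L ≤ 1 := le_trans (le_add_of_nonneg_left (zero_le)) hML
      exact_mod_cast this
    have := hL.dist_le_mul x y
    rw [Real.dist_eq, Real.dist_eq] at this
    exact this.trans (mul_le_mul_of_nonneg_right hL1 (abs_nonneg _))
  have h2 := le_csSup (bddAbove_dBL_set ν ρ) ⟨f, M, L, hM, hL, hML, rfl⟩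
  exact (abs_sub_le _ _ _).trans (add_le_add h1 h2)

theorem abs_dBL_sub_le {μ ν ρ : ProbabilityMeasure ℝ} {D : ℝ}
    (h : ∀ f : ℝ → ℝ, (∀ x y, |f x - f y| ≤ 1 * |x - y|) →
      |(∫ x, f x ∂(μ : Measure ℝ)) - ∫ x, f x ∂(ν : Measure ℝ)| ≤ D) :
    |dBL μ ρ - dBL ν ρ| ≤ D := by
  rw [abs_sub_le_iff]
  constructor
  · linarith [dBL_le_add (ρ := ρ) h]
  · have := dBL_le_add (μ := ν) (ν := μ) (ρ := ρ) fun f hf => by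
      rw [abs_sub_comm]; exact h f hf
    linarith

/-! ### Families of commuting or anticommuting spin operators -/

/-- A family of trace-orthogonal Hermitian involutions that commute up to the signs `ε`. -/
structure IsSpinFamily {ι κ : Type*} [DecidableEq ι] [Fintype κ] [DecidableEq κ]
    (S : ι → Matrix κ κ ℂ) (ε : ι → ι → ℝ) : Prop where
  isHermitian : ∀ c, (S c).IsHermitian
  mul_self : ∀ c, S c * S c = 1
  mul_comm : ∀ c d, S d * S c = (ε c d : ℂ) • (S c * S d)
  trace_mul : ∀ c d, (S c * S d).trace = if c = d then (Fintype.card κ : ℂ) else 0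

section SpinFamily

variable {ι κ : Type*} [Fintype ι] [DecidableEq ι] [Fintype κ] [DecidableEq κ]

/-- The Hamiltonian with coefficients `x`, normalised by the number of terms. -/
noncomputable def spinHamiltonian (S : ι → Matrix κ κ ℂ) (x : ι → ℝ) : Matrix κ κ ℂ :=
  (1 / √(Fintype.card ι : ℝ)) • ∑ c, x c • S c

variable {S : ι → Matrix κ κ ℂ} {ε : ι → ι → ℝ}

theorem IsSpinFamily.hamiltonian_isHermitian (hS : IsSpinFamily S ε) (x : ι → ℝ) :
    (spinHamiltonian S x).IsHermitian :=
  real_smul_isHermitian (sum_isHermitian fun c => real_smul_isHermitian (hS.isHermitian c) _) _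

omit [DecidableEq ι] [Fintype κ] [DecidableEq κ] in
theorem spinHamiltonian_sub (S : ι → Matrix κ κ ℂ) (x y : ι → ℝ) :
    spinHamiltonian S x - spinHamiltonian S y = spinHamiltonian S (x - y) := by
  simp [spinHamiltonian, ← smul_sub, ← Finset.sum_sub_distrib, ← sub_smul]

/-- Trace orthogonality kills the cross terms, so the Hamiltonian is a scaled isometric image of its
coefficient vector. The Lipschitz constant `M^{-1/2}` has its origin here. -/
theorem IsSpinFamily.sum_norm_sq_hamiltonian (hS : IsSpinFamily S ε) (x : ι → ℝ) :
    ∑ i, ∑ j, ‖spinHamiltonian S x i j‖ ^ 2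
      = Fintype.card κ * ((1 / √(Fintype.card ι : ℝ)) ^ 2 * ∑ c, x c ^ 2) := by
  have h := trace_mul_conjTranspose_eq_sum (spinHamiltonian S x)
  rw [(hS.hamiltonian_isHermitian x).eq] at h
  have h2 : (spinHamiltonian S x * spinHamiltonian S x).trace
      = ((Fintype.card κ * ((1 / √(Fintype.card ι : ℝ)) ^ 2 * ∑ c, x c ^ 2) : ℝ) : ℂ) := by
    simp only [spinHamiltonian, Matrix.smul_mul, Matrix.mul_smul, Finset.sum_mul, Finset.mul_sum,
      Matrix.trace_smul, Matrix.trace_sum, hS.trace_mul, smul_ite, smul_zero,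
      Finset.sum_ite_eq', Finset.mem_univ, if_true]
    simp only [Complex.real_smul]
    push_cast
    simp only [Finset.mul_sum]
    refine Finset.sum_congr rfl fun c _ => ?_
    ring
  rw [h2] at h
  exact (Complex.ofReal_injective h).symm

variable [Nonempty κ]

/-- The empirical spectral measure of the Hamiltonian. -/
noncomputable def IsSpinFamily.spectral (hS : IsSpinFamily S ε) (x : ι → ℝ) :
    ProbabilityMeasure ℝ :=
  spectralMeasure (hS.hamiltonian_isHermitian x)

theorem IsSpinFamily.abs_integral_spectral_sub_le (hS : IsSpinFamily S ε) {f : ℝ → ℝ} {K : ℝ}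
    (hK : 0 ≤ K) (hf : ∀ x y, |f x - f y| ≤ K * |x - y|) (x y : ι → ℝ) :
    |(∫ u, f u ∂(hS.spectral x : Measure ℝ)) - ∫ u, f u ∂(hS.spectral y : Measure ℝ)|
      ≤ K * (1 / √(Fintype.card ι : ℝ)) * √(∑ c, (x c - y c) ^ 2) := by
  refine (abs_integral_spectralMeasure_sub_le (hS.hamiltonian_isHermitian x)
    (hS.hamiltonian_isHermitian y) hK hf).trans (le_of_eq ?_)
  rw [spinHamiltonian_sub, hS.sum_norm_sq_hamiltonian, ← mul_assoc (_⁻¹),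
    inv_mul_cancel₀ (by simp [Fintype.card_ne_zero]), one_mul, Real.sqrt_mul (by positivity),
    Real.sqrt_sq (by positivity), mul_assoc]
  rfl

theorem IsSpinFamily.abs_dBL_spectral_sub_le (hS : IsSpinFamily S ε) (ρ : ProbabilityMeasure ℝ)
    (x y : ι → ℝ) :
    |dBL (hS.spectral x) ρ - dBL (hS.spectral y) ρ|
      ≤ 1 / √(Fintype.card ι : ℝ) * √(∑ c, (x c - y c) ^ 2) := by
  refine abs_dBL_sub_le fun f hf => ?_
  have := hS.abs_integral_spectral_sub_le zero_le_one hf x y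
  rwa [one_mul] at this

theorem IsSpinFamily.integral_pow_spectral (hS : IsSpinFamily S ε) (x : ι → ℝ) (k : ℕ) :
    ((∫ u, u ^ k ∂(hS.spectral x : Measure ℝ) : ℝ) : ℂ)
      = (Fintype.card κ : ℂ)⁻¹ * (spinHamiltonian S x ^ k).trace := by
  set hA := hS.hamiltonian_isHermitian x
  obtain ⟨U, hU1, hU2, hAd⟩ := exists_unitary_diagonalization hA
  have hpow : spinHamiltonian S x ^ k
      = U * Matrix.diagonal (fun i => (hA.eigenvalues i : ℂ)) ^ k * U.conjTranspose := by
    induction k with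
    | zero =>
      simp only [pow_zero, Matrix.mul_one]
      exact hU2.symm
    | succ k ih =>
      rw [pow_succ, ih, pow_succ]
      conv_lhs => enter [2]; rw [hAd]
      simp only [Matrix.mul_assoc]
      rw [← Matrix.mul_assoc U.conjTranspose U, hU1, Matrix.one_mul]
  rw [hpow, Matrix.trace_mul_comm, ← Matrix.mul_assoc, hU1, Matrix.one_mul, Matrix.diagonal_pow,
    Matrix.trace_diagonal]
  rw [IsSpinFamily.spectral, integral_spectralMeasure]
  simp

theorem IsSpinFamily.integral_sq_spectral (hS : IsSpinFamily S ε) (x : ι → ℝ) :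
    ∫ u, u ^ 2 ∂(hS.spectral x : Measure ℝ) = (1 / √(Fintype.card ι : ℝ)) ^ 2 * ∑ c, x c ^ 2 := by
  have h := hS.integral_pow_spectral x 2
  have h2 := trace_mul_conjTranspose_eq_sum (spinHamiltonian S x)
  rw [(hS.hamiltonian_isHermitian x).eq, ← sq] at h2
  rw [h2, hS.sum_norm_sq_hamiltonian] at h
  have h3 : (Fintype.card κ : ℂ) ≠ 0 := by simp [Fintype.card_ne_zero]
  rw [Complex.ofReal_mul, Complex.ofReal_natCast, ← mul_assoc, inv_mul_cancel₀ h3, one_mul] at h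
  exact Complex.ofReal_injective h

end SpinFamily

end SpinGlass

namespace SpinGlass

/-! ### Moments of Gaussian spin Hamiltonians -/

/-- The moments of `∑ x_c S_c / √M`, computed recursively by reading the word `H ⋯ H` from the left.
The list `L` contains the pending operators, in the order in which they will be contracted. -/
noncomputable def wickMoment {ι : Type*} [Fintype ι] (ε : ι → ι → ℝ) : ℕ → List ι → ℝ
  | 0, [] => 1
  | 0, _ :: _ => 0
  | k + 1, L => (Fintype.card ι : ℝ)⁻¹ * (∑ c, ∑ i ∈ Finset.range (L.length + 1),
      ((L.take i).map (ε c)).prod * wickMoment ε k (L.insertIdx i c)) +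
      match L with
      | [] => 0
      | _ :: L' => wickMoment ε k L'

section Wick

variable {ι 𝒜 : Type*} [Ring 𝒜]

/-- The sum of all words obtained from `H ^ k` by replacing letters by the operators of a list, in
the given order. -/
def markedPow (H : 𝒜) (S : ι → 𝒜) : ℕ → List ι → 𝒜
  | 0, [] => 1
  | 0, _ :: _ => 0
  | k + 1, [] => H * markedPow H S k []
  | k + 1, c :: L => H * markedPow H S k (c :: L) + S c * markedPow H S k L

theorem markedPow_nil (H : 𝒜) (S : ι → 𝒜) (k : ℕ) : markedPow H S k [] = H ^ k := by
  induction k with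
  | zero => simp [markedPow]
  | succ k ih => rw [markedPow, ih, pow_succ']

variable [Algebra ℂ 𝒜]

/-- By the Leibniz rule `D` replaces the free letters `H` by `r S_c` one at a time. Sorting the
results by the position of the new letter among those already marked gives the insertions into `L`.
-/
theorem map_markedPow {H : 𝒜} {S : ι → 𝒜} {r : ℂ} (c : ι) (D : 𝒜 →ₗ[ℂ] 𝒜)
    (hD : ∀ a b, D (a * b) = D a * b + a * D b) (hH : D H = r • S c) (hS : ∀ d, D (S d) = 0)
    (k : ℕ) (L : List ι) :
    D (markedPow H S k L)
      = r • ∑ i ∈ Finset.range (L.length + 1), markedPow H S k (L.insertIdx i c) := by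
  have h1 : D 1 = 0 := by
    have := hD 1 1
    simpa using this
  induction k generalizing L with
  | zero =>
    -- With no letters left, a list that has received an insertion is nonempty and cannot be placed.
    have h0 : ∀ (L : List ι) (i : ℕ), i ∈ Finset.range (L.length + 1) →
        markedPow H S 0 (L.insertIdx i c) = 0 := by
      intro L i hi
      have hl : (L.insertIdx i c).length = L.length + 1 :=
        List.length_insertIdx_of_le_length (Nat.lt_succ_iff.1 (Finset.mem_range.1 hi)) c
      cases h : L.insertIdx i c with
      | nil => rw [h] at hl; simp at hl
      | cons d L' => rfl
    rw [Finset.sum_eq_zero (h0 L), smul_zero]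
    cases L with
    | nil => exact h1
    | cons d L => exact map_zero D
  | succ k ih =>
    cases L with
    | nil =>
      simp only [markedPow, hD, hH, ih, List.length_nil, zero_add, Finset.sum_range_one,
        List.insertIdx_zero, smul_mul_assoc, mul_smul_comm, smul_add]
      rw [add_comm]
    | cons d L =>
      rw [List.length_cons, Finset.sum_range_succ']
      simp only [markedPow, map_add, hD, hH, hS, ih, List.insertIdx_zero, List.insertIdx_succ_cons,
        zero_mul, zero_add, smul_mul_assoc, mul_smul_comm, ← smul_add, List.length_cons,
        Finset.sum_add_distrib, Finset.mul_sum]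
      congr 1
      rw [Finset.sum_range_succ' (fun i => H * markedPow H S k ((d :: L).insertIdx i c))]
      simp only [List.insertIdx_zero, List.insertIdx_succ_cons]
      abel

/-- The pending operators stand in reverse order, so that the next one to be contracted is adjacent
to the remaining word. Moving `S c` left past the first `i` entries of `L` produces one sign for
each of them. -/
theorem prod_reverse_mul {S : ι → 𝒜} {ε : ι → ι → ℝ}
    (hS : ∀ c d, S d * S c = (ε c d : ℂ) • (S c * S d)) (c : ι) (L : List ι) (i : ℕ)
    (hi : i ≤ L.length) :
    (L.reverse.map S).prod * S c
      = ((((L.take i).map (ε c)).prod : ℝ) : ℂ) • ((L.insertIdx i c).reverse.map S).prod := by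
  induction i generalizing L with
  | zero => simp
  | succ i ih =>
    cases L with
    | nil => simp at hi
    | cons d L =>
      have hi' : i ≤ L.length := by simpa using hi
      simp only [List.reverse_cons, List.map_append, List.map_cons, List.map_nil, List.prod_append,
        List.insertIdx_succ_cons, List.take_succ_cons, List.prod_cons, List.prod_nil, mul_one]
      rw [mul_assoc, hS, mul_smul_comm, ← mul_assoc, ih L hi', smul_mul_assoc, smul_smul]
      push_cast
      rfl

/-- Gaussian integration by parts for the functional `Φ` yields the recursion of `wickMoment`. -/
theorem map_prod_mul_markedPow [Fintype ι] {H : 𝒜} {S : ι → 𝒜} {ε : ι → ι → ℝ} {r : ℂ}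
    (hr : r * r = (Fintype.card ι : ℂ)⁻¹) (D : ι → 𝒜 →ₗ[ℂ] 𝒜)
    (hD : ∀ c a b, D c (a * b) = D c a * b + a * D c b) (hH : ∀ c, D c H = r • S c)
    (hDS : ∀ c d, D c (S d) = 0) (hS1 : ∀ c, S c * S c = 1)
    (hS : ∀ c d, S d * S c = (ε c d : ℂ) • (S c * S d)) (Φ : 𝒜 →ₗ[ℂ] ℂ) (hΦ1 : Φ 1 = 1)
    (hΦ : ∀ (L : List ι) (a : 𝒜), Φ ((L.map S).prod * (H * a))
      = r * ∑ c, Φ ((L.map S).prod * S c * D c a)) (k : ℕ) (L : List ι) :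
    Φ ((L.reverse.map S).prod * markedPow H S k L) = (wickMoment ε k L : ℂ) := by
  induction k generalizing L with
  | zero =>
    cases L with
    | nil => simp [markedPow, wickMoment, hΦ1]
    | cons d L => simp [markedPow, wickMoment]
  | succ k ih =>
    -- The leading `H` contributes an operator `S c` on the left and a second copy, by
    -- differentiation, somewhere in the remaining word. If that copy lies behind `i` marked
    -- letters, the first is commuted to position `i` of the pending list.
    have hmain : Φ ((L.reverse.map S).prod * (H * markedPow H S k L))
        = (((Fintype.card ι : ℝ)⁻¹ * ∑ c, ∑ i ∈ Finset.range (L.length + 1),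
          ((L.take i).map (ε c)).prod * wickMoment ε k (L.insertIdx i c) : ℝ) : ℂ) := by
      rw [hΦ]
      push_cast
      rw [← hr, mul_assoc]
      congr 1
      rw [Finset.mul_sum]
      refine Finset.sum_congr rfl fun c _ => ?_
      rw [map_markedPow c (D c) (hD c) (hH c) (hDS c), mul_smul_comm, map_smul, smul_eq_mul,
        Finset.mul_sum, map_sum]
      congr 1
      refine Finset.sum_congr rfl fun i hi => ?_
      rw [prod_reverse_mul hS c L i (Nat.lt_succ_iff.1 (Finset.mem_range.1 hi)), smul_mul_assoc,
        map_smul, ih, smul_eq_mul]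
    cases L with
    | nil =>
      rw [markedPow, wickMoment, hmain, add_zero]
    | cons d L =>
      rw [markedPow, wickMoment, mul_add, map_add, hmain, Complex.ofReal_add]
      congr 1
      -- The leading letter is the partner of the innermost pending operator, and `S d * S d = 1`
      -- removes the pair.
      rw [← ih, List.reverse_cons, List.map_append, List.prod_append, List.map_singleton,
        List.prod_singleton, mul_assoc, ← mul_assoc (S d), hS1, one_mul]

end Wick

/-! ### Gaussian integration by parts for polynomials -/

theorem integrable_pow_gaussianReal (k : ℕ) :
    Integrable (fun x : ℝ => x ^ k) (gaussianReal 0 1) := by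
  have h := (memLp_id_gaussianReal (μ := 0) (v := 1) (k : NNReal)).integrable_norm_rpow'
  refine h.mono' (by fun_prop) (.of_forall fun x => ?_)
  simp

theorem integral_mul_deriv_gaussianReal {f f' : ℝ → ℝ} (hf : ∀ x, HasDerivAt f (f' x) x)
    (h0 : Integrable f (gaussianReal 0 1)) (h1 : Integrable (fun x => x * f x) (gaussianReal 0 1))
    (h2 : Integrable f' (gaussianReal 0 1)) :
    ∫ x, x * f x ∂gaussianReal 0 1 = ∫ x, f' x ∂gaussianReal 0 1 := by
  set φ := gaussianPDFReal 0 1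
  have hφe : ∀ x, φ x = (√(2 * Real.pi))⁻¹ * Real.exp (-x ^ 2 / 2) := by
    intro x; simp [φ, gaussianPDFReal]
  have hφ : ∀ x, HasDerivAt φ (-x * φ x) x := by
    intro x
    have : HasDerivAt (fun x : ℝ => (√(2 * Real.pi))⁻¹ * Real.exp (-x ^ 2 / 2))
        ((√(2 * Real.pi))⁻¹ * (Real.exp (-x ^ 2 / 2) * (-(2 * x) / 2))) x := by
      refine ((HasDerivAt.exp ?_).const_mul _)
      simpa using ((hasDerivAt_pow 2 x).neg.div_const 2)
    have e : φ = fun x : ℝ => (√(2 * Real.pi))⁻¹ * Real.exp (-x ^ 2 / 2) := funext hφe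
    rw [e]
    convert this using 1
    ring
  have hint : ∀ g : ℝ → ℝ, Integrable g (gaussianReal 0 1) → Integrable (fun x => g x * φ x) := by
    intro g hg
    rw [gaussianReal_of_var_ne_zero _ (by simp), integrable_withDensity_iff_integrable_smul'
      (measurable_gaussianPDF _ _) (.of_forall fun x => gaussianPDF_lt_top)] at hg
    refine hg.congr (.of_forall fun x => ?_)
    simp only [toReal_gaussianPDF, smul_eq_mul]
    exact mul_comm _ _
  have key := integral_mul_deriv_eq_deriv_mul_of_integrable (u := f) (v := φ) (u' := f')
    (v' := fun x => -x * φ x) (fun x _ => hf x) (fun x _ => hφ x)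
    ((hint _ h1).neg.congr (.of_forall fun x => by simp; ring)) (hint _ h2) (hint _ h0)
  rw [integral_gaussianReal_eq_integral_smul (by simp),
    integral_gaussianReal_eq_integral_smul (by simp)]
  simp only [smul_eq_mul]
  have e1 : (∫ x, φ x * (x * f x)) = -∫ x, f x * (-x * φ x) := by
    rw [← integral_neg]
    exact integral_congr_ae (.of_forall fun x => by simp; ring)
  have e2 : (∫ x, φ x * f' x) = ∫ x, f' x * φ x :=
    integral_congr_ae (.of_forall fun x => mul_comm _ _)
  change (∫ x, φ x * (x * f x)) = ∫ x, φ x * f' x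
  rw [e1, key, neg_neg, e2]

/-- At `k = 0` the truncated exponent `k - 1` is harmless, since its coefficient vanishes. -/
theorem integral_pow_succ_gaussianReal (k : ℕ) :
    ∫ x, x ^ (k + 1) ∂gaussianReal 0 1 = k * ∫ x, x ^ (k - 1) ∂gaussianReal 0 1 := by
  have h := integral_mul_deriv_gaussianReal (f := fun x => x ^ k) (f' := fun x => k * x ^ (k - 1))
    (fun x => hasDerivAt_pow k x) (integrable_pow_gaussianReal k)
    ((integrable_pow_gaussianReal (k + 1)).congr (.of_forall fun x => pow_succ' x k))
    ((integrable_pow_gaussianReal (k - 1)).const_mul _)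
  rw [integral_const_mul] at h
  rw [← h]
  exact integral_congr_ae (.of_forall fun x => pow_succ' x k)

section GaussianPolynomial

variable {ι : Type*} [Fintype ι]

theorem eval_monomial_ofReal (m : ι →₀ ℕ) (a : ℂ) (x : ι → ℝ) :
    MvPolynomial.eval (fun c => (x c : ℂ)) (MvPolynomial.monomial m a)
      = a * ∏ c, ((x c ^ m c : ℝ) : ℂ) := by
  rw [MvPolynomial.eval_monomial, Finsupp.prod_fintype _ _ (by simp)]
  push_cast
  rfl

theorem integrable_eval_stdGaussianPi (p : MvPolynomial ι ℂ) :
    Integrable (fun x : ι → ℝ => MvPolynomial.eval (fun c => (x c : ℂ)) p) (stdGaussianPi ι) := by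
  induction p using MvPolynomial.induction_on' with
  | monomial m a =>
    simp only [eval_monomial_ofReal]
    refine Integrable.const_mul ?_ _
    exact Integrable.fintype_prod (f := fun c (y : ℝ) => ((y ^ m c : ℝ) : ℂ))
      fun c => (integrable_pow_gaussianReal (m c)).ofReal
  | add p q hp hq =>
    simp only [map_add]
    exact hp.add hq

/-- The expectation of a polynomial in independent standard Gaussian variables. -/
noncomputable def gaussianExpectation (ι : Type*) [Fintype ι] : MvPolynomial ι ℂ →ₗ[ℂ] ℂ where
  toFun p := ∫ x : ι → ℝ, MvPolynomial.eval (fun c => (x c : ℂ)) p ∂stdGaussianPi ι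
  map_add' p q := by
    simp only [map_add]
    exact integral_add (integrable_eval_stdGaussianPi p) (integrable_eval_stdGaussianPi q)
  map_smul' a p := by
    simp only [MvPolynomial.smul_eval, RingHom.id_apply, smul_eq_mul]
    exact integral_const_mul _ _

theorem gaussianExpectation_monomial (m : ι →₀ ℕ) (a : ℂ) :
    gaussianExpectation ι (MvPolynomial.monomial m a)
      = a * ∏ c, ((∫ y, y ^ m c ∂gaussianReal 0 1 : ℝ) : ℂ) := by
  change ∫ x : ι → ℝ, MvPolynomial.eval (fun c => (x c : ℂ)) (MvPolynomial.monomial m a)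
    ∂stdGaussianPi ι = _
  simp only [eval_monomial_ofReal]
  rw [integral_const_mul]
  congr 1
  rw [stdGaussianPi, integral_fintype_prod_eq_prod (f := fun c (y : ℝ) => ((y ^ m c : ℝ) : ℂ))]
  exact Finset.prod_congr rfl fun c _ => integral_ofReal

/-- By linearity a monomial suffices. Independence factorises its expectation, and only the factor
of the variable `c` changes, through the one-dimensional moment recursion. -/
theorem gaussianExpectation_X_mul [DecidableEq ι] (c : ι) (p : MvPolynomial ι ℂ) :
    gaussianExpectation ι (MvPolynomial.X c * p)
      = gaussianExpectation ι (MvPolynomial.pderiv c p) := by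
  induction p using MvPolynomial.induction_on' with
  | monomial m a =>
    rw [MvPolynomial.pderiv_monomial, mul_comm, MvPolynomial.X, MvPolynomial.monomial_mul, mul_one,
      gaussianExpectation_monomial, gaussianExpectation_monomial, mul_assoc]
    congr 1
    rw [← Finset.mul_prod_erase _ _ (Finset.mem_univ c),
      ← Finset.mul_prod_erase _ _ (Finset.mem_univ c), ← mul_assoc]
    congr 1
    · simp only [Finsupp.add_apply, Finsupp.single_eq_same, Finsupp.tsub_apply]
      rw [integral_pow_succ_gaussianReal]
      push_cast
      rfl
    · refine Finset.prod_congr rfl fun d hd => ?_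
      have : d ≠ c := Finset.ne_of_mem_erase hd
      simp [this.symm]
  | add p q hp hq => rw [mul_add, map_add, map_add, map_add, hp, hq]

end GaussianPolynomial

end SpinGlass

namespace SpinGlass

/-! ### Expected trace moments through matrices with polynomial entries. -/

section SpinMoments

variable {ι κ : Type*} [Fintype ι] [DecidableEq ι] [Fintype κ] [DecidableEq κ]

/-- The generic spin Hamiltonian, with polynomial entries. -/
noncomputable def genericHamiltonian (S : ι → Matrix κ κ ℂ) :
    Matrix κ κ (MvPolynomial ι ℂ) :=
  ((1 / √(Fintype.card ι : ℝ) : ℝ) : ℂ) •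
    ∑ c, (MvPolynomial.X c : MvPolynomial ι ℂ) • (S c).map MvPolynomial.C

/-- The entrywise partial derivative. -/
noncomputable def matrixPderiv (κ : Type*) (c : ι) :
    Matrix κ κ (MvPolynomial ι ℂ) →ₗ[ℂ] Matrix κ κ (MvPolynomial ι ℂ) :=
  LinearMap.mapMatrix (MvPolynomial.pderiv c : Derivation ℂ _ (MvPolynomial ι ℂ)).toLinearMap

omit [Fintype ι] [DecidableEq ι] [Fintype κ] [DecidableEq κ] in
theorem matrixPderiv_apply (c : ι) (a : Matrix κ κ (MvPolynomial ι ℂ)) (i j : κ) :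
    matrixPderiv κ c a i j = MvPolynomial.pderiv c (a i j) := rfl

omit [Fintype ι] [DecidableEq ι] [DecidableEq κ] in
theorem matrixPderiv_mul (c : ι) (a b : Matrix κ κ (MvPolynomial ι ℂ)) :
    matrixPderiv κ c (a * b) = matrixPderiv κ c a * b + a * matrixPderiv κ c b := by
  ext1 i j
  simp only [matrixPderiv_apply, Matrix.mul_apply, Matrix.add_apply, map_sum, Derivation.leibniz,
    smul_eq_mul]
  rw [← Finset.sum_add_distrib]
  exact Finset.sum_congr rfl fun k _ => by ring

omit [Fintype ι] [DecidableEq ι] [Fintype κ] [DecidableEq κ] in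
theorem matrixPderiv_map_C (c : ι) (a : Matrix κ κ ℂ) :
    matrixPderiv κ c (a.map MvPolynomial.C) = 0 := by
  ext1 i j
  simp [matrixPderiv_apply]

omit [Fintype κ] [DecidableEq κ] in
theorem matrixPderiv_genericHamiltonian (S : ι → Matrix κ κ ℂ) (c : ι) :
    matrixPderiv κ c (genericHamiltonian S)
      = ((1 / √(Fintype.card ι : ℝ) : ℝ) : ℂ) • (S c).map MvPolynomial.C := by
  rw [genericHamiltonian, map_smul, map_sum]
  congr 1
  rw [Finset.sum_eq_single c]
  · ext1 i j
    simp [matrixPderiv_apply, Derivation.leibniz]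
  · intro d _ hd
    ext1 i j
    simp [matrixPderiv_apply, Derivation.leibniz, MvPolynomial.pderiv_X_of_ne hd]
  · simp

omit [Fintype ι] [DecidableEq ι] [DecidableEq κ] in
theorem trace_matrixPderiv (c : ι) (a : Matrix κ κ (MvPolynomial ι ℂ)) :
    MvPolynomial.pderiv c a.trace = (matrixPderiv κ c a).trace := by
  simp [Matrix.trace, matrixPderiv_apply]

/-- The expected normalised trace. -/
noncomputable def expectedTrace (ι κ : Type*) [Fintype ι] [Fintype κ] :
    Matrix κ κ (MvPolynomial ι ℂ) →ₗ[ℂ] ℂ :=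
  (Fintype.card κ : ℂ)⁻¹ • (gaussianExpectation ι ∘ₗ Matrix.traceLinearMap κ ℂ (MvPolynomial ι ℂ))

omit [DecidableEq ι] [DecidableEq κ] in
theorem expectedTrace_apply (a : Matrix κ κ (MvPolynomial ι ℂ)) :
    expectedTrace ι κ a = (Fintype.card κ : ℂ)⁻¹ * gaussianExpectation ι a.trace := rfl

/-- Polynomial entries turn differentiation in a coefficient into an algebraic derivation.
Integrating by parts against `X c` leaves only the derivative of `a`, since `b` and `S c` have
constant entries. -/
theorem expectedTrace_map_mul_genericHamiltonian_mul (S : ι → Matrix κ κ ℂ) (b : Matrix κ κ ℂ)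
    (a : Matrix κ κ (MvPolynomial ι ℂ)) :
    expectedTrace ι κ (b.map MvPolynomial.C * (genericHamiltonian S * a))
      = ((1 / √(Fintype.card ι : ℝ) : ℝ) : ℂ) * ∑ c, expectedTrace ι κ
          (b.map MvPolynomial.C * (S c).map MvPolynomial.C * matrixPderiv κ c a) := by
  rw [genericHamiltonian, smul_mul_assoc, mul_smul_comm, map_smul, smul_eq_mul]
  congr 1
  rw [Finset.sum_mul, Finset.mul_sum, map_sum]
  refine Finset.sum_congr rfl fun c _ => ?_
  rw [Matrix.smul_mul, Matrix.mul_smul, ← Matrix.mul_assoc, expectedTrace_apply,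
    expectedTrace_apply, Matrix.trace_smul, smul_eq_mul, gaussianExpectation_X_mul,
    trace_matrixPderiv, matrixPderiv_mul, matrixPderiv_mul, matrixPderiv_map_C,
    matrixPderiv_map_C]
  simp

omit [DecidableEq ι] in
theorem eval_trace_genericHamiltonian_pow (S : ι → Matrix κ κ ℂ) (k : ℕ) (x : ι → ℝ) :
    MvPolynomial.eval (fun c => (x c : ℂ)) ((genericHamiltonian S ^ k).trace)
      = (spinHamiltonian S x ^ k).trace := by
  set e : MvPolynomial ι ℂ →+* ℂ := MvPolynomial.eval (fun c => (x c : ℂ))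
  have h1 : e ((genericHamiltonian S ^ k).trace) = (e.mapMatrix (genericHamiltonian S ^ k)).trace :=
    AddMonoidHom.map_trace e.toAddMonoidHom _
  have h2 : e.mapMatrix (genericHamiltonian S) = spinHamiltonian S x := by
    ext i j
    simp [genericHamiltonian, spinHamiltonian, e, Matrix.sum_apply, MvPolynomial.smul_eval]
  rw [h1, map_pow, h2]

variable {S : ι → Matrix κ κ ℂ} {ε : ι → ι → ℝ} [Nonempty κ]

theorem IsSpinFamily.integrable_moment (hS : IsSpinFamily S ε) (k : ℕ) :
    Integrable (fun x => ∫ u, u ^ k ∂(hS.spectral x : Measure ℝ)) (stdGaussianPi ι) := by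
  have h := ((integrable_eval_stdGaussianPi ((genericHamiltonian S ^ k).trace)).const_mul
    (Fintype.card κ : ℂ)⁻¹).re
  refine h.congr (.of_forall fun x => ?_)
  simp only [eval_trace_genericHamiltonian_pow, ← hS.integral_pow_spectral]
  exact RCLike.ofReal_re (K := ℂ) _

/-- The expected moments of the spectral measure of a Gaussian spin Hamiltonian. -/
theorem IsSpinFamily.integral_moment (hS : IsSpinFamily S ε) (k : ℕ) :
    ∫ x, (∫ u, u ^ k ∂(hS.spectral x : Measure ℝ)) ∂stdGaussianPi ι = wickMoment ε k [] := by
  have hN : (Fintype.card κ : ℂ) ≠ 0 := by simp [Fintype.card_ne_zero]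
  have hmap : ∀ L : List ι, (L.map fun c => (S c).map MvPolynomial.C).prod
      = ((L.map S).prod).map (MvPolynomial.C : ℂ →+* MvPolynomial ι ℂ) := by
    intro L
    have := map_list_prod (MvPolynomial.C : ℂ →+* MvPolynomial ι ℂ).mapMatrix (L.map S)
    rw [List.map_map] at this
    exact this.symm
  have key := map_prod_mul_markedPow (H := genericHamiltonian S)
    (S := fun c => (S c).map (MvPolynomial.C : ℂ →+* MvPolynomial ι ℂ)) (ε := ε)
    (r := ((1 / √(Fintype.card ι : ℝ) : ℝ) : ℂ)) (by
      rw [← Complex.ofReal_mul, div_mul_div_comm, Real.mul_self_sqrt (by positivity)]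
      simp) (matrixPderiv κ) matrixPderiv_mul (matrixPderiv_genericHamiltonian S)
    (fun c d => matrixPderiv_map_C c (S d)) (fun c => by
      have := congrArg (MvPolynomial.C : ℂ →+* MvPolynomial ι ℂ).mapMatrix (hS.mul_self c)
      rwa [map_mul, map_one] at this) (fun c d => by
      have := congrArg (MvPolynomial.C : ℂ →+* MvPolynomial ι ℂ).mapMatrix (hS.mul_comm c d)
      rw [map_mul] at this
      simp only [RingHom.mapMatrix_apply] at this
      rw [this, ← Matrix.map_mul]
      ext1 i j
      rw [Matrix.smul_apply, Matrix.map_apply, Matrix.smul_apply, Matrix.map_apply, smul_eq_mul,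
        map_mul, MvPolynomial.smul_eq_C_mul]) (expectedTrace ι κ) (by
      rw [expectedTrace_apply, Matrix.trace_one]
      change _ * ∫ x : ι → ℝ, MvPolynomial.eval _ _ ∂_ = 1
      simp [hN]) (fun L a => by
      rw [hmap]
      exact expectedTrace_map_mul_genericHamiltonian_mul S _ a) k []
  rw [markedPow_nil, List.reverse_nil, List.map_nil, List.prod_nil, one_mul, expectedTrace_apply]
    at key
  change _ * ∫ x : ι → ℝ, MvPolynomial.eval _ _ ∂_ = _ at key
  simp only [eval_trace_genericHamiltonian_pow] at key
  rw [← integral_const_mul] at key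
  simp only [← hS.integral_pow_spectral] at key
  rw [integral_complex_ofReal] at key
  exact Complex.ofReal_injective key

end SpinMoments

/-! ### Averages over lists -/

section ListAverage

variable {ι : Type*} [Fintype ι]

/-- The average of a function over all lists of length `m`. -/
noncomputable def listAverage : ℕ → (List ι → ℝ) → ℝ
  | 0, f => f []
  | m + 1, f => (Fintype.card ι : ℝ)⁻¹ * ∑ c, listAverage m fun L => f (c :: L)

theorem listAverage_mono {m : ℕ} {f g : List ι → ℝ} (h : ∀ L, L.length = m → f L ≤ g L) :
    listAverage m f ≤ listAverage m g := by
  induction m generalizing f g with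
  | zero => exact h [] rfl
  | succ m ih =>
    refine mul_le_mul_of_nonneg_left (Finset.sum_le_sum fun c _ => ih fun L hL => ?_) (by positivity)
    exact h _ (by simp [hL])

theorem listAverage_congr {m : ℕ} {f g : List ι → ℝ} (h : ∀ L, L.length = m → f L = g L) :
    listAverage m f = listAverage m g :=
  le_antisymm (listAverage_mono fun L hL => (h L hL).le) (listAverage_mono fun L hL => (h L hL).ge)

theorem listAverage_add (m : ℕ) (f g : List ι → ℝ) :
    listAverage m (fun L => f L + g L) = listAverage m f + listAverage m g := by
  induction m generalizing f g with
  | zero => rfl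
  | succ m ih => simp only [listAverage, ih, Finset.sum_add_distrib, mul_add]

theorem listAverage_const_mul (m : ℕ) (a : ℝ) (f : List ι → ℝ) :
    listAverage m (fun L => a * f L) = a * listAverage m f := by
  induction m generalizing f with
  | zero => rfl
  | succ m ih => simp only [listAverage, ih, ← Finset.mul_sum]; ring

theorem listAverage_zero (m : ℕ) : listAverage m (fun _ : List ι => (0 : ℝ)) = 0 := by
  have := listAverage_const_mul m 0 (fun _ : List ι => (0 : ℝ))
  simpa using this

theorem listAverage_sum {α : Type*} (m : ℕ) (s : Finset α) (f : α → List ι → ℝ) :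
    listAverage m (fun L => ∑ a ∈ s, f a L) = ∑ a ∈ s, listAverage m (f a) := by
  classical
  induction s using Finset.induction_on with
  | empty => simpa using listAverage_zero m
  | insert a s ha ih => simp only [Finset.sum_insert ha, listAverage_add, ih]

theorem listAverage_nonneg {m : ℕ} {f : List ι → ℝ} (h : ∀ L, L.length = m → 0 ≤ f L) :
    0 ≤ listAverage m f := by
  rw [← listAverage_zero (ι := ι) m]
  exact listAverage_mono h

theorem listAverage_const [Nonempty ι] (m : ℕ) (a : ℝ) :
    listAverage m (fun _ : List ι => a) = a := by
  induction m with
  | zero => rfl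
  | succ m ih => simp [listAverage, ih]

/-- A uniform list with an independent uniform element inserted at a fixed place is again a uniform
list. Thanks to this the averaged moment recursion closes on itself. -/
theorem listAverage_insertIdx {m i : ℕ} (hi : i ≤ m) (f : List ι → ℝ) :
    listAverage m (fun L => (Fintype.card ι : ℝ)⁻¹ * ∑ c, f (L.insertIdx i c))
      = listAverage (m + 1) f := by
  induction i generalizing m f with
  | zero => simp only [List.insertIdx_zero, listAverage_const_mul, listAverage_sum, listAverage]
  | succ i ih =>
    obtain ⟨m, rfl⟩ : ∃ m', m = m' + 1 := ⟨m - 1, by omega⟩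
    rw [listAverage, listAverage]
    simp only [List.insertIdx_succ_cons]
    congr 1
    exact Finset.sum_congr rfl fun d _ => ih (Nat.le_of_succ_le_succ hi) fun L => f (d :: L)

theorem listAverage_tail [Nonempty ι] (m : ℕ) (f : List ι → ℝ) :
    listAverage (m + 1) (fun L => f L.tail) = listAverage m f := by
  simp [listAverage]

theorem listAverage_take [Nonempty ι] {m i : ℕ} (hi : i ≤ m) (f : List ι → ℝ) :
    listAverage m (fun L => f (L.take i)) = listAverage i f := by
  induction m generalizing i f with
  | zero =>
    obtain rfl : i = 0 := by omega
    rfl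
  | succ m ih =>
    cases i with
    | zero => simpa [listAverage] using listAverage_const (ι := ι) m (f [])
    | succ i =>
      simp only [listAverage, List.take_succ_cons]
      congr 1
      exact Finset.sum_congr rfl fun c _ => ih (Nat.le_of_succ_le_succ hi) fun L => f (c :: L)

/-- The average sign picked up when a random operator is moved through the operators of a list. -/
noncomputable def signAverage (ε : ι → ι → ℝ) (L : List ι) : ℝ :=
  (Fintype.card ι : ℝ)⁻¹ * ∑ c, (L.map (ε c)).prod

end ListAverage

/-- The moments of the `q`-Gaussian law, computed recursively: `qMoment q k 0` is the moment of
order `k`. -/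
def qMoment (q : ℝ) : ℕ → ℕ → ℝ
  | 0, 0 => 1
  | 0, _ + 1 => 0
  | k + 1, j => (∑ i ∈ Finset.range (j + 1), q ^ i) * qMoment q k (j + 1) +
      match j with
      | 0 => 0
      | j' + 1 => qMoment q k j'

/-! ### Stability of the moment recursion under averaging of the signs. -/

section MomentLimit

variable {ι : Type*} [Fintype ι] {ε : ι → ι → ℝ}

omit [Fintype ι] in
theorem abs_prod_map_le_one (hε : ∀ c d, |ε c d| ≤ 1) (c : ι) (L : List ι) :
    |(L.map (ε c)).prod| ≤ 1 := by
  induction L with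
  | nil => simp
  | cons d L ih =>
    rw [List.map_cons, List.prod_cons, abs_mul]
    exact mul_le_one₀ (hε c d) (abs_nonneg _) ih

/-- The two recursions are compared term by term. Each product of signs multiplies the error made
one step earlier, where it is bounded by `1`, plus the deterministic value `qMoment`, where
averaging over `c` turns it into `signAverage`. -/
theorem abs_wickMoment_succ_sub_le (hε : ∀ c d, |ε c d| ≤ 1) (q : ℝ) (k : ℕ) (L : List ι) :
    |wickMoment ε (k + 1) L - qMoment q (k + 1) L.length|
      ≤ (∑ i ∈ Finset.range (L.length + 1),
          ((Fintype.card ι : ℝ)⁻¹ * ∑ c,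
              |wickMoment ε k (L.insertIdx i c) - qMoment q k (L.length + 1)|
            + |qMoment q k (L.length + 1)| * |signAverage ε (L.take i) - q ^ i|))
        + if L = [] then 0 else |wickMoment ε k L.tail - qMoment q k (L.length - 1)| := by
  set M : ℝ := (Fintype.card ι : ℝ)⁻¹
  have hM : 0 ≤ M := by positivity
  have h1 : M * (∑ c, ∑ i ∈ Finset.range (L.length + 1),
        ((L.take i).map (ε c)).prod * wickMoment ε k (L.insertIdx i c))
      - (∑ i ∈ Finset.range (L.length + 1), q ^ i) * qMoment q k (L.length + 1)
      = ∑ i ∈ Finset.range (L.length + 1),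
        (M * ∑ c, ((L.take i).map (ε c)).prod *
            (wickMoment ε k (L.insertIdx i c) - qMoment q k (L.length + 1))
          + qMoment q k (L.length + 1) * (signAverage ε (L.take i) - q ^ i)) := by
    rw [Finset.sum_comm, Finset.sum_mul, Finset.mul_sum, ← Finset.sum_sub_distrib]
    refine Finset.sum_congr rfl fun i _ => ?_
    simp only [mul_sub, Finset.sum_sub_distrib, ← Finset.sum_mul, signAverage]
    ring
  have h2 : |M * (∑ c, ∑ i ∈ Finset.range (L.length + 1),
        ((L.take i).map (ε c)).prod * wickMoment ε k (L.insertIdx i c))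
      - (∑ i ∈ Finset.range (L.length + 1), q ^ i) * qMoment q k (L.length + 1)|
      ≤ ∑ i ∈ Finset.range (L.length + 1),
          (M * ∑ c, |wickMoment ε k (L.insertIdx i c) - qMoment q k (L.length + 1)|
            + |qMoment q k (L.length + 1)| * |signAverage ε (L.take i) - q ^ i|) := by
    rw [h1]
    refine (Finset.abs_sum_le_sum_abs _ _).trans (Finset.sum_le_sum fun i _ => ?_)
    refine (abs_add_le _ _).trans (add_le_add ?_ (abs_mul _ _).le)
    rw [abs_mul, abs_of_nonneg hM]
    refine mul_le_mul_of_nonneg_left ?_ hM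
    refine (Finset.abs_sum_le_sum_abs _ _).trans (Finset.sum_le_sum fun c _ => ?_)
    rw [abs_mul]
    exact mul_le_of_le_one_left (abs_nonneg _) (abs_prod_map_le_one hε c _)
  cases L with
  | nil => simpa [wickMoment, qMoment] using h2
  | cons d L =>
    rw [wickMoment, List.length_cons, qMoment, if_neg (by simp)]
    simp only [List.length_cons, List.tail_cons, Nat.add_sub_cancel] at h2 ⊢
    rw [add_sub_add_comm]
    exact (abs_add_le _ _).trans (add_le_add h2 le_rfl)

/-- Averaging over `L` replaces the insertions by random lists of length `j + 1`. Consequently the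
signs need to be close to `q ^ i` only on average over lists, not for every list. -/
theorem listAverage_wickMoment_succ_le [Nonempty ι] (hε : ∀ c d, |ε c d| ≤ 1) (q : ℝ) (k j : ℕ) :
    listAverage j (fun L => |wickMoment ε (k + 1) L - qMoment q (k + 1) j|)
      ≤ (∑ i ∈ Finset.range (j + 1),
          (listAverage (j + 1) (fun L => |wickMoment ε k L - qMoment q k (j + 1)|)
            + |qMoment q k (j + 1)| * listAverage i fun L => |signAverage ε L - q ^ i|))
        + if j = 0 then 0 else
            listAverage (j - 1) fun L => |wickMoment ε k L - qMoment q k (j - 1)| := by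
  have h1 : listAverage j (fun L => |wickMoment ε (k + 1) L - qMoment q (k + 1) j|)
      ≤ listAverage j fun L => (∑ i ∈ Finset.range (j + 1),
          ((Fintype.card ι : ℝ)⁻¹ * ∑ c,
              |wickMoment ε k (L.insertIdx i c) - qMoment q k (j + 1)|
            + |qMoment q k (j + 1)| * |signAverage ε (L.take i) - q ^ i|))
        + if j = 0 then 0 else |wickMoment ε k L.tail - qMoment q k (j - 1)| := by
    refine listAverage_mono fun L hL => ?_
    have h := abs_wickMoment_succ_sub_le hε q k L
    have h0 : L = [] ↔ j = 0 := by rw [← hL, List.length_eq_zero_iff]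
    simpa only [hL, h0] using h
  refine h1.trans (le_of_eq ?_)
  rw [listAverage_add, listAverage_sum]
  congr 1
  · refine Finset.sum_congr rfl fun i hi => ?_
    have hi' : i ≤ j := Nat.lt_succ_iff.1 (Finset.mem_range.1 hi)
    rw [listAverage_add,
      listAverage_insertIdx hi' fun L => |wickMoment ε k L - qMoment q k (j + 1)|,
      listAverage_const_mul, listAverage_take hi' fun L => |signAverage ε L - q ^ i|]
  · cases j with
    | zero => simp [listAverage]
    | succ j =>
      simp only [Nat.add_sub_cancel, Nat.succ_ne_zero, if_false]
      exact listAverage_tail j fun L => |wickMoment ε k L - qMoment q k j|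

end MomentLimit

/-- If moving a random operator through `m` other random operators produces the average sign `q ^ m`
in the limit, then the expected moments converge to those of the `q`-Gaussian law. -/
theorem tendsto_wickMoment {ι : ℕ → Type*} [∀ n, Fintype (ι n)] {ε : ∀ n, ι n → ι n → ℝ}
    (hε : ∀ n c d, |ε n c d| ≤ 1) (hι : ∀ᶠ n in atTop, Nonempty (ι n)) {q : ℝ}
    (hq : ∀ m, Tendsto (fun n => listAverage m fun L => |signAverage (ε n) L - q ^ m|) atTop (𝓝 0))
    (k : ℕ) : Tendsto (fun n => wickMoment (ε n) k []) atTop (𝓝 (qMoment q k 0)) := by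
  -- The induction runs over all list lengths at once, since one step relates length `j` to `j + 1`
  -- and `j - 1`.
  have main : ∀ j, Tendsto (fun n => listAverage j fun L =>
      |wickMoment (ε n) k L - qMoment q k j|) atTop (𝓝 0) := by
    induction k with
    | zero =>
      intro j
      refine tendsto_const_nhds.congr fun n => ?_
      rw [← listAverage_zero (ι := ι n) j]
      refine listAverage_congr fun L hL => ?_
      cases L with
      | nil => subst hL; simp [wickMoment, qMoment]
      | cons d L => subst hL; simp [wickMoment, qMoment]
    | succ k ih =>
      intro j
      have hlim : Tendsto (fun n => (∑ i ∈ Finset.range (j + 1),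
          (listAverage (j + 1) (fun L => |wickMoment (ε n) k L - qMoment q k (j + 1)|)
            + |qMoment q k (j + 1)| * listAverage i fun L => |signAverage (ε n) L - q ^ i|))
        + if j = 0 then 0 else
            listAverage (j - 1) fun L => |wickMoment (ε n) k L - qMoment q k (j - 1)|)
          atTop (𝓝 ((∑ i ∈ Finset.range (j + 1), (0 + |qMoment q k (j + 1)| * 0)) +
            if j = 0 then 0 else 0)) := by
        refine (tendsto_finsetSum _ fun i _ => (ih _).add ((hq i).const_mul _)).add ?_
        split_ifs
        · exact tendsto_const_nhds
        · exact ih _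
      simp only [mul_zero, add_zero, Finset.sum_const_zero, ite_self] at hlim
      refine tendsto_of_tendsto_of_tendsto_of_le_of_le' tendsto_const_nhds hlim
        (.of_forall fun n => listAverage_nonneg fun L _ => abs_nonneg _) ?_
      filter_upwards [hι] with n hn
      exact listAverage_wickMoment_succ_le (hε n) q k j
  rw [tendsto_iff_dist_tendsto_zero]
  exact main 0

end SpinGlass

namespace SpinGlass

/-! ### Characteristic functions and moments -/

theorem hasDerivAt_sum_pow_div_factorial (z : ℂ) (n : ℕ) (s : ℝ) :
    HasDerivAt (fun s : ℝ => ∑ k ∈ Finset.range (n + 1), ((s : ℂ) * z) ^ k / k.factorial)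
      (z * ∑ k ∈ Finset.range n, ((s : ℂ) * z) ^ k / k.factorial) s := by
  have h0 : HasDerivAt (fun s : ℝ => (s : ℂ) * z) z s := by
    simpa using (Complex.ofRealCLM.hasDerivAt (x := s)).mul_const z
  have h : ∀ k ∈ Finset.range n, HasDerivAt
      (fun s : ℝ => ((s : ℂ) * z) ^ (k + 1) / (k + 1).factorial)
      (z * (((s : ℂ) * z) ^ k / k.factorial)) s := by
    intro k _
    refine ((h0.pow (k + 1)).div_const ((k + 1).factorial : ℂ)).congr_deriv ?_
    rw [Nat.factorial_succ]
    have : (k.factorial : ℂ) ≠ 0 := by exact_mod_cast k.factorial_ne_zero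
    have h3 : (k : ℂ) + 1 ≠ 0 := by exact_mod_cast k.succ_ne_zero
    push_cast
    field_simp
  have h4 := (HasDerivAt.fun_sum h).add_const (1 : ℂ)
  rw [← Finset.mul_sum] at h4
  refine h4.congr_of_eventuallyEq (.of_forall fun s => ?_)
  simp [Finset.sum_range_succ']

/-- The derivative of each Taylor remainder is `z` times the previous one, and `‖z‖ = 1`. Comparison
with the derivative of `s ^ (n + 1) / (n + 1)!` gives the induction step. -/
theorem norm_exp_sub_sum_le_of_nonneg {z : ℂ} (hz : ‖z‖ = 1) (hz' : z.re = 0) (n : ℕ) {s : ℝ}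
    (hs : 0 ≤ s) :
    ‖Complex.exp (s * z) - ∑ k ∈ Finset.range n, ((s : ℂ) * z) ^ k / k.factorial‖
      ≤ s ^ n / n.factorial := by
  induction n generalizing s with
  | zero =>
    simp [Complex.norm_exp, hz']
  | succ n ih =>
    have hd : ∀ x : ℝ, HasDerivAt (fun s : ℝ => Complex.exp (s * z)
        - ∑ k ∈ Finset.range (n + 1), ((s : ℂ) * z) ^ k / k.factorial)
        (z * (Complex.exp (x * z) - ∑ k ∈ Finset.range n, ((x : ℂ) * z) ^ k / k.factorial)) x := by
      intro x
      have h0 : HasDerivAt (fun s : ℝ => (s : ℂ) * z) z x := by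
        simpa using (Complex.ofRealCLM.hasDerivAt (x := x)).mul_const z
      have := h0.cexp.sub (hasDerivAt_sum_pow_div_factorial z n x)
      rwa [mul_comm _ z, ← mul_sub] at this
    have hB : ∀ x : ℝ, HasDerivAt (fun s : ℝ => s ^ (n + 1) / (n + 1).factorial)
        (x ^ n / n.factorial) x := by
      intro x
      refine ((hasDerivAt_pow (n + 1) x).div_const ((n + 1).factorial : ℝ)).congr_deriv ?_
      rw [Nat.factorial_succ]
      have : (n.factorial : ℝ) ≠ 0 := by exact_mod_cast n.factorial_ne_zero
      push_cast
      field_simp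
    refine image_norm_le_of_norm_deriv_right_le_deriv_boundary (a := 0) (b := s)
      (fun x _ => (hd x).continuousAt.continuousWithinAt)
      (fun x _ => (hd x).hasDerivWithinAt) ?_ hB (fun x hx => ?_) ⟨hs, le_rfl⟩
    · simp [Finset.sum_range_succ']
    · rw [norm_mul, hz, one_mul]
      exact ih hx.1

theorem norm_exp_mul_I_sub_sum_le (y : ℝ) (n : ℕ) :
    ‖Complex.exp (y * Complex.I) - ∑ k ∈ Finset.range n, ((y : ℂ) * Complex.I) ^ k / k.factorial‖
      ≤ |y| ^ n / n.factorial := by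
  rcases le_total 0 y with hy | hy
  · rw [abs_of_nonneg hy]
    exact norm_exp_sub_sum_le_of_nonneg (by simp) (by simp) n hy
  · have h := norm_exp_sub_sum_le_of_nonneg (z := -Complex.I) (by simp) (by simp) n
      (neg_nonneg.2 hy)
    rw [abs_of_nonpos hy]
    simpa using h

/-- For even `n` the remainder `|t x| ^ n / n!` integrates to a genuine moment, so the error is
controlled by moments alone. -/
theorem norm_charFun_sub_sum_le {μ : Measure ℝ} [IsProbabilityMeasure μ]
    (hμ : ∀ k, Integrable (fun x => x ^ k) μ) (t : ℝ) {n : ℕ} (hn : Even n) :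
    ‖charFun μ t - ∑ k ∈ Finset.range n, ((t : ℂ) * Complex.I) ^ k / k.factorial *
        ((∫ x, x ^ k ∂μ : ℝ) : ℂ)‖ ≤ |t| ^ n / n.factorial * ∫ x, x ^ n ∂μ := by
  have hik : ∀ k, Integrable (fun x : ℝ => ((t : ℂ) * Complex.I) ^ k / k.factorial *
      ((x ^ k : ℝ) : ℂ)) μ := fun k => (hμ k).ofReal.const_mul _
  have h1 : (∑ k ∈ Finset.range n, ((t : ℂ) * Complex.I) ^ k / k.factorial *
      ((∫ x, x ^ k ∂μ : ℝ) : ℂ))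
      = ∫ x, ∑ k ∈ Finset.range n, ((t : ℂ) * Complex.I) ^ k / k.factorial *
        ((x ^ k : ℝ) : ℂ) ∂μ := by
    rw [integral_finsetSum _ fun k _ => hik k]
    refine Finset.sum_congr rfl fun k _ => ?_
    rw [integral_const_mul, integral_complex_ofReal]
  have h2 : Integrable (fun x : ℝ => Complex.exp (t * x * Complex.I)) μ := by
    refine (integrable_const (1 : ℝ)).mono' (by fun_prop) (.of_forall fun x => ?_)
    rw [← Complex.ofReal_mul, Complex.norm_exp_ofReal_mul_I]
  rw [charFun_apply_real, h1, ← integral_sub h2 (integrable_finsetSum _ fun k _ => hik k),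
    ← integral_const_mul]
  refine norm_integral_le_of_norm_le ((hμ n).const_mul _) (.of_forall fun x => ?_)
  have h3 := norm_exp_mul_I_sub_sum_le (t * x) n
  rw [abs_mul, mul_pow, hn.pow_abs x] at h3
  convert h3 using 1
  · congr 2
    · push_cast; rfl
    · refine Finset.sum_congr rfl fun k _ => ?_
      push_cast
      ring
  · ring

theorem norm_charFun_sub_charFun_le {μ : Measure ℝ} [IsProbabilityMeasure μ]
    (hμ : Integrable (fun x => x ^ 2) μ) (s t : ℝ) :
    ‖charFun μ s - charFun μ t‖ ≤ |s - t| * (1 + ∫ x, x ^ 2 ∂μ) := by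
  have h2 : ∀ t : ℝ, Integrable (fun x : ℝ => Complex.exp (t * x * Complex.I)) μ := fun t => by
    refine (integrable_const (1 : ℝ)).mono' (by fun_prop) (.of_forall fun x => ?_)
    rw [← Complex.ofReal_mul, Complex.norm_exp_ofReal_mul_I]
  have h3 : (1 : ℝ) + ∫ x, x ^ 2 ∂μ = ∫ x, (1 + x ^ 2) ∂μ := by
    rw [integral_add (integrable_const _) hμ]; simp
  rw [charFun_apply_real, charFun_apply_real, ← integral_sub (h2 s) (h2 t), h3,
    ← integral_const_mul]
  refine norm_integral_le_of_norm_le (((integrable_const _).add hμ).const_mul _)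
    (.of_forall fun x => ?_)
  have e : Complex.exp (s * x * Complex.I) - Complex.exp (t * x * Complex.I)
      = Complex.exp (((t * x : ℝ) : ℂ) * Complex.I) *
        (Complex.exp ((((s - t) * x : ℝ) : ℂ) * Complex.I) - 1) := by
    rw [mul_sub, ← Complex.exp_add]
    push_cast
    congr 1
    · congr 1; ring
    · ring
  rw [e, norm_mul, Complex.norm_exp_ofReal_mul_I, one_mul]
  have h4 := norm_exp_mul_I_sub_sum_le ((s - t) * x) 1
  simp only [Finset.sum_range_one, pow_zero, Nat.factorial_zero, Nat.cast_one, div_one,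
    pow_one, Nat.factorial_one] at h4
  refine h4.trans ?_
  rw [abs_mul]
  refine mul_le_mul_of_nonneg_left ?_ (abs_nonneg _)
  nlinarith [sq_abs x, sq_nonneg (|x| - 1), abs_nonneg x]

theorem integrable_pow_of_integrable_exp {ν : Measure ℝ}
    (hν : ∀ t : ℝ, Integrable (fun x => Real.exp (t * x)) ν) (k : ℕ) :
    Integrable (fun x => x ^ k) ν := by
  refine (((hν 1).add (hν (-1))).const_mul (k.factorial : ℝ)).mono' (by fun_prop)
    (.of_forall fun x => ?_)
  have h := Real.pow_div_factorial_le_exp _ (abs_nonneg x) k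
  rw [div_le_iff₀ (by positivity)] at h
  rw [norm_pow, Real.norm_eq_abs, Pi.add_apply, one_mul, neg_one_mul]
  refine h.trans ?_
  rw [mul_comm]
  refine mul_le_mul_of_nonneg_left ?_ (by positivity)
  rcases abs_cases x with ⟨h, _⟩ | ⟨h, _⟩ <;> rw [h] <;>
    linarith [Real.exp_pos x, Real.exp_pos (-x)]

theorem tendsto_even_moment_div_factorial {ν : Measure ℝ}
    (hν : ∀ t : ℝ, Integrable (fun x => Real.exp (t * x)) ν) (t : ℝ) :
    Tendsto (fun n : ℕ => |t| ^ (2 * n) / (2 * n).factorial * ∫ x, x ^ (2 * n) ∂ν) atTop (𝓝 0) := by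
  have h := tendsto_integral_of_dominated_convergence (μ := ν)
    (F := fun (n : ℕ) x => |t * x| ^ (2 * n) / (2 * n).factorial) (f := fun _ => 0)
    (fun x => Real.exp (t * x) + Real.exp (-t * x)) (fun n => by fun_prop)
    ((hν t).add (hν (-t))) (fun n => .of_forall fun x => by
      rw [Real.norm_of_nonneg (by positivity)]
      refine (Real.pow_div_factorial_le_exp _ (abs_nonneg _) _).trans ?_
      rcases abs_cases (t * x) with ⟨h, _⟩ | ⟨h, _⟩ <;> rw [h] <;> simp only [neg_mul] <;>
        linarith [Real.exp_pos (t * x), Real.exp_pos (-(t * x))])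
    (.of_forall fun x => (FloorSemiring.tendsto_pow_div_factorial_atTop |t * x|).comp
      (tendsto_id.const_mul_atTop' (by norm_num)))
  rw [integral_zero] at h
  refine h.congr fun n => ?_
  rw [← integral_const_mul]
  refine integral_congr_ae (.of_forall fun x => ?_)
  simp only
  rw [abs_mul, mul_pow, (even_two_mul n).pow_abs x]
  ring

/-- An even Taylor order is fixed at which the remainder of the limit law is small; convergence of
finitely many moments does the rest. The sequence `φ` is arbitrary, so that expected characteristic
functions are covered without exhibiting a measure behind them. -/
theorem tendsto_of_approx_by_moments {ν : Measure ℝ} [IsProbabilityMeasure ν]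
    (hν : ∀ t : ℝ, Integrable (fun x => Real.exp (t * x)) ν) {m : ℕ → ℕ → ℝ}
    (hm : ∀ k, Tendsto (fun n => m n k) atTop (𝓝 (∫ x, x ^ k ∂ν))) {φ : ℕ → ℂ} {t : ℝ}
    (hφ : ∀ n k, Even k → ‖φ n - ∑ j ∈ Finset.range k, ((t : ℂ) * Complex.I) ^ j / j.factorial *
        (m n j : ℂ)‖ ≤ |t| ^ k / k.factorial * m n k) :
    Tendsto φ atTop (𝓝 (charFun ν t)) := by
  rw [Metric.tendsto_atTop']
  intro δ hδ
  obtain ⟨J, hJ⟩ := ((tendsto_even_moment_div_factorial hν t).eventually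
    (gt_mem_nhds (show 0 < δ / 3 by positivity))).exists
  have h1 : Tendsto (fun n => ∑ j ∈ Finset.range (2 * J), ((t : ℂ) * Complex.I) ^ j / j.factorial *
      (m n j : ℂ)) atTop (𝓝 (∑ j ∈ Finset.range (2 * J), ((t : ℂ) * Complex.I) ^ j / j.factorial *
      ((∫ x, x ^ j ∂ν : ℝ) : ℂ))) :=
    tendsto_finsetSum _ fun j _ =>
      ((Complex.continuous_ofReal.tendsto _).comp (hm j)).const_mul _
  have h2 := (hm (2 * J)).const_mul (|t| ^ (2 * J) / (2 * J).factorial)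
  have h3 := (h1.eventually (Metric.ball_mem_nhds _ (show 0 < δ / 3 by positivity))).and
    (h2.eventually (gt_mem_nhds hJ))
  obtain ⟨N, hN⟩ := eventually_atTop.1 h3
  refine ⟨N, fun n hn => ?_⟩
  obtain ⟨h4, h5⟩ := hN n hn.le
  have h6 := hφ n (2 * J) (even_two_mul J)
  have h7 := norm_charFun_sub_sum_le (integrable_pow_of_integrable_exp hν) t (even_two_mul J)
  rw [dist_eq_norm] at h4
  rw [dist_eq_norm]
  set A := ∑ j ∈ Finset.range (2 * J), ((t : ℂ) * Complex.I) ^ j / j.factorial * (m n j : ℂ)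
  set B := ∑ j ∈ Finset.range (2 * J), ((t : ℂ) * Complex.I) ^ j / j.factorial *
      ((∫ x, x ^ j ∂ν : ℝ) : ℂ)
  calc ‖φ n - charFun ν t‖ = ‖(φ n - A) + (A - B) + -(charFun ν t - B)‖ := by congr 1; ring
    _ ≤ ‖φ n - A‖ + ‖A - B‖ + ‖charFun ν t - B‖ := by
        refine (norm_add_le _ _).trans (add_le_add (norm_add_le _ _) (norm_neg _).le)
    _ < δ := by linarith

/-- Almost sure statements can be combined over countably many frequencies only. Bounded second
moments make the characteristic functions equi-Lipschitz, which extends the convergence from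
rational to real frequencies. -/
theorem tendsto_charFun_of_tendsto_rat {μ : ℕ → ProbabilityMeasure ℝ} {ν : Measure ℝ}
    [IsProbabilityMeasure ν] (hμ : ∀ n, Integrable (fun x => x ^ 2) (μ n : Measure ℝ)) {B : ℝ}
    (hB : ∀ᶠ n in atTop, ∫ x, x ^ 2 ∂(μ n : Measure ℝ) ≤ B)
    (h : ∀ r : ℚ, Tendsto (fun n => charFun (μ n : Measure ℝ) (r : ℝ)) atTop
      (𝓝 (charFun ν (r : ℝ)))) (t : ℝ) :
    Tendsto (fun n => charFun (μ n : Measure ℝ) t) atTop (𝓝 (charFun ν t)) := by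
  rw [Metric.tendsto_nhds]
  intro δ hδ
  have hB0 : 0 ≤ B := by
    obtain ⟨n, hn⟩ := hB.exists
    exact (integral_nonneg fun x => sq_nonneg x).trans hn
  have hc : ∀ᶠ s in 𝓝 t, dist (charFun ν s) (charFun ν t) < δ / 3 ∧ |t - s| * (1 + B) < δ / 3 := by
    refine ((continuous_charFun.tendsto t).eventually
      (Metric.ball_mem_nhds _ (show 0 < δ / 3 by positivity))).and ?_
    have : Continuous fun s : ℝ => |t - s| * (1 + B) := by fun_prop
    have h2 := this.tendsto t
    simp only [sub_self, abs_zero, zero_mul] at h2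
    exact h2.eventually (gt_mem_nhds (by positivity))
  obtain ⟨U, hU, hUo, htU⟩ := eventually_nhds_iff.1 hc
  obtain ⟨s, hsU, r, rfl⟩ := Rat.denseRange_cast (𝕜 := ℝ) |>.inter_open_nonempty U hUo ⟨t, htU⟩
  obtain ⟨h1, h2⟩ := hU _ hsU
  filter_upwards [hB, Metric.tendsto_nhds.1 (h r) (δ / 3) (by positivity)] with n hn1 hn2
  have h3 := norm_charFun_sub_charFun_le (hμ n) t r
  have h4 : |t - r| * (1 + ∫ x, x ^ 2 ∂(μ n : Measure ℝ)) ≤ |t - r| * (1 + B) :=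
    mul_le_mul_of_nonneg_left (by linarith) (abs_nonneg _)
  rw [← dist_eq_norm] at h3
  calc _ ≤ dist (charFun (μ n : Measure ℝ) t) (charFun (μ n : Measure ℝ) r)
        + dist (charFun (μ n : Measure ℝ) r) (charFun ν r) + dist (charFun ν r) (charFun ν t) :=
        dist_triangle4 _ _ _ _
    _ < δ := by linarith

/-! ### Almost sure convergence -/

section Concentration

variable {Ω : Type*} [MeasurableSpace Ω] {P : Measure Ω}

theorem IsStdGaussianFamily.hasLaw [IsProbabilityMeasure P] {ι : Type*} [Fintype ι]
    {α : ι → Ω → ℝ} (hα : IsStdGaussianFamily P α) :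
    HasLaw (fun ω i => α i ω) (stdGaussianPi ι) P :=
  hα.2.hasLaw_pi hα.1

theorem IsStdGaussianFamily.measureReal_lt_abs_le [IsProbabilityMeasure P] {ι : Type*} [Fintype ι]
    {α : ι → Ω → ℝ} (hα : IsStdGaussianFamily P α) {F : (ι → ℝ) → ℝ} {K : ℝ} (hK : 0 ≤ K)
    (hF : ∀ x y, |F x - F y| ≤ K * √(∑ i, (x i - y i) ^ 2)) {t : ℝ} (ht : 0 ≤ t) :
    P.real {ω | t < |F (fun i => α i ω) - ∫ y, F y ∂stdGaussianPi ι|}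
      ≤ 2 * Real.exp (-(t ^ 2 / (4 * K ^ 2))) := by
  have hFm := (continuous_of_abs_sub_le hF).measurable
  have h := hα.hasLaw.measureReal_eq
    (p := fun x => t < |F x - ∫ y, F y ∂stdGaussianPi ι|)
    (measurableSet_lt measurable_const (by fun_prop))
  exact h.trans_le (stdGaussianPi_measureReal_lt_abs_le hK hF ht)

/-- Borel-Cantelli at each level `1 / (j + 1)`: the tails are at most `2 exp (-t² M / (4 K²))` with
`M` the number of coefficients. No independence between different `n` is required. -/
theorem ae_tendsto_sub_integral [IsProbabilityMeasure P] {ι : ℕ → Type*} [∀ n, Fintype (ι n)]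
    {α : ∀ n, ι n → Ω → ℝ} (hα : ∀ n, IsStdGaussianFamily P (α n))
    (hsum : ∀ s : ℝ, 0 < s → Summable fun n => Real.exp (-s * Fintype.card (ι n)))
    {F : ∀ n, (ι n → ℝ) → ℝ} {K : ℝ} (hK : 0 < K)
    (hF : ∀ n x y, |F n x - F n y|
      ≤ K * (1 / √(Fintype.card (ι n) : ℝ)) * √(∑ i, (x i - y i) ^ 2)) :
    ∀ᵐ ω ∂P, Tendsto (fun n => F n (fun i => α n i ω) - ∫ y, F n y ∂stdGaussianPi (ι n))
      atTop (𝓝 0) := by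
  have h1 : ∀ j : ℕ, ∀ᵐ ω ∂P, ∀ᶠ n in atTop,
      |F n (fun i => α n i ω) - ∫ y, F n y ∂stdGaussianPi (ι n)| ≤ 1 / ((j : ℝ) + 1) := by
    intro j
    set t : ℝ := 1 / ((j : ℝ) + 1)
    have ht : 0 < t := by positivity
    have hs : Summable fun n => P.real
        {ω | t < |F n (fun i => α n i ω) - ∫ y, F n y ∂stdGaussianPi (ι n)|} := by
      refine Summable.of_nonneg_of_le (fun n => measureReal_nonneg) (fun n => ?_)
        ((hsum (t ^ 2 / (4 * K ^ 2)) (by positivity)).mul_left 2)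
      refine ((hα n).measureReal_lt_abs_le (by positivity) (hF n) ht.le).trans (le_of_eq ?_)
      congr 2
      have hM : (1 / √(Fintype.card (ι n) : ℝ)) ^ 2 = (Fintype.card (ι n) : ℝ)⁻¹ := by
        rw [div_pow, one_pow, Real.sq_sqrt (by positivity), one_div]
      rw [mul_pow, hM, ← mul_assoc, ← div_div, div_inv_eq_mul, neg_mul]
    have := ae_eventually_notMem (μ := P)
      (s := fun n => {ω | t < |F n (fun i => α n i ω) - ∫ y, F n y ∂stdGaussianPi (ι n)|}) (by
        have h2 := hs.tsum_ofReal_ne_top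
        refine ne_of_eq_of_ne (tsum_congr fun n => ?_) h2
        exact (ofReal_measureReal (measure_ne_top _ _)).symm)
    filter_upwards [this] with ω hω
    filter_upwards [hω] with n hn
    exact not_lt.1 hn
  filter_upwards [ae_all_iff.2 h1] with ω hω
  rw [Metric.tendsto_nhds]
  intro δ hδ
  obtain ⟨j, hj⟩ := exists_nat_one_div_lt hδ
  filter_upwards [hω j] with n hn
  rw [dist_zero_right, Real.norm_eq_abs]
  exact hn.trans_lt hj

end Concentration

section AlmostSure

theorem charFun_eq_cos_add_sin (μ : ProbabilityMeasure ℝ) (t : ℝ) :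
    charFun (μ : Measure ℝ) t = ((∫ u, Real.cos (t * u) ∂(μ : Measure ℝ) : ℝ) : ℂ)
      + ((∫ u, Real.sin (t * u) ∂(μ : Measure ℝ) : ℝ) : ℂ) * Complex.I := by
  have h1 : Integrable (fun u : ℝ => ((Real.cos (t * u) : ℝ) : ℂ)) (μ : Measure ℝ) := by
    refine (integrable_const (1 : ℝ)).mono' (by fun_prop) (.of_forall fun x => ?_)
    rw [Complex.norm_real]
    exact Real.abs_cos_le_one _
  have h2 : Integrable (fun u : ℝ => ((Real.sin (t * u) : ℝ) : ℂ) * Complex.I) (μ : Measure ℝ) := by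
    refine (integrable_const (1 : ℝ)).mono' (by fun_prop) (.of_forall fun x => ?_)
    rw [norm_mul, Complex.norm_I, mul_one, Complex.norm_real]
    exact Real.abs_sin_le_one _
  rw [charFun_apply_real, ← integral_complex_ofReal, ← integral_complex_ofReal,
    ← integral_mul_const, ← integral_add h1 h2]
  refine integral_congr_ae (.of_forall fun u => ?_)
  simp only [← Complex.ofReal_mul, Complex.exp_mul_I, ← Complex.ofReal_cos, ← Complex.ofReal_sin]

variable {ι κ : Type*} [Fintype ι] [DecidableEq ι] [Fintype κ] [DecidableEq κ] [Nonempty κ]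
  {S : ι → Matrix κ κ ℂ} {ε : ι → ι → ℝ}

/-- The constant is `|t| + 1` rather than `|t|` so as to be positive at `t = 0` as well, as the
Borel-Cantelli argument demands. -/
theorem IsSpinFamily.abs_cos_sub_le (hS : IsSpinFamily S ε) (t : ℝ) (x y : ι → ℝ) :
    |(∫ u, Real.cos (t * u) ∂(hS.spectral x : Measure ℝ))
        - ∫ u, Real.cos (t * u) ∂(hS.spectral y : Measure ℝ)|
      ≤ (|t| + 1) * (1 / √(Fintype.card ι : ℝ)) * √(∑ c, (x c - y c) ^ 2) := by
  refine hS.abs_integral_spectral_sub_le (by positivity) (fun u v => ?_) x y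
  have h := Real.abs_cos_sub_cos_le (x := t * u) (y := t * v)
  rw [← mul_sub, abs_mul] at h
  nlinarith [abs_nonneg (u - v)]

theorem IsSpinFamily.abs_sin_sub_le (hS : IsSpinFamily S ε) (t : ℝ) (x y : ι → ℝ) :
    |(∫ u, Real.sin (t * u) ∂(hS.spectral x : Measure ℝ))
        - ∫ u, Real.sin (t * u) ∂(hS.spectral y : Measure ℝ)|
      ≤ (|t| + 1) * (1 / √(Fintype.card ι : ℝ)) * √(∑ c, (x c - y c) ^ 2) := by
  refine hS.abs_integral_spectral_sub_le (by positivity) (fun u v => ?_) x y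
  have h := Real.abs_sin_sub_sin_le (x := t * u) (y := t * v)
  rw [← mul_sub, abs_mul] at h
  nlinarith [abs_nonneg (u - v)]

omit [DecidableEq ι] in
theorem abs_sqrt_sum_sq_sub_le (x y : ι → ℝ) :
    |√(∑ c, x c ^ 2) - √(∑ c, y c ^ 2)| ≤ √(∑ c, (x c - y c) ^ 2) := by
  have h := abs_norm_sub_norm_le (WithLp.toLp 2 x : EuclideanSpace ℝ ι) (WithLp.toLp 2 y)
  simpa [EuclideanSpace.norm_eq, sq_abs] using h

/-- The square root of the second moment is the normalised Euclidean norm of the coefficients, hence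
Lipschitz, which the second moment itself is not. -/
theorem IsSpinFamily.abs_sqrt_moment_sub_le (hS : IsSpinFamily S ε) (x y : ι → ℝ) :
    |√(∫ u, u ^ 2 ∂(hS.spectral x : Measure ℝ)) - √(∫ u, u ^ 2 ∂(hS.spectral y : Measure ℝ))|
      ≤ 1 * (1 / √(Fintype.card ι : ℝ)) * √(∑ c, (x c - y c) ^ 2) := by
  rw [hS.integral_sq_spectral, hS.integral_sq_spectral, Real.sqrt_mul (by positivity),
    Real.sqrt_mul (by positivity), Real.sqrt_sq (by positivity), ← mul_sub, abs_mul,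
    abs_of_nonneg (by positivity), one_mul]
  exact mul_le_mul_of_nonneg_left (abs_sqrt_sum_sq_sub_le x y) (by positivity)

theorem IsSpinFamily.norm_expected_charFun_sub_le (hS : IsSpinFamily S ε) (t : ℝ) (k : ℕ)
    (hk : Even k) :
    ‖(((∫ x, ∫ u, Real.cos (t * u) ∂(hS.spectral x : Measure ℝ) ∂stdGaussianPi ι : ℝ) : ℂ)
        + ((∫ x, ∫ u, Real.sin (t * u) ∂(hS.spectral x : Measure ℝ) ∂stdGaussianPi ι : ℝ) : ℂ)
          * Complex.I)
        - ∑ j ∈ Finset.range k, ((t : ℂ) * Complex.I) ^ j / j.factorial * (wickMoment ε j [] : ℂ)‖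
      ≤ |t| ^ k / k.factorial * wickMoment ε k [] := by
  have h1 := stdGaussianPi_integrable (hS.abs_cos_sub_le t)
  have h2 := stdGaussianPi_integrable (hS.abs_sin_sub_le t)
  have h12 : Integrable (fun x => ((∫ u, Real.cos (t * u) ∂(hS.spectral x : Measure ℝ) : ℝ) : ℂ)
      + ((∫ u, Real.sin (t * u) ∂(hS.spectral x : Measure ℝ) : ℝ) : ℂ) * Complex.I)
      (stdGaussianPi ι) := h1.ofReal.add (h2.ofReal.mul_const _)
  have hm := hS.integrable_moment
  have hik : ∀ j ∈ Finset.range k, Integrable (fun x => ((t : ℂ) * Complex.I) ^ j / j.factorial *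
      ((∫ u, u ^ j ∂(hS.spectral x : Measure ℝ) : ℝ) : ℂ)) (stdGaussianPi ι) :=
    fun j _ => (hm j).ofReal.const_mul _
  have e1 : (∑ j ∈ Finset.range k, ((t : ℂ) * Complex.I) ^ j / j.factorial *
      (wickMoment ε j [] : ℂ))
      = ∫ x, ∑ j ∈ Finset.range k, ((t : ℂ) * Complex.I) ^ j / j.factorial *
        ((∫ u, u ^ j ∂(hS.spectral x : Measure ℝ) : ℝ) : ℂ) ∂stdGaussianPi ι := by
    rw [integral_finsetSum _ hik]
    refine Finset.sum_congr rfl fun j _ => ?_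
    rw [integral_const_mul, integral_complex_ofReal, hS.integral_moment]
  rw [e1, ← integral_complex_ofReal, ← integral_complex_ofReal, ← integral_mul_const,
    ← integral_add h1.ofReal (h2.ofReal.mul_const _), ← integral_sub h12 (integrable_finsetSum _ hik), ← hS.integral_moment,
    ← integral_const_mul]
  refine norm_integral_le_of_norm_le ((hm k).const_mul _) (.of_forall fun x => ?_)
  rw [← charFun_eq_cos_add_sin]
  exact norm_charFun_sub_sum_le (fun j => integrable_spectralMeasure _ _) t hk

end AlmostSure

theorem eventually_nonempty_of_summable {ι : ℕ → Type*} [∀ n, Fintype (ι n)]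
    (hsum : ∀ s : ℝ, 0 < s → Summable fun n => Real.exp (-s * Fintype.card (ι n))) :
    ∀ᶠ n in atTop, Nonempty (ι n) := by
  have h := (hsum 1 one_pos).tendsto_atTop_zero.eventually (gt_mem_nhds one_pos)
  filter_upwards [h] with n hn
  by_contra hne
  rw [not_nonempty_iff] at hne
  simp at hn

/-- Almost sure convergence of the spectral measures of Gaussian spin Hamiltonians, from the
convergence of the average signs. -/
theorem ae_convergesWeakly {Ω : Type*} [MeasurableSpace Ω] (P : Measure Ω) [IsProbabilityMeasure P]
    {ι κ : ℕ → Type*} [∀ n, Fintype (ι n)] [∀ n, DecidableEq (ι n)] [∀ n, Fintype (κ n)]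
    [∀ n, DecidableEq (κ n)] [∀ n, Nonempty (κ n)] {S : ∀ n, ι n → Matrix (κ n) (κ n) ℂ}
    {ε : ∀ n, ι n → ι n → ℝ} (hS : ∀ n, IsSpinFamily (S n) (ε n)) (hε : ∀ n c d, |ε n c d| ≤ 1)
    {α : ∀ n, ι n → Ω → ℝ} (hα : ∀ n, IsStdGaussianFamily P (α n))
    (hsum : ∀ s : ℝ, 0 < s → Summable fun n => Real.exp (-s * Fintype.card (ι n))) {q : ℝ}
    (hq : ∀ m, Tendsto (fun n => listAverage m fun L => |signAverage (ε n) L - q ^ m|) atTop (𝓝 0))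
    (ν : Measure ℝ) [hν : IsProbabilityMeasure ν]
    (hexp : ∀ t : ℝ, Integrable (fun x => Real.exp (t * x)) ν)
    (hmom : ∀ k, ∫ x, x ^ k ∂ν = qMoment q k 0) :
    ∀ᵐ ω ∂P, ConvergesWeakly (fun n => (hS n).spectral fun i => α n i ω) ν := by
  have hι := eventually_nonempty_of_summable hsum
  have hwick := tendsto_wickMoment hε hι hq
  have hexpect : ∀ t : ℝ, Tendsto (fun n =>
      ((∫ x, ∫ u, Real.cos (t * u) ∂((hS n).spectral x : Measure ℝ) ∂stdGaussianPi (ι n) : ℝ) : ℂ)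
        + ((∫ x, ∫ u, Real.sin (t * u) ∂((hS n).spectral x : Measure ℝ)
          ∂stdGaussianPi (ι n) : ℝ) : ℂ) * Complex.I) atTop (𝓝 (charFun ν t)) := fun t =>
    tendsto_of_approx_by_moments hexp (m := fun n k => wickMoment (ε n) k [])
      (fun k => by rw [hmom]; exact hwick k)
      fun n k hk => (hS n).norm_expected_charFun_sub_le t k hk
  have hcos := ae_all_iff.2 fun r : ℚ => ae_tendsto_sub_integral hα hsum (K := |(r : ℝ)| + 1)
    (by positivity) fun n => (hS n).abs_cos_sub_le r
  have hsin := ae_all_iff.2 fun r : ℚ => ae_tendsto_sub_integral hα hsum (K := |(r : ℝ)| + 1)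
    (by positivity) fun n => (hS n).abs_sin_sub_le r
  have hsq := ae_tendsto_sub_integral hα hsum one_pos fun n => (hS n).abs_sqrt_moment_sub_le
  filter_upwards [hcos, hsin, hsq] with ω h1 h2 h3
  refine ⟨hν, ProbabilityMeasure.tendsto_of_tendsto_charFun fun t => ?_⟩
  -- The expected square root of the second moment is at most `(1 + E m₂) / 2` since `√y ≤ (1 + y) /
  -- 2`. One inner `1` allows for `E m₂` exceeding its limit, the final `1` for the random
  -- fluctuation.
  set B := (1 + (qMoment q 2 0 + 1)) / 2 + 1
  have hsqrt : ∀ᶠ n in atTop,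
      ∫ u, u ^ 2 ∂((hS n).spectral fun i => α n i ω : Measure ℝ) ≤ B ^ 2 := by
    filter_upwards [h3.eventually (gt_mem_nhds one_pos),
      (hwick 2).eventually (gt_mem_nhds (lt_add_one _))] with n hn1 hn2
    have hle : ∫ x, √(∫ u, u ^ 2 ∂((hS n).spectral x : Measure ℝ)) ∂stdGaussianPi (ι n)
        ≤ (1 + wickMoment (ε n) 2 []) / 2 := by
      have hc : (1 + wickMoment (ε n) 2 []) / 2
          = ∫ x, (1 + ∫ u, u ^ 2 ∂((hS n).spectral x : Measure ℝ)) / 2 ∂stdGaussianPi (ι n) := by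
        rw [integral_div, integral_add (integrable_const _) ((hS n).integrable_moment 2),
          (hS n).integral_moment]
        simp
      rw [hc]
      refine integral_mono (stdGaussianPi_integrable (hS n).abs_sqrt_moment_sub_le)
        (((integrable_const _).add ((hS n).integrable_moment 2)).div_const 2) fun x => ?_
      have h0 : 0 ≤ ∫ u, u ^ 2 ∂((hS n).spectral x : Measure ℝ) :=
        integral_nonneg fun u => sq_nonneg u
      have := Real.sq_sqrt h0
      nlinarith [sq_nonneg (√(∫ u, u ^ 2 ∂((hS n).spectral x : Measure ℝ)) - 1)]
    have h5 : √(∫ u, u ^ 2 ∂((hS n).spectral fun i => α n i ω : Measure ℝ)) ≤ B := by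
      simp only [B]
      linarith
    exact (Real.sqrt_le_left (le_trans (Real.sqrt_nonneg _) h5)).1 h5
  change Tendsto _ atTop (𝓝 (charFun ν t))
  refine tendsto_charFun_of_tendsto_rat (μ := fun n => (hS n).spectral fun i => α n i ω) (fun n => integrable_spectralMeasure _ _) hsqrt
    (fun r => ?_) t
  have h4 := (((Complex.continuous_ofReal.tendsto _).comp (h1 r)).add
    (((Complex.continuous_ofReal.tendsto _).comp (h2 r)).mul_const Complex.I)).add (hexpect r)
  simp only [Complex.ofReal_zero, zero_mul, zero_add] at h4
  refine h4.congr fun n => ?_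
  rw [charFun_eq_cos_add_sin]
  simp only [Function.comp_apply, Complex.ofReal_sub]
  ring

end SpinGlass

namespace SpinGlass

/-! ### Pauli strings -/

/-- The identity or one of the Pauli matrices. -/
noncomputable def pauliOpt : Option (Fin 3) → Matrix (Fin 2) (Fin 2) ℂ
  | none => 1
  | some a => pauli a

/-- The sign `±1` by which two local operators commute. -/
noncomputable def pauliSign : Option (Fin 3) → Option (Fin 3) → ℝ
  | some a, some b => if a = b then 1 else -1
  | _, _ => 1

theorem pauliOpt_isHermitian (o : Option (Fin 3)) : (pauliOpt o).IsHermitian := by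
  cases o with
  | none => exact Matrix.isHermitian_one
  | some a => exact pauli_isHermitian a

theorem pauliOpt_mul_self (o : Option (Fin 3)) : pauliOpt o * pauliOpt o = 1 := by
  cases o with
  | none => simp [pauliOpt]
  | some a => fin_cases a <;> ext i j <;> fin_cases i <;> fin_cases j <;> simp [pauliOpt, pauli]

theorem pauliOpt_mul_comm (o o' : Option (Fin 3)) :
    pauliOpt o' * pauliOpt o = (pauliSign o o' : ℂ) • (pauliOpt o * pauliOpt o') := by
  cases o with
  | none => simp [pauliOpt, pauliSign]
  | some a =>
    cases o' with
    | none => simp [pauliOpt, pauliSign]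
    | some b =>
      fin_cases a <;> fin_cases b <;> ext i j <;> fin_cases i <;> fin_cases j <;>
        simp [pauliOpt, pauli, pauliSign]

theorem trace_pauliOpt_mul (o o' : Option (Fin 3)) :
    (pauliOpt o * pauliOpt o').trace = if o = o' then 2 else 0 := by
  cases o with
  | none =>
    cases o' with
    | none => simp [pauliOpt]
    | some b => fin_cases b <;> simp [pauliOpt, pauli, Matrix.trace_fin_two]
  | some a =>
    cases o' with
    | none => fin_cases a <;> simp [pauliOpt, pauli, Matrix.trace_fin_two]
    | some b =>
      fin_cases a <;> fin_cases b <;> simp [pauliOpt, pauli, Matrix.trace_fin_two] <;> norm_num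

theorem tensor_one {n : ℕ} : tensor (fun _ : Fin n => (1 : Matrix (Fin 2) (Fin 2) ℂ)) = 1 := by
  ext s t
  simp only [tensor, Matrix.of_apply, Matrix.one_apply]
  by_cases h : s = t
  · simp [h]
  · rw [if_neg h]
    obtain ⟨k, hk⟩ := Function.ne_iff.1 h
    exact Finset.prod_eq_zero (Finset.mem_univ k) (if_neg hk)

theorem tensor_smul {n : ℕ} (c : Fin n → ℂ) (A : Fin n → Matrix (Fin 2) (Fin 2) ℂ) :
    tensor (fun k => c k • A k) = (∏ k, c k) • tensor A := by
  ext s t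
  simp [tensor, Finset.prod_mul_distrib]

theorem trace_tensor {n : ℕ} (A : Fin n → Matrix (Fin 2) (Fin 2) ℂ) :
    (tensor A).trace = ∏ k, (A k).trace := by
  simp only [Matrix.trace, Matrix.diag, tensor, Matrix.of_apply]
  exact (Fintype.prod_sum fun k r => A k r r).symm

theorem list_prod_tensor {n p : ℕ} (B : Fin p → Fin n → Matrix (Fin 2) (Fin 2) ℂ) :
    (List.ofFn fun l => tensor (B l)).prod = tensor fun k => (List.ofFn fun l => B l k).prod := by
  induction p with
  | zero => simp [tensor_one]
  | succ p ih => simp only [List.ofFn_succ, List.prod_cons, ih, tensor_mul]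

theorem list_prod_ofFn_eq_single {M : Type*} [Monoid M] {p : ℕ} (g : Fin p → M) (l : Fin p)
    (hg : ∀ l', l' ≠ l → g l' = 1) : (List.ofFn g).prod = g l := by
  induction p with
  | zero => exact l.elim0
  | succ p ih =>
    rw [List.ofFn_succ, List.prod_cons]
    refine Fin.cases (fun hg => ?_) (fun l hg => ?_) l hg
    · rw [List.prod_eq_one, mul_one]
      intro x hx
      obtain ⟨l', rfl⟩ := (List.mem_ofFn' _ _).1 hx
      exact hg _ (Fin.succ_ne_zero l')
    · rw [hg 0 (Fin.succ_ne_zero l).symm, one_mul]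
      exact ih (fun l' => g l'.succ) l fun l' h => hg _ fun h' => h (Fin.succ_injective _ h')

/-- A tensor product of Pauli matrices and identities. -/
noncomputable def pauliString {n : ℕ} (f : Fin n → Option (Fin 3)) :
    Matrix (Fin n → Fin 2) (Fin n → Fin 2) ℂ :=
  tensor fun k => pauliOpt (f k)

/-- The sign by which two Pauli strings commute. -/
noncomputable def stringSign {n : ℕ} (f g : Fin n → Option (Fin 3)) : ℝ :=
  ∏ k, pauliSign (f k) (g k)

/-- Each property reduces to a single site. Distinct strings differ at some site, and the local
trace there is `0`; this is trace orthogonality. -/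
theorem isSpinFamily_pauliString {n : ℕ} {ι : Type*} [DecidableEq ι]
    {str : ι → Fin n → Option (Fin 3)} (hstr : Function.Injective str) :
    IsSpinFamily (fun c => pauliString (str c)) fun c d => stringSign (str c) (str d) where
  isHermitian c := tensor_isHermitian fun k => pauliOpt_isHermitian _
  mul_self c := by
    rw [pauliString, tensor_mul, ← tensor_one]
    congr 1
    exact funext fun k => pauliOpt_mul_self _
  mul_comm c d := by
    rw [pauliString, pauliString, tensor_mul, tensor_mul, stringSign, Complex.ofReal_prod,
      ← tensor_smul]
    congr 1
    exact funext fun k => pauliOpt_mul_comm _ _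
  trace_mul c d := by
    rw [pauliString, pauliString, tensor_mul, trace_tensor]
    simp only [trace_pauliOpt_mul]
    split_ifs with h
    · subst h
      simp
    · obtain ⟨k, hk⟩ := Function.ne_iff.1 (hstr.ne h)
      exact Finset.prod_eq_zero (Finset.mem_univ k) (if_neg hk)

theorem abs_pauliSign (o o' : Option (Fin 3)) : |pauliSign o o'| = 1 := by
  unfold pauliSign
  split
  · split_ifs <;> simp
  · simp

theorem abs_stringSign {n : ℕ} (f g : Fin n → Option (Fin 3)) : |stringSign f g| = 1 := by
  rw [stringSign, Finset.abs_prod]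
  exact Finset.prod_eq_one fun k _ => abs_pauliSign _ _

theorem spectralMeasure_congr {κ : Type*} [Fintype κ] [DecidableEq κ] [Nonempty κ]
    {A B : Matrix κ κ ℂ} (h : A = B) (hA : A.IsHermitian) (hB : B.IsHermitian) :
    spectralMeasure hA = spectralMeasure hB := by
  subst h
  rfl

/-! ### Coupling graphs -/

section Graph

variable {n : ℕ} (Γ : SimpleGraph (Fin n))

/-- The Pauli string of a coupling of a graph. -/
def graphString (c : GraphCoupling Γ) : Fin n → Option (Fin 3) := fun k =>
  if k = c.1.1.1 then some c.2.1 else if k = c.1.1.2 then some c.2.2 else none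

theorem graphString_injective : Function.Injective (graphString Γ) := by
  rintro ⟨⟨⟨i, j⟩, hij, h⟩, a, b⟩ ⟨⟨⟨i', j'⟩, hij', h'⟩, a', b'⟩ hc
  simp only at hij hij'
  have hi := congrFun hc i
  have hj := congrFun hc j
  have hi' := congrFun hc i'
  have hj' := congrFun hc j'
  simp only [graphString, if_true, hij.ne', hij'.ne', if_false] at hi hj hi' hj'
  have h1 : i = i' ∨ i = j' := by
    by_contra hne
    push Not at hne
    simp [hne.1, hne.2] at hi
  have h2 : j = i' ∨ j = j' := by
    by_contra hne
    push Not at hne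
    simp [hne.1, hne.2] at hj
  have h3 : i' = i ∨ i' = j := by
    by_contra hne
    push Not at hne
    simp [hne.1, hne.2] at hi'
  have hii : i = i' := by
    rcases h1 with h1 | h1
    · exact h1
    · rcases h3 with h3 | h3
      · exact h3.symm
      · subst h1 h3
        exact absurd hij (lt_asymm hij')
  subst hii
  have hjj : j = j' := by
    rcases h2 with h2 | h2
    · exact absurd h2 hij.ne'
    · exact h2
  subst hjj
  simp only [if_true, hij.ne', if_false, Option.some.injEq] at hi hj
  rw [hi, hj]

theorem spin_mul_spin_eq_pauliString (c : GraphCoupling Γ) :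
    spin c.1.1.1 c.2.1 * spin c.1.1.2 c.2.2 = pauliString (graphString Γ c) := by
  rw [spin, spin, tensor_mul, pauliString]
  congr 1
  funext k
  have hne : c.1.1.1 ≠ c.1.1.2 := c.1.2.1.ne
  by_cases h1 : k = c.1.1.1
  · subst h1
    simp [Function.update_of_ne hne, graphString, pauliOpt]
  · by_cases h2 : k = c.1.1.2
    · subst h2
      simp [graphString, pauliOpt, hne.symm]
    · simp [graphString, pauliOpt, h1, h2]

variable [DecidableRel Γ.Adj]

theorem card_edges :
    Fintype.card {e : Fin n × Fin n // e.1 < e.2 ∧ Γ.Adj e.1 e.2} = Γ.edgeFinset.card := by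
  rw [← Finset.card_univ]
  refine Finset.card_bij (fun e _ => s(e.1.1, e.1.2)) (fun e _ => ?_) (fun e _ e' _ h => ?_)
    fun e he => ?_
  · simpa using e.2.2
  · obtain ⟨⟨i, j⟩, hij, _⟩ := e
    obtain ⟨⟨i', j'⟩, hij', _⟩ := e'
    simp only [Sym2.eq_iff] at h hij hij'
    rcases h with ⟨rfl, rfl⟩ | ⟨rfl, rfl⟩
    · rfl
    · exact absurd hij (lt_asymm hij')
  · induction e using Sym2.ind with
    | h i j =>
      have hadj : Γ.Adj i j := by simpa using he
      rcases lt_or_gt_of_ne hadj.ne with h | h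
      · exact ⟨⟨(i, j), h, hadj⟩, Finset.mem_univ _, rfl⟩
      · exact ⟨⟨(j, i), h, hadj.symm⟩, Finset.mem_univ _, Sym2.eq_swap⟩

theorem card_graphCoupling : (Fintype.card (GraphCoupling Γ) : ℝ) = 9 * Γ.edgeFinset.card := by
  rw [Fintype.card_prod, card_edges]
  simp
  ring

theorem one_div_sqrt_card_graphCoupling :
    1 / √(Fintype.card (GraphCoupling Γ) : ℝ) = 1 / (3 * √(Γ.edgeFinset.card : ℝ)) := by
  rw [card_graphCoupling, Real.sqrt_mul (by norm_num)]
  congr 2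
  rw [show (9 : ℝ) = 3 ^ 2 by norm_num, Real.sqrt_sq (by norm_num)]

omit [DecidableRel Γ.Adj] in
theorem graph_isSpinFamily : IsSpinFamily (fun c => pauliString (graphString Γ c))
    fun c d => stringSign (graphString Γ c) (graphString Γ d) :=
  isSpinFamily_pauliString (graphString_injective Γ)

theorem graphSpectral_eq (x : GraphCoupling Γ → ℝ) :
    graphSpectral Γ x = (graph_isSpinFamily Γ).spectral x := by
  refine spectralMeasure_congr ?_ _ _
  rw [graphHamiltonian, spinHamiltonian, one_div_sqrt_card_graphCoupling]
  simp only [spin_mul_spin_eq_pauliString]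

theorem card_filter_fst_le (v : Fin n) :
    (Finset.univ.filter fun e : {e : Fin n × Fin n // e.1 < e.2 ∧ Γ.Adj e.1 e.2} =>
      e.1.1 = v).card ≤ Γ.maxDegree := by
  refine le_trans ?_ (Γ.degree_le_maxDegree v)
  rw [← SimpleGraph.card_neighborFinset_eq_degree]
  refine Finset.card_le_card_of_injOn (fun e => e.1.2) (fun e he => ?_) fun e he e' he' h => ?_
  · simp only [Finset.coe_filter, Finset.mem_univ, true_and, Set.mem_ofPred_eq] at he
    subst he
    simpa using e.2.2
  · simp only [Finset.coe_filter, Finset.mem_univ, true_and, Set.mem_ofPred_eq] at he he'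
    exact Subtype.ext (Prod.ext (he.trans he'.symm) h)

theorem card_filter_snd_le (v : Fin n) :
    (Finset.univ.filter fun e : {e : Fin n × Fin n // e.1 < e.2 ∧ Γ.Adj e.1 e.2} =>
      e.1.2 = v).card ≤ Γ.maxDegree := by
  refine le_trans ?_ (Γ.degree_le_maxDegree v)
  rw [← SimpleGraph.card_neighborFinset_eq_degree]
  refine Finset.card_le_card_of_injOn (fun e => e.1.1) (fun e he => ?_) fun e he e' he' h => ?_
  · simp only [Finset.coe_filter, Finset.mem_univ, true_and, Set.mem_ofPred_eq] at he
    subst he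
    simpa using e.2.2.symm
  · simp only [Finset.coe_filter, Finset.mem_univ, true_and, Set.mem_ofPred_eq] at he he'
    exact Subtype.ext (Prod.ext h (he.trans he'.symm))

/-- Strings on disjoint edges commute. A shared vertex can arise in four ways, each for at most
`maxDegree` edges with nine label pairs, and the sign then deviates from `1` by at most `2`: in
total `4 · 9 · 2 = 72`. -/
theorem sum_abs_stringSign_sub_one_le (d : GraphCoupling Γ) :
    ∑ c, |stringSign (graphString Γ c) (graphString Γ d) - 1| ≤ 72 * Γ.maxDegree := by
  set i := d.1.1.1
  set j := d.1.1.2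
  have h1 : ∀ c : GraphCoupling Γ, |stringSign (graphString Γ c) (graphString Γ d) - 1|
      ≤ 2 * ((if c.1.1.1 = i then 1 else 0) + (if c.1.1.1 = j then 1 else 0)
        + (if c.1.1.2 = i then 1 else 0) + (if c.1.1.2 = j then 1 else 0)) := by
    intro c
    by_cases hc : c.1.1.1 = i ∨ c.1.1.1 = j ∨ c.1.1.2 = i ∨ c.1.1.2 = j
    · have h2 : |stringSign (graphString Γ c) (graphString Γ d) - 1| ≤ 2 := by
        refine (abs_sub _ _).trans ?_
        rw [abs_stringSign]
        norm_num
      refine h2.trans ?_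
      rcases hc with h | h | h | h <;> rw [if_pos h] <;> split_ifs <;> norm_num
    · push Not at hc
      obtain ⟨h2, h3, h4, h5⟩ := hc
      have : stringSign (graphString Γ c) (graphString Γ d) = 1 := by
        refine Finset.prod_eq_one fun k _ => ?_
        by_cases hk : k = c.1.1.1 ∨ k = c.1.1.2
        · have : graphString Γ d k = none := by
            rcases hk with rfl | rfl <;> simp [graphString, *, i, j]
          rw [this]
          cases graphString Γ c k <;> rfl
        · push Not at hk
          have : graphString Γ c k = none := by simp [graphString, hk]
          rw [this]
          rfl
      rw [this]
      simp [h2, h3, h4, h5]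
  refine (Finset.sum_le_sum fun c _ => h1 c).trans ?_
  have hf : ∀ v, (∑ e : {e : Fin n × Fin n // e.1 < e.2 ∧ Γ.Adj e.1 e.2},
      if e.1.1 = v then (1 : ℝ) else 0) ≤ Γ.maxDegree := fun v => by
    rw [Finset.sum_boole]; exact_mod_cast card_filter_fst_le Γ v
  have hs : ∀ v, (∑ e : {e : Fin n × Fin n // e.1 < e.2 ∧ Γ.Adj e.1 e.2},
      if e.1.2 = v then (1 : ℝ) else 0) ≤ Γ.maxDegree := fun v => by
    rw [Finset.sum_boole]; exact_mod_cast card_filter_snd_le Γ v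
  have hp : ∀ F : {e : Fin n × Fin n // e.1 < e.2 ∧ Γ.Adj e.1 e.2} → ℝ,
      ∑ c : GraphCoupling Γ, F c.1 = 9 * ∑ e, F e := fun F => by
    rw [Fintype.sum_prod_type, Finset.mul_sum]
    refine Finset.sum_congr rfl fun e _ => ?_
    simp only [Finset.sum_const, Finset.card_univ, Fintype.card_prod, Fintype.card_fin,
      nsmul_eq_mul]
    norm_num
  rw [← Finset.mul_sum, hp fun e => (if e.1.1 = i then (1 : ℝ) else 0)
    + (if e.1.1 = j then 1 else 0) + (if e.1.2 = i then 1 else 0) + if e.1.2 = j then 1 else 0]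
  simp only [Finset.sum_add_distrib]
  have h3 := hf i
  have h4 := hf j
  have h5 := hs i
  have h6 := hs j
  linarith

end Graph

/-- A product of numbers of modulus at most `1` differs from `1` by at most the sum of the
deviations of its factors, so each element of the list costs `η` on average. -/
theorem abs_signAverage_sub_one_le {ι : Type*} [Fintype ι] [Nonempty ι] {ε : ι → ι → ℝ} {η : ℝ}
    (hε : ∀ c d, |ε c d| ≤ 1) (hη : ∀ d, (Fintype.card ι : ℝ)⁻¹ * ∑ c, |ε c d - 1| ≤ η)
    (L : List ι) : |signAverage ε L - 1| ≤ L.length * η := by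
  have h1 : signAverage ε L - 1 = (Fintype.card ι : ℝ)⁻¹ * ∑ c, ((L.map (ε c)).prod - 1) := by
    rw [signAverage, Finset.sum_sub_distrib, mul_sub]
    simp
  have h2 : ∀ L : List ι, (Fintype.card ι : ℝ)⁻¹ * ∑ c, |(L.map (ε c)).prod - 1|
      ≤ L.length * η := by
    intro L
    induction L with
    | nil => simp
    | cons d L ih =>
      have h3 : ∀ c, |((d :: L).map (ε c)).prod - 1|
          ≤ |ε c d - 1| + |(L.map (ε c)).prod - 1| := by
        intro c
        rw [List.map_cons, List.prod_cons]
        have e : ε c d * (L.map (ε c)).prod - 1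
            = (ε c d - 1) * (L.map (ε c)).prod + ((L.map (ε c)).prod - 1) := by ring
        rw [e]
        refine (abs_add_le _ _).trans (add_le_add ?_ le_rfl)
        rw [abs_mul]
        exact mul_le_of_le_one_right (abs_nonneg _) (abs_prod_map_le_one hε c L)
      have h4 := mul_le_mul_of_nonneg_left (Finset.sum_le_sum fun c (_ : c ∈ Finset.univ) => h3 c)
        (show 0 ≤ (Fintype.card ι : ℝ)⁻¹ by positivity)
      rw [Finset.sum_add_distrib, mul_add] at h4
      rw [List.length_cons]
      push_cast
      linarith [hη d]
  rw [h1, abs_mul, abs_of_nonneg (by positivity)]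
  exact (mul_le_mul_of_nonneg_left (Finset.abs_sum_le_sum_abs _ _) (by positivity)).trans (h2 L)

/-- For coupling graphs of small maximal degree, most terms of the Hamiltonian commute. -/
theorem tendsto_signAverage_graph {Γ : ∀ n : ℕ, SimpleGraph (Fin n)} [∀ n, DecidableRel (Γ n).Adj]
    (hΓ : (fun n => ((Γ n).maxDegree : ℝ)) =o[atTop] fun n => ((Γ n).edgeFinset.card : ℝ))
    (hne : ∀ᶠ n in atTop, Nonempty (GraphCoupling (Γ n))) (m : ℕ) :
    Tendsto (fun n => listAverage m fun L => |signAverage (fun c d =>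
      stringSign (graphString (Γ n) c) (graphString (Γ n) d)) L - 1 ^ m|) atTop (𝓝 0) := by
  -- The factor `8` is `72 / 9`, as there are nine couplings for each edge.
  have h1 : Tendsto (fun n => (m : ℝ) * (8 * (((Γ n).maxDegree : ℝ) / (Γ n).edgeFinset.card)))
      atTop (𝓝 0) := by
    simpa using (hΓ.tendsto_div_nhds_zero.const_mul 8).const_mul (m : ℝ)
  refine tendsto_of_tendsto_of_tendsto_of_le_of_le' tendsto_const_nhds h1
    (.of_forall fun n => listAverage_nonneg fun L _ => abs_nonneg _) ?_
  filter_upwards [hne] with n hn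
  rw [← listAverage_const (ι := GraphCoupling (Γ n)) m
    ((m : ℝ) * (8 * (((Γ n).maxDegree : ℝ) / (Γ n).edgeFinset.card)))]
  refine listAverage_mono fun L hL => ?_
  rw [one_pow, ← hL]
  refine abs_signAverage_sub_one_le (fun c d => (abs_stringSign _ _).le) (fun d => ?_) L
  rw [card_graphCoupling]
  refine (mul_le_mul_of_nonneg_left (sum_abs_stringSign_sub_one_le (Γ n) d)
    (by positivity)).trans (le_of_eq ?_)
  rw [mul_inv]
  ring

end SpinGlass

namespace SpinGlass

/-! ### Products of Pauli strings -/

/-- The product of two local operators, up to a phase. -/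
def pauliMul : Option (Fin 3) → Option (Fin 3) → Option (Fin 3)
  | none, o => o
  | some a, none => some a
  -- The three indices sum to `0` in `Fin 3`, so `-(a + b)` is the remaining one.
  | some a, some b => if a = b then none else some (-(a + b))

/-- Multiplicativity of commutation signs reduces the signs against a whole list of strings to one
sign against their product. -/
theorem pauliSign_pauliMul (x o o' : Option (Fin 3)) :
    pauliSign x (pauliMul o o') = pauliSign x o * pauliSign x o' := by
  cases x with
  | none => simp [pauliSign]
  | some x =>
    cases o with
    | none => simp [pauliSign, pauliMul]
    | some a =>
      cases o' with
      | none => simp [pauliSign, pauliMul]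
      | some b => fin_cases x <;> fin_cases a <;> fin_cases b <;> simp +decide [pauliSign, pauliMul]

theorem pauliMul_some_eq_none_iff (a : Fin 3) (o : Option (Fin 3)) :
    pauliMul (some a) o = none ↔ o = some a := by
  cases o with
  | none => simp [pauliMul]
  | some b =>
    simp only [pauliMul, Option.some.injEq]
    split_ifs with h
    · simp [h]
    · simp [Ne.symm h]

/-- Against a given Pauli matrix one label commutes and two anticommute, with mean sign `-1/3`. The
constant `4/3 = 1 - (-1/3)` in the limiting `q` comes from here. -/
theorem sum_pauliSign_some (o : Option (Fin 3)) :
    ∑ b, pauliSign (some b) o = 3 * (-1 / 3 : ℝ) ^ (if o = none then 0 else 1) := by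
  cases o with
  | none => simp [pauliSign]
  | some a => fin_cases a <;> simp [pauliSign, Fin.sum_univ_three] <;> norm_num

section Product

variable {n : ℕ} {ι : Type*} (str : ι → Fin n → Option (Fin 3))

/-- The product of a list of Pauli strings, up to a phase. -/
def productString : List ι → Fin n → Option (Fin 3)
  | [] => fun _ => none
  | d :: L => fun k => pauliMul (str d k) (productString L k)

theorem prod_stringSign (f : Fin n → Option (Fin 3)) (L : List ι) :
    (L.map fun d => stringSign f (str d)).prod = stringSign f (productString str L) := by
  induction L with
  | nil =>
    refine (Finset.prod_eq_one fun k _ => ?_).symm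
    rw [productString]
    cases f k <;> rfl
  | cons d L ih =>
    rw [List.map_cons, List.prod_cons, ih, stringSign, stringSign, stringSign,
      ← Finset.prod_mul_distrib]
    exact Finset.prod_congr rfl fun k _ => (pauliSign_pauliMul _ _ _).symm

/-- The sites at which a Pauli string is not the identity. -/
def stringSupport (f : Fin n → Option (Fin 3)) : Finset (Fin n) :=
  Finset.univ.filter fun k => f k ≠ none

theorem mem_stringSupport {f : Fin n → Option (Fin 3)} {k : Fin n} :
    k ∈ stringSupport f ↔ f k ≠ none := by
  simp [stringSupport]

/-- The sites at which some string of a list is not the identity. -/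
def supportUnion : List ι → Finset (Fin n)
  | [] => ∅
  | d :: L => stringSupport (str d) ∪ supportUnion L

theorem stringSupport_productString_subset (L : List ι) :
    stringSupport (productString str L) ⊆ supportUnion str L := by
  induction L with
  | nil => simp [stringSupport, productString]
  | cons d L ih =>
    intro k hk
    rw [mem_stringSupport, productString] at hk
    rw [supportUnion, Finset.mem_union]
    by_cases h : str d k = none
    · right
      refine ih ?_
      simpa [mem_stringSupport, h, pauliMul] using hk
    · left
      simpa [mem_stringSupport] using h

theorem card_supportUnion_le {p : ℕ} (hp : ∀ d, (stringSupport (str d)).card = p) (L : List ι) :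
    (supportUnion str L).card ≤ L.length * p := by
  induction L with
  | nil => simp [supportUnion]
  | cons d L ih =>
    refine (Finset.card_union_le _ _).trans ?_
    rw [hp, List.length_cons]
    linarith

/-- Cancellation is possible only where the new string meets the old ones. The sites of `W \ A` and
of `A \ U` survive, and what is lost from `W` and from `A` is in each case at most `|A ∩ U|`. -/
theorem card_stringSupport_productString_cons (d : ι) (L : List ι) :
    (stringSupport (productString str L)).card + (stringSupport (str d)).card
      ≤ (stringSupport (productString str (d :: L))).card
        + 2 * (stringSupport (str d) ∩ supportUnion str L).card := by
  set A := stringSupport (str d)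
  set W := stringSupport (productString str L)
  set U := supportUnion str L
  have hWU : W ⊆ U := stringSupport_productString_subset str L
  have h1 : (W \ A) ∪ (A \ U) ⊆ stringSupport (productString str (d :: L)) := by
    intro k hk
    rw [Finset.mem_union, Finset.mem_sdiff, Finset.mem_sdiff] at hk
    rw [mem_stringSupport, productString]
    rcases hk with ⟨hW, hA⟩ | ⟨hA, hU⟩
    · have h2 : str d k = none := by simpa [A, mem_stringSupport] using hA
      have h3 : productString str L k ≠ none := by simpa [W, mem_stringSupport] using hW
      simpa [h2, pauliMul] using h3
    · have h2 : str d k ≠ none := by simpa [A, mem_stringSupport] using hA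
      have h3 : productString str L k = none := by
        simpa [W, mem_stringSupport] using fun h => hU (hWU h)
      obtain ⟨a, ha⟩ := Option.ne_none_iff_exists'.1 h2
      simp [ha, h3, pauliMul]
  have h2 : Disjoint (W \ A) (A \ U) :=
    Finset.disjoint_left.2 fun k hk hk' => (Finset.mem_sdiff.1 hk).2 (Finset.mem_sdiff.1 hk').1
  have h3 := Finset.card_le_card h1
  rw [Finset.card_union_of_disjoint h2] at h3
  have h4 := Finset.card_sdiff_add_card_inter W A
  have h5 := Finset.card_sdiff_add_card_inter A U
  have h6 : (W ∩ A).card ≤ (A ∩ U).card := by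
    rw [Finset.inter_comm]
    exact Finset.card_le_card (Finset.inter_subset_inter_left hWU)
  omega

end Product

/-! ### Couplings of the `p`-spin model -/

section Glass

variable {n p : ℕ}

theorem GlassCoupling.strictMono (c : GlassCoupling n p) : StrictMono c.1.1 :=
  fun k l h => c.1.2 k l h

/-- The Pauli string of a coupling of the `p`-spin model. -/
noncomputable def glassString (c : GlassCoupling n p) : Fin n → Option (Fin 3) :=
  Function.extend c.1.1 (fun l => some (c.2 l)) fun _ => none

theorem glassString_apply (c : GlassCoupling n p) (l : Fin p) :
    glassString c (c.1.1 l) = some (c.2 l) :=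
  c.strictMono.injective.extend_apply _ _ _

theorem glassString_eq_none (c : GlassCoupling n p) {k : Fin n} (hk : ¬∃ l, c.1.1 l = k) :
    glassString c k = none :=
  Function.extend_apply' _ _ _ hk

theorem stringSupport_glassString (c : GlassCoupling n p) :
    stringSupport (glassString c) = Finset.univ.image c.1.1 := by
  ext k
  simp only [mem_stringSupport, Finset.mem_image, Finset.mem_univ, true_and]
  constructor
  · intro h
    by_contra h'
    exact h (glassString_eq_none c h')
  · rintro ⟨l, rfl⟩
    simp [glassString_apply]

theorem card_stringSupport_glassString (c : GlassCoupling n p) :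
    (stringSupport (glassString c)).card = p := by
  rw [stringSupport_glassString, Finset.card_image_of_injective _ c.strictMono.injective]
  simp

theorem image_strictMono_injective {f g : Fin p → Fin n} (hf : StrictMono f) (hg : StrictMono g)
    (h : Finset.univ.image f = Finset.univ.image g) : f = g := by
  refine (hf.range_inj hg).1 ?_
  have := congrArg (fun s : Finset (Fin n) => (s : Set (Fin n))) h
  simpa using this

theorem glassString_injective : Function.Injective (glassString (n := n) (p := p)) := by
  intro c d h
  have h1 : c.1.1 = d.1.1 := by
    refine image_strictMono_injective c.strictMono d.strictMono ?_
    rw [← stringSupport_glassString, ← stringSupport_glassString, h]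
  refine Prod.ext (Subtype.ext h1) (funext fun l => ?_)
  have h2 := congrFun h (c.1.1 l)
  rw [glassString_apply, h1, glassString_apply] at h2
  exact Option.some.inj h2

theorem list_prod_spin_eq_pauliString (c : GlassCoupling n p) :
    (List.ofFn fun l => spin (c.1.1 l) (c.2 l)).prod = pauliString (glassString c) := by
  simp only [spin]
  rw [list_prod_tensor, pauliString]
  congr 1
  funext k
  by_cases hk : ∃ l, c.1.1 l = k
  · obtain ⟨l, rfl⟩ := hk
    rw [list_prod_ofFn_eq_single _ l, glassString_apply]
    · simp [pauliOpt]
    · intro l' hl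
      exact Function.update_of_ne (fun h => hl (c.strictMono.injective h).symm) _ _
  · rw [glassString_eq_none c hk, List.prod_eq_one]
    · rfl
    · intro x hx
      obtain ⟨l, rfl⟩ := (List.mem_ofFn' _ _).1 hx
      exact Function.update_of_ne (fun h => hk ⟨l, h.symm⟩) _ _

theorem sum_image_strictMono {M : Type*} [AddCommMonoid M] (Ψ : Finset (Fin n) → M) :
    ∑ i : {i : Fin p → Fin n // ∀ k l, k < l → i k < i l}, Ψ (Finset.univ.image i.1)
      = ∑ I ∈ Finset.powersetCard p Finset.univ, Ψ I := by
  refine Finset.sum_bij (fun i _ => Finset.univ.image i.1) (fun i _ => ?_)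
    (fun i _ j _ h => ?_) (fun I hI => ?_) fun i _ => rfl
  · rw [Finset.mem_powersetCard]
    refine ⟨Finset.subset_univ _, ?_⟩
    rw [Finset.card_image_of_injective]
    · simp
    · exact StrictMono.injective fun k l h => i.2 k l h
  · exact Subtype.ext (image_strictMono_injective (fun k l h => i.2 k l h)
      (fun k l h => j.2 k l h) h)
  · have hc := (Finset.mem_powersetCard.1 hI).2
    refine ⟨⟨I.orderEmbOfFin hc, fun k l h => (I.orderEmbOfFin hc).strictMono h⟩,
      Finset.mem_univ _, ?_⟩
    simp

theorem sum_stringSupport_glassString (Ψ : Finset (Fin n) → ℝ) :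
    ∑ c : GlassCoupling n p, Ψ (stringSupport (glassString c))
      = 3 ^ p * ∑ I ∈ Finset.powersetCard p Finset.univ, Ψ I := by
  simp only [stringSupport_glassString]
  rw [Fintype.sum_prod_type, ← sum_image_strictMono, Finset.mul_sum]
  refine Finset.sum_congr rfl fun i _ => ?_
  simp

/-- For a fixed set of sites the labels are summed independently, so the sum of products becomes a
product of sums. -/
theorem sum_prod_glassString (F : Fin n → Option (Fin 3) → ℝ) (hF : ∀ k, F k none = 1) :
    ∑ c : GlassCoupling n p, ∏ k, F k (glassString c k)
      = ∑ I ∈ Finset.powersetCard p Finset.univ, ∏ k ∈ I, ∑ b, F k (some b) := by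
  rw [Fintype.sum_prod_type, ← sum_image_strictMono]
  refine Finset.sum_congr rfl fun i _ => ?_
  have hi : StrictMono i.1 := fun k l h => i.2 k l h
  rw [Finset.prod_image hi.injective.injOn, Finset.prod_univ_sum, Fintype.piFinset_univ]
  refine Finset.sum_congr rfl fun a _ => ?_
  rw [← Finset.prod_subset (Finset.subset_univ (Finset.univ.image i.1)) fun k _ hk => ?_,
    Finset.prod_image hi.injective.injOn]
  · exact Finset.prod_congr rfl fun l _ =>
      congrArg _ (glassString_apply (⟨i, a⟩ : GlassCoupling n p) l)
  · rw [glassString_eq_none _ fun ⟨l, hl⟩ => hk (Finset.mem_image.2 ⟨l, Finset.mem_univ l, hl⟩),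
      hF]

theorem card_glassCoupling :
    (Fintype.card (GlassCoupling n p) : ℝ) = 3 ^ p * n.choose p := by
  have := sum_stringSupport_glassString (n := n) (p := p) fun _ => 1
  simpa using this

theorem one_div_sqrt_card_glassCoupling :
    1 / √(Fintype.card (GlassCoupling n p) : ℝ)
      = (3 : ℝ) ^ (-(p : ℝ) / 2) * (n.choose p : ℝ) ^ (-(1 : ℝ) / 2) := by
  rw [card_glassCoupling, Real.sqrt_mul (by positivity), one_div, mul_inv]
  congr 1
  · rw [neg_div, Real.rpow_neg (by norm_num), Real.sqrt_eq_rpow, ← Real.rpow_natCast,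
      ← Real.rpow_mul (by norm_num)]
    congr 2
    ring
  · rw [neg_div, Real.rpow_neg (by positivity), Real.sqrt_eq_rpow]

theorem glass_isSpinFamily (n p : ℕ) :
    IsSpinFamily (fun c : GlassCoupling n p => pauliString (glassString c))
      fun c d => stringSign (glassString c) (glassString d) :=
  isSpinFamily_pauliString glassString_injective

theorem glassSpectral_eq (x : GlassCoupling n p → ℝ) :
    glassSpectral n p x = (glass_isSpinFamily n p).spectral x := by
  refine spectralMeasure_congr ?_ _ _
  rw [glassHamiltonian, spinHamiltonian, one_div_sqrt_card_glassCoupling]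
  simp only [list_prod_spin_eq_pauliString]

end Glass

end SpinGlass

namespace SpinGlass

/-! ### Overlaps of random subsets -/

section Subsets

variable {n : ℕ} (p : ℕ)

/-- The average of `z ^ |I ∩ W|` over the subsets `I` of size `p`. -/
noncomputable def subsetMean (z : ℝ) (W : Finset (Fin n)) : ℝ :=
  (n.choose p : ℝ)⁻¹ * ∑ I ∈ Finset.powersetCard p Finset.univ, z ^ (I ∩ W).card

theorem sum_powersetCard_const (a : ℝ) :
    ∑ _I ∈ Finset.powersetCard p (Finset.univ : Finset (Fin n)), a = n.choose p * a := by
  simp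

/-- The transposition of `x` and `y` permutes the `p`-subsets and fixes `W`. -/
theorem sum_pow_mul_mem_eq (z : ℝ) {W : Finset (Fin n)} {x y : Fin n} (hx : x ∉ W) (hy : y ∉ W) :
    ∑ I ∈ Finset.powersetCard p Finset.univ, z ^ (I ∩ W).card * (if x ∈ I then 1 else 0)
      = ∑ I ∈ Finset.powersetCard p Finset.univ,
        z ^ (I ∩ W).card * (if y ∈ I then 1 else 0) := by
  set e : Fin n ≃ Fin n := Equiv.swap x y
  have hW : W.map e.toEmbedding = W := by
    ext k
    rw [Finset.mem_map_equiv, Equiv.symm_swap]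
    by_cases hkx : k = x
    · subst hkx; simp [hx, hy]
    · by_cases hky : k = y
      · subst hky; simp [hx, hy]
      · rw [Equiv.swap_apply_of_ne_of_ne hkx hky]
  have hinv : ∀ I : Finset (Fin n), (I.map e.toEmbedding).map e.toEmbedding = I := by
    intro I
    ext k
    simp [Finset.mem_map_equiv, e]
  have hmem : ∀ I ∈ Finset.powersetCard p (Finset.univ : Finset (Fin n)),
      I.map e.toEmbedding ∈ Finset.powersetCard p (Finset.univ : Finset (Fin n)) := by
    intro I hI
    rw [Finset.mem_powersetCard] at hI ⊢
    exact ⟨Finset.subset_univ _, by rw [Finset.card_map, hI.2]⟩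
  refine Finset.sum_bij' (fun I _ => I.map e.toEmbedding) (fun I _ => I.map e.toEmbedding) hmem hmem
    (fun I _ => hinv I) (fun I _ => hinv I) fun I _ => ?_
  have h1 : (I.map e.toEmbedding ∩ W).card = (I ∩ W).card := by
    conv_lhs => rw [← hW, ← Finset.map_inter, Finset.card_map]
  have h2 : y ∈ I.map e.toEmbedding ↔ x ∈ I := by
    rw [Finset.mem_map_equiv, Equiv.symm_swap, Equiv.swap_apply_right]
  rw [h1]
  simp only [h2]

/-- By symmetry the indicator of `x` can be averaged over the complement of `W`, which `I` meets in
`p - |I ∩ W|` points. This exact identity replaces a conditional probability. -/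
theorem mul_sum_pow_mul_mem (z : ℝ) {W : Finset (Fin n)} {x : Fin n} (hx : x ∉ W) :
    ((n : ℝ) - W.card)
        * ∑ I ∈ Finset.powersetCard p Finset.univ, z ^ (I ∩ W).card * (if x ∈ I then 1 else 0)
      = ∑ I ∈ Finset.powersetCard p Finset.univ, z ^ (I ∩ W).card * ((p : ℝ) - (I ∩ W).card) := by
  have h1 : ((Wᶜ).card : ℝ) = n - W.card := by
    rw [Finset.card_compl, Fintype.card_fin, Nat.cast_sub]
    simpa using Finset.card_le_univ W
  have h2 : ∑ y ∈ Wᶜ, ∑ I ∈ Finset.powersetCard p Finset.univ,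
        z ^ (I ∩ W).card * (if y ∈ I then (1 : ℝ) else 0)
      = ((Wᶜ).card : ℝ) * ∑ I ∈ Finset.powersetCard p Finset.univ,
        z ^ (I ∩ W).card * (if x ∈ I then 1 else 0) := by
    rw [Finset.sum_congr rfl fun y hy =>
      sum_pow_mul_mem_eq p z (Finset.mem_compl.1 hy) hx, Finset.sum_const, nsmul_eq_mul]
  rw [← h1, ← h2, Finset.sum_comm]
  refine Finset.sum_congr rfl fun I hI => ?_
  rw [← Finset.mul_sum]
  congr 1
  rw [Finset.sum_ite_mem, Finset.sum_const, nsmul_eq_mul, mul_one, Finset.inter_comm]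
  have h3 := Finset.card_inter_add_card_sdiff I W
  rw [(Finset.mem_powersetCard.1 hI).2] at h3
  rw [← Finset.sdiff_eq_inter_compl]
  have h4 : ((I ∩ W).card : ℝ) + (I \ W).card = p := by exact_mod_cast h3
  linarith

theorem mul_sum_mem (x : Fin n) :
    (n : ℝ) * ∑ I ∈ Finset.powersetCard p Finset.univ, (if x ∈ I then (1 : ℝ) else 0)
      = n.choose p * p := by
  have := mul_sum_pow_mul_mem p 1 (Finset.notMem_empty x)
  simpa using this

theorem mul_sum_card_inter (W : Finset (Fin n)) :
    (n : ℝ) * ∑ I ∈ Finset.powersetCard p Finset.univ, ((I ∩ W).card : ℝ)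
      = n.choose p * (p * W.card) := by
  have h1 : ∀ I : Finset (Fin n), ((I ∩ W).card : ℝ) = ∑ x ∈ W, if x ∈ I then 1 else 0 := by
    intro I
    rw [Finset.sum_ite_mem, Finset.inter_comm]
    simp
  simp only [h1]
  rw [Finset.sum_comm, Finset.mul_sum, Finset.sum_congr rfl fun x _ => mul_sum_mem p x,
    Finset.sum_const, nsmul_eq_mul]
  ring

theorem sum_pow_insert (z : ℝ) {W : Finset (Fin n)} {x : Fin n} (hx : x ∉ W) :
    ∑ I ∈ Finset.powersetCard p Finset.univ, z ^ (I ∩ insert x W).card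
      = ∑ I ∈ Finset.powersetCard p Finset.univ, z ^ (I ∩ W).card
        + (z - 1) * ∑ I ∈ Finset.powersetCard p Finset.univ,
          z ^ (I ∩ W).card * (if x ∈ I then 1 else 0) := by
  rw [Finset.mul_sum, ← Finset.sum_add_distrib]
  refine Finset.sum_congr rfl fun I _ => ?_
  by_cases h : x ∈ I
  · rw [Finset.inter_insert_of_mem h, Finset.card_insert_of_notMem (by simp [hx]), if_pos h]
    ring
  · rw [Finset.inter_insert_of_notMem h, if_neg h]
    ring

theorem subsetMean_empty (hp : p ≤ n) (z : ℝ) : subsetMean p z (∅ : Finset (Fin n)) = 1 := by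
  have : (n.choose p : ℝ) ≠ 0 := by exact_mod_cast (Nat.choose_pos hp).ne'
  simp [subsetMean, this]

/-- The size of `I ∩ W` and the decreasing function `z ^ |I ∩ W|` are negatively correlated. -/
theorem mul_sum_pow_mul_card_le (hn : 0 < n) {z : ℝ} (hz : 0 < z) (hz1 : z ≤ 1)
    (W : Finset (Fin n)) :
    ∑ I ∈ Finset.powersetCard p Finset.univ,
      z ^ (I ∩ W).card * (((I ∩ W).card : ℝ) - p * W.card / n) ≤ 0 := by
  have hn' : (n : ℝ) ≠ 0 := by exact_mod_cast hn.ne'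
  set κ : ℝ := p * W.card / n
  -- Chebyshev's trick: comparing the decreasing weight `z ^ k` with its value at the mean `κ`
  -- leaves a sum that vanishes.
  have h1 : ∀ k : ℕ, z ^ k * ((k : ℝ) - κ) ≤ z ^ κ * ((k : ℝ) - κ) := by
    intro k
    rw [← Real.rpow_natCast]
    rcases le_total κ k with h | h
    · exact mul_le_mul_of_nonneg_right (Real.rpow_le_rpow_of_exponent_ge hz hz1 h) (by linarith)
    · exact mul_le_mul_of_nonpos_right (Real.rpow_le_rpow_of_exponent_ge hz hz1 h) (by linarith)
  refine (Finset.sum_le_sum fun I _ => h1 (I ∩ W).card).trans (le_of_eq ?_)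
  rw [← Finset.mul_sum, Finset.sum_sub_distrib, sum_powersetCard_const]
  have h2 := mul_sum_card_inter p W
  have h3 : ∑ I ∈ Finset.powersetCard p Finset.univ, ((I ∩ W).card : ℝ) = n.choose p * κ := by
    simp only [κ]
    field_simp
    linarith
  rw [h3, sub_self, mul_zero]

/-- Under the weight `z ^ |I ∩ W|` the set `I` meets `W` at most as often as on average, hence
contains the outside point `x` with weight at least `p / n`. -/
theorem subsetMean_insert_le (hn : 0 < n) {z : ℝ} (hz : 0 < z) (hz1 : z ≤ 1)
    {W : Finset (Fin n)} {x : Fin n} (hx : x ∉ W) :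
    subsetMean p z (insert x W) ≤ (1 - (1 - z) * p / n) * subsetMean p z W := by
  have hn' : (0 : ℝ) < n := by exact_mod_cast hn
  have hw : (0 : ℝ) < n - W.card := by
    have h1 := Finset.card_lt_univ_of_notMem hx
    rw [Fintype.card_fin] at h1
    have : (W.card : ℝ) < n := by exact_mod_cast h1
    linarith
  have h1 := mul_sum_pow_mul_mem p z hx
  have h2 := mul_sum_pow_mul_card_le p hn hz hz1 W
  rw [subsetMean, subsetMean, sum_pow_insert p z hx]
  set A := ∑ I ∈ Finset.powersetCard p Finset.univ, z ^ (I ∩ W).card * (if x ∈ I then 1 else 0)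
  set T := ∑ I ∈ Finset.powersetCard p Finset.univ, z ^ (I ∩ W).card
  have h3 : (p : ℝ) / n * T ≤ A := by
    refine le_of_mul_le_mul_left ?_ hw
    rw [h1]
    have h4 : ∑ I ∈ Finset.powersetCard p Finset.univ, z ^ (I ∩ W).card * ((p : ℝ) - (I ∩ W).card)
        = (n - W.card) * (p / n * T) - ∑ I ∈ Finset.powersetCard p Finset.univ,
          z ^ (I ∩ W).card * (((I ∩ W).card : ℝ) - p * W.card / n) := by
      simp only [T, Finset.mul_sum]
      rw [← Finset.sum_sub_distrib]
      refine Finset.sum_congr rfl fun I _ => ?_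
      field_simp
      ring
    linarith
  have h5 : T + (z - 1) * A ≤ (1 - (1 - z) * p / n) * T := by
    have := mul_le_mul_of_nonneg_left h3 (sub_nonneg.2 hz1)
    have e : (1 - (1 - z) * p / n) * T = T - (1 - z) * (p / n * T) := by ring
    rw [e]
    linarith
  calc _ ≤ (n.choose p : ℝ)⁻¹ * ((1 - (1 - z) * p / n) * T) :=
        mul_le_mul_of_nonneg_left h5 (by positivity)
    _ = _ := by ring

/-- Taking absolute values replaces `-1/3` by `1/3`, where the monotone estimate applies. The rate
drops from `4/3` to `2/3`, which suffices for showing decay to `0`. -/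
theorem abs_subsetMean_neg_le (hn : 0 < n) (hp : p ≤ n) (W : Finset (Fin n)) :
    |subsetMean p (-1 / 3) W| ≤ (1 - 2 * p / (3 * n)) ^ W.card := by
  have hn' : (0 : ℝ) < n := by exact_mod_cast hn
  have hpn : (p : ℝ) / n ≤ 1 := by
    rw [div_le_one hn']
    exact_mod_cast hp
  have h1 : ∀ W : Finset (Fin n), |subsetMean p (-1 / 3) W| ≤ subsetMean p (1 / 3) W := fun W => by
    rw [subsetMean, abs_mul, abs_of_nonneg (by positivity), subsetMean]
    refine mul_le_mul_of_nonneg_left ((Finset.abs_sum_le_sum_abs _ _).trans (le_of_eq ?_))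
      (by positivity)
    refine Finset.sum_congr rfl fun I _ => ?_
    rw [abs_pow]
    norm_num
  refine (h1 W).trans ?_
  induction W using Finset.induction_on with
  | empty => rw [subsetMean_empty p hp]; simp
  | insert x W hx ih =>
    have h2 := subsetMean_insert_le p hn (z := 1 / 3) (by norm_num) (by norm_num) hx
    have e : (1 : ℝ) - (1 - 1 / 3) * p / n = 1 - 2 * p / (3 * n) := by
      field_simp
      ring
    rw [e] at h2
    rw [Finset.card_insert_of_notMem hx, pow_succ']
    refine h2.trans (mul_le_mul_of_nonneg_left ih ?_)
    have : 2 * (p : ℝ) / (3 * n) = 2 / 3 * (p / n) := by field_simp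
    rw [this]
    linarith

/-- For `z` of either sign, correlation with `W` costs at most the average of `κ + |I ∩ W|`, which
is `2 κ`, divided by the `n - |W|` available places. -/
theorem abs_subsetMean_insert_sub_le (hn : 0 < n) (hp : p ≤ n) {z : ℝ} (hz : |z| ≤ 1)
    {W : Finset (Fin n)} {x : Fin n} (hx : x ∉ W) :
    |subsetMean p z (insert x W) - (1 - (1 - z) * p / n) * subsetMean p z W|
      ≤ (1 - z) * (2 * (p * W.card / n) / (n - W.card)) := by
  have hn' : (0 : ℝ) < n := by exact_mod_cast hn
  have hC : (0 : ℝ) < n.choose p := by exact_mod_cast Nat.choose_pos hp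
  have hw : (0 : ℝ) < n - W.card := by
    have h1 := Finset.card_lt_univ_of_notMem hx
    rw [Fintype.card_fin] at h1
    have : (W.card : ℝ) < n := by exact_mod_cast h1
    linarith
  have hz' : 0 ≤ 1 - z := by linarith [le_of_abs_le hz]
  have h1 := mul_sum_pow_mul_mem p z hx
  rw [subsetMean, subsetMean, sum_pow_insert p z hx]
  set A := ∑ I ∈ Finset.powersetCard p Finset.univ, z ^ (I ∩ W).card * (if x ∈ I then 1 else 0)
  set T := ∑ I ∈ Finset.powersetCard p Finset.univ, z ^ (I ∩ W).card
  set κ : ℝ := p * W.card / n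
  have h2 : (n - W.card) * (A - p / n * T)
      = ∑ I ∈ Finset.powersetCard p Finset.univ, z ^ (I ∩ W).card * (κ - (I ∩ W).card) := by
    rw [mul_sub, h1]
    simp only [T, Finset.mul_sum]
    rw [← Finset.sum_sub_distrib]
    refine Finset.sum_congr rfl fun I _ => ?_
    simp only [κ]
    field_simp
    ring
  have h3 : |(n - W.card) * (A - p / n * T)| ≤ n.choose p * (2 * κ) := by
    rw [h2]
    have h4 : ∀ I : Finset (Fin n), |z ^ (I ∩ W).card * (κ - (I ∩ W).card)|
        ≤ κ + (I ∩ W).card := by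
      intro I
      rw [abs_mul, abs_pow]
      refine (mul_le_of_le_one_left (abs_nonneg _) (pow_le_one₀ (abs_nonneg _) hz)).trans ?_
      refine (abs_sub _ _).trans ?_
      rw [abs_of_nonneg (by positivity), abs_of_nonneg (by positivity)]
    refine (Finset.abs_sum_le_sum_abs _ _).trans ((Finset.sum_le_sum fun I _ => h4 I).trans
      (le_of_eq ?_))
    rw [Finset.sum_add_distrib, sum_powersetCard_const]
    have h5 := mul_sum_card_inter p W
    have h6 : ∑ I ∈ Finset.powersetCard p Finset.univ, ((I ∩ W).card : ℝ) = n.choose p * κ := by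
      simp only [κ]
      field_simp
      linarith
    rw [h6]
    ring
  rw [abs_mul, abs_of_pos hw] at h3
  have h4 : (n.choose p : ℝ)⁻¹ * |A - p / n * T| ≤ 2 * κ / (n - W.card) := by
    rw [le_div_iff₀ hw, inv_mul_eq_div, div_mul_eq_mul_div, div_le_iff₀ hC]
    linarith
  have e : (n.choose p : ℝ)⁻¹ * (T + (z - 1) * A)
      - (1 - (1 - z) * p / n) * ((n.choose p : ℝ)⁻¹ * T)
      = -((1 - z) * ((n.choose p : ℝ)⁻¹ * (A - p / n * T))) := by ring
  rw [e, abs_neg, abs_mul, abs_of_nonneg hz', abs_mul, abs_of_nonneg (by positivity)]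
  exact mul_le_mul_of_nonneg_left h4 hz'

/-- For `p` small compared with `n ^ (2 / 3)`, the average behaves as for independent elements. -/
theorem abs_subsetMean_sub_pow_le (hn : 0 < n) (hp : p ≤ n) {N : ℕ} (hN : 2 * N ≤ n)
    (W : Finset (Fin n)) (hW : W.card ≤ N) :
    |subsetMean p (-1 / 3) W - (1 - 4 * p / (3 * n)) ^ W.card|
      ≤ W.card * (16 / 3 * (N * p / n ^ 2)) := by
  have hn' : (0 : ℝ) < n := by exact_mod_cast hn
  have hpn : (p : ℝ) / n ≤ 1 := by
    rw [div_le_one hn']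
    exact_mod_cast hp
  have hN' : 2 * (N : ℝ) ≤ n := by exact_mod_cast hN
  have ha : |1 - 4 * (p : ℝ) / (3 * n)| ≤ 1 := by
    have : 4 * (p : ℝ) / (3 * n) = 4 / 3 * (p / n) := by field_simp
    have h0 : 0 ≤ (p : ℝ) / n := by positivity
    rw [this, abs_le]
    constructor <;> linarith
  induction W using Finset.induction_on with
  | empty => rw [subsetMean_empty p hp]; simp
  | insert x W hx ih =>
    rw [Finset.card_insert_of_notMem hx] at hW ⊢
    have h1 := ih (by omega)
    have h2 := abs_subsetMean_insert_sub_le p hn hp (z := -1 / 3) (by norm_num [abs_of_neg]) hx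
    have e : (1 : ℝ) - (1 - -1 / 3) * p / n = 1 - 4 * p / (3 * n) := by
      field_simp
      ring
    rw [e] at h2
    set a : ℝ := 1 - 4 * p / (3 * n)
    have hw : (W.card : ℝ) ≤ N := by exact_mod_cast (by omega : W.card ≤ N)
    -- Since `|W| ≤ N ≤ n / 2`, the denominator is at least `n / 2`; the constant is `4/3 · 4 =
    -- 16/3`.
    have h3 : (1 - -1 / 3) * (2 * ((p : ℝ) * W.card / n) / (n - W.card))
        ≤ 16 / 3 * (N * p / n ^ 2) := by
      have h4 : 2 * ((p : ℝ) * W.card / n) / (n - W.card) ≤ 2 * (p * N / n) / (n / 2) := by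
        gcongr
        linarith
      have e2 : 2 * ((p : ℝ) * N / n) / (n / 2) = 4 * (N * p / n ^ 2) := by
        field_simp
        ring
      rw [e2] at h4
      linarith
    have h5 : |a * (subsetMean p (-1 / 3) W - a ^ W.card)| ≤ W.card * (16 / 3 * (N * p / n ^ 2)) := by
      rw [abs_mul]
      exact (mul_le_of_le_one_left (abs_nonneg _) ha).trans h1
    have e3 : subsetMean p (-1 / 3) (insert x W) - a ^ (W.card + 1)
        = (subsetMean p (-1 / 3) (insert x W) - a * subsetMean p (-1 / 3) W)
          + a * (subsetMean p (-1 / 3) W - a ^ W.card) := by ring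
    rw [e3]
    refine (abs_add_le _ _).trans ?_
    push_cast
    linarith [h2.trans h3]

end Subsets

end SpinGlass

namespace SpinGlass

/-! ### Commutation signs in the `p`-spin model -/

theorem listAverage_succ {ι : Type*} [Fintype ι] (m : ℕ) (f : List ι → ℝ) :
    listAverage (m + 1) f
      = listAverage m fun L => (Fintype.card ι : ℝ)⁻¹ * ∑ c, f (c :: L) := by
  rw [← listAverage_insertIdx (Nat.zero_le m)]
  simp only [List.insertIdx_zero]

theorem abs_pow_sub_pow_le_mul {x y : ℝ} (hx : |x| ≤ 1) (hy : |y| ≤ 1) (k : ℕ) :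
    |x ^ k - y ^ k| ≤ k * |x - y| := by
  induction k with
  | zero => simp
  | succ k ih =>
    have e : x ^ (k + 1) - y ^ (k + 1) = x * (x ^ k - y ^ k) + (x - y) * y ^ k := by ring
    rw [e]
    refine (abs_add_le _ _).trans ?_
    rw [abs_mul, abs_mul, abs_pow]
    have h1 := mul_le_of_le_one_left (abs_nonneg (x ^ k - y ^ k)) hx
    have h2 := mul_le_of_le_one_right (abs_nonneg (x - y)) (pow_le_one₀ (n := k) (abs_nonneg y) hy)
    push_cast
    linarith

theorem abs_pow_sub_pow_le_of_le {a : ℝ} (ha : |a| ≤ 1) {j k : ℕ} (h : j ≤ k) :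
    |a ^ j - a ^ k| ≤ ((k : ℝ) - j) * |1 - a| := by
  obtain ⟨i, rfl⟩ := Nat.exists_eq_add_of_le h
  have e : a ^ j - a ^ (j + i) = a ^ j * (1 ^ i - a ^ i) := by rw [pow_add]; ring
  rw [e, abs_mul, abs_pow]
  refine (mul_le_of_le_one_left (abs_nonneg _) (pow_le_one₀ (abs_nonneg a) ha)).trans ?_
  refine (abs_pow_sub_pow_le_mul (by simp) ha i).trans (le_of_eq ?_)
  push_cast
  ring

section Glass

variable {n p : ℕ}

/-- The sign by which two terms of the `p`-spin Hamiltonian commute. -/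
noncomputable def glassSign (n p : ℕ) (c d : GlassCoupling n p) : ℝ :=
  stringSign (glassString c) (glassString d)

theorem signAverage_glassSign (L : List (GlassCoupling n p)) :
    signAverage (glassSign n p) L
      = subsetMean p (-1 / 3) (stringSupport (productString glassString L)) := by
  rw [signAverage, card_glassCoupling, subsetMean]
  have h1 : ∀ c : GlassCoupling n p, (L.map (glassSign n p c)).prod
      = ∏ k, pauliSign (glassString c k) (productString glassString L k) := fun c =>
    prod_stringSign glassString (glassString c) L
  simp only [h1]
  rw [sum_prod_glassString (fun k o => pauliSign o (productString glassString L k))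
    (fun k => rfl)]
  simp only [sum_pauliSign_some]
  have h2 : ∀ I ∈ Finset.powersetCard p (Finset.univ : Finset (Fin n)),
      ∏ k ∈ I, 3 * (-1 / 3 : ℝ) ^ (if productString glassString L k = none then 0 else 1)
        = 3 ^ p * (-1 / 3 : ℝ) ^ (I ∩ stringSupport (productString glassString L)).card := by
    intro I hI
    rw [Finset.prod_mul_distrib, Finset.prod_const, (Finset.mem_powersetCard.1 hI).2,
      Finset.prod_pow_eq_pow_sum]
    congr 2
    rw [Finset.card_eq_sum_ones, ← Finset.sum_ite_mem]
    exact Finset.sum_congr rfl fun k _ => by simp [mem_stringSupport]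
  rw [Finset.sum_congr rfl h2, ← Finset.mul_sum, mul_inv]
  have h3 : ((3 : ℝ) ^ p) ≠ 0 := by positivity
  field_simp

/-- A single random string already makes the support of the product large, whatever `L` is. At each
of its sites at most one of three labels cancels the existing operator, so a site contributes at
most `(1 + 2 z) / 3` on average. -/
theorem average_pow_card_stringSupport_le (hp : p ≤ n) {z : ℝ} (hz : 0 ≤ z) (hz1 : z ≤ 1)
    (L : List (GlassCoupling n p)) :
    (Fintype.card (GlassCoupling n p) : ℝ)⁻¹
        * ∑ c, z ^ (stringSupport (productString glassString (c :: L))).card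
      ≤ ((1 + 2 * z) / 3) ^ p := by
  have hC : (0 : ℝ) < n.choose p := by exact_mod_cast Nat.choose_pos hp
  set F : Fin n → Option (Fin 3) → ℝ := fun k o =>
    if o = none ∨ productString glassString L k = o then 1 else z
  have hF : ∀ k o, 0 ≤ F k o := fun k o => by simp only [F]; split_ifs <;> linarith
  have h1 : ∀ c : GlassCoupling n p,
      z ^ (stringSupport (productString glassString (c :: L))).card
        ≤ ∏ k, F k (glassString c k) := by
    intro c
    rw [stringSupport, Finset.card_filter, ← Finset.prod_pow_eq_pow_sum]
    refine Finset.prod_le_prod (fun k _ => by positivity) fun k _ => ?_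
    by_cases h : glassString c k = none ∨ productString glassString L k = glassString c k
    · simp only [F, if_pos h]
      exact pow_le_one₀ hz hz1
    · simp only [F, if_neg h]
      push Not at h
      obtain ⟨a, ha⟩ := Option.ne_none_iff_exists'.1 h.1
      rw [if_pos]
      · simp
      · change pauliMul (glassString c k) (productString glassString L k) ≠ none
        rw [ha, Ne, pauliMul_some_eq_none_iff, ← ha]
        exact h.2
  have h2 : ∑ c : GlassCoupling n p, ∏ k, F k (glassString c k) ≤ n.choose p * (1 + 2 * z) ^ p := by
    rw [sum_prod_glassString F fun k => by simp [F], ← sum_powersetCard_const]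
    refine Finset.sum_le_sum fun I hI => ?_
    have h3 : ∀ k, ∑ b, F k (some b) ≤ 1 + 2 * z := by
      intro k
      simp only [F, reduceCtorEq, false_or]
      cases productString glassString L k with
      | none => simp; linarith
      | some a => fin_cases a <;> simp [Fin.sum_univ_three] <;> linarith
    calc _ ≤ ∏ _k ∈ I, (1 + 2 * z) :=
          Finset.prod_le_prod (fun k _ => Finset.sum_nonneg fun b _ => hF k _) fun k _ => h3 k
      _ = _ := by rw [Finset.prod_const, (Finset.mem_powersetCard.1 hI).2]
  rw [card_glassCoupling]
  calc _ ≤ (3 ^ p * (n.choose p : ℝ))⁻¹ * (n.choose p * (1 + 2 * z) ^ p) :=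
        mul_le_mul_of_nonneg_left ((Finset.sum_le_sum fun c _ => h1 c).trans h2) (by positivity)
    _ = _ := by
        rw [div_pow]
        field_simp

theorem average_card_inter_stringSupport (hn : 0 < n) (hp : p ≤ n) (U : Finset (Fin n)) :
    (Fintype.card (GlassCoupling n p) : ℝ)⁻¹
        * ∑ c : GlassCoupling n p, ((stringSupport (glassString c) ∩ U).card : ℝ)
      = p * U.card / n := by
  have hC : (0 : ℝ) < n.choose p := by exact_mod_cast Nat.choose_pos hp
  have hn' : (0 : ℝ) < n := by exact_mod_cast hn
  rw [sum_stringSupport_glassString (fun I => ((I ∩ U).card : ℝ)), card_glassCoupling]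
  have h1 := mul_sum_card_inter p U
  rw [eq_div_iff hn'.ne']
  have h2 : ((3 : ℝ) ^ p) ≠ 0 := by positivity
  calc _ = (3 ^ p * (n.choose p : ℝ))⁻¹ * 3 ^ p
        * (n * ∑ I ∈ Finset.powersetCard p Finset.univ, ((I ∩ U).card : ℝ)) := by ring
    _ = _ := by
        rw [h1]
        field_simp

theorem nonempty_glassCoupling (hp : p ≤ n) : Nonempty (GlassCoupling n p) := by
  rw [← Fintype.card_pos_iff]
  have h1 := card_glassCoupling (n := n) (p := p)
  have hC : (0 : ℝ) < n.choose p := by exact_mod_cast Nat.choose_pos hp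
  have h2 : (0 : ℝ) < Fintype.card (GlassCoupling n p) := by rw [h1]; positivity
  exact_mod_cast h2

/-- Random products of Pauli strings have almost disjoint supports. -/
theorem listAverage_card_stringSupport_le (hn : 0 < n) (hp : p ≤ n) (m : ℕ) :
    listAverage m (fun L : List (GlassCoupling n p) =>
      (m : ℝ) * p - (stringSupport (productString glassString L)).card) ≤ m ^ 2 * (p ^ 2 / n) := by
  have := nonempty_glassCoupling hp
  have hn' : (0 : ℝ) < n := by exact_mod_cast hn
  have hc : (Fintype.card (GlassCoupling n p) : ℝ) ≠ 0 := by exact_mod_cast Fintype.card_ne_zero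
  induction m with
  | zero => simp [listAverage, stringSupport, productString]
  | succ m ih =>
    rw [listAverage_succ]
    have h1 : ∀ L : List (GlassCoupling n p), L.length = m →
        (Fintype.card (GlassCoupling n p) : ℝ)⁻¹ * ∑ c, (((m + 1 : ℕ) : ℝ) * p
          - (stringSupport (productString glassString (c :: L))).card)
        ≤ ((m : ℝ) * p - (stringSupport (productString glassString L)).card)
          + 2 * (m * (p ^ 2 / n)) := by
      intro L hL
      have h2 : ∀ c : GlassCoupling n p, ((m + 1 : ℕ) : ℝ) * p
          - (stringSupport (productString glassString (c :: L))).card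
          ≤ ((m : ℝ) * p - (stringSupport (productString glassString L)).card)
            + 2 * (stringSupport (glassString c) ∩ supportUnion glassString L).card := by
        intro c
        have h3 := card_stringSupport_productString_cons glassString c L
        rw [card_stringSupport_glassString] at h3
        have h4 : ((stringSupport (productString glassString L)).card : ℝ) + p
            ≤ (stringSupport (productString glassString (c :: L))).card
              + 2 * (stringSupport (glassString c) ∩ supportUnion glassString L).card := by
          exact_mod_cast h3
        push_cast
        linarith
      refine (mul_le_mul_of_nonneg_left (Finset.sum_le_sum fun c _ => h2 c)
        (by positivity)).trans ?_
      rw [Finset.sum_add_distrib, mul_add, ← Finset.mul_sum, mul_left_comm _ (2 : ℝ),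
        average_card_inter_stringSupport hn hp, Finset.sum_const, nsmul_eq_mul, Finset.card_univ,
        inv_mul_cancel_left₀ hc]
      have h5 := card_supportUnion_le glassString card_stringSupport_glassString L
      rw [hL] at h5
      have h6 : ((supportUnion glassString L).card : ℝ) ≤ m * p := by exact_mod_cast h5
      have h7 : (p : ℝ) * (supportUnion glassString L).card / n ≤ m * (p ^ 2 / n) := by
        rw [mul_div_assoc', div_le_div_iff_of_pos_right hn']
        nlinarith [Nat.cast_nonneg (α := ℝ) p]
      linarith
    -- The loss at each step is twice the expected overlap, at most `2 m p² / n`, and `m² + 2 m ≤ (m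
    -- + 1)²`.
    refine (listAverage_mono h1).trans ?_
    rw [listAverage_add, listAverage_const]
    have h8 : (0 : ℝ) ≤ p ^ 2 / n := by positivity
    push_cast
    nlinarith

/-- The bound `z ^ |W|` with `z = 1 - 2p/(3n)` is averaged over the first string of the list, giving
`(1 - 4p/(9n)) ^ p ≤ exp (-4p²/(9n))`. -/
theorem listAverage_abs_signAverage_glassSign_le (hn : 0 < n) (hp : p ≤ n) (m : ℕ) :
    listAverage (m + 1) (fun L => |signAverage (glassSign n p) L|)
      ≤ Real.exp (-(4 / 9 * ((p : ℝ) / √n) ^ 2)) := by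
  have := nonempty_glassCoupling hp
  have hn' : (0 : ℝ) < n := by exact_mod_cast hn
  have hpn : (p : ℝ) / n ≤ 1 := by
    rw [div_le_one hn']
    exact_mod_cast hp
  have h0 : (0 : ℝ) ≤ p / n := by positivity
  have e1 : 2 * (p : ℝ) / (3 * n) = 2 / 3 * (p / n) := by field_simp
  have e2 : (1 + 2 * (1 - 2 * (p : ℝ) / (3 * n))) / 3 = 1 - 4 / 9 * (p / n) := by
    field_simp
    ring
  have hz : 0 ≤ 1 - 2 * (p : ℝ) / (3 * n) := by rw [e1]; linarith
  have hz1 : 1 - 2 * (p : ℝ) / (3 * n) ≤ 1 := by rw [e1]; linarith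
  have h1 : ∀ L : List (GlassCoupling n p), L.length = m →
      (Fintype.card (GlassCoupling n p) : ℝ)⁻¹
        * ∑ c, |signAverage (glassSign n p) (c :: L)| ≤ (1 - 4 / 9 * ((p : ℝ) / n)) ^ p := by
    intro L _
    rw [← e2]
    refine le_trans ?_ (average_pow_card_stringSupport_le hp hz hz1 L)
    refine mul_le_mul_of_nonneg_left (Finset.sum_le_sum fun c _ => ?_) (by positivity)
    rw [signAverage_glassSign]
    exact abs_subsetMean_neg_le p hn hp _
  rw [listAverage_succ]
  refine (listAverage_mono h1).trans ?_
  rw [listAverage_const]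
  have h2 := pow_le_pow_left₀ (by linarith) (Real.add_one_le_exp (-(4 / 9 * ((p : ℝ) / n)))) p
  rw [← Real.exp_nat_mul] at h2
  have e3 : (p : ℝ) * -(4 / 9 * (p / n)) = -(4 / 9 * (p / √n) ^ 2) := by
    rw [div_pow, Real.sq_sqrt hn'.le]
    ring
  rw [e3, neg_add_eq_sub] at h2
  exact h2

/-- Three errors add up: dependence within the random subset (`16/3`), the missing sites `m p -
|W|`, each costing `4p/(3n)` (`4/3`), and the distance from `(1 - 4p/(3n)) ^ p` to `q`. The first
two give `20/3`. -/
theorem listAverage_abs_signAverage_glassSign_sub_le (hn : 0 < n) (hp : p ≤ n) {m : ℕ}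
    (hm : 2 * (m * p) ≤ n) (q : ℝ) :
    listAverage m (fun L => |signAverage (glassSign n p) L - q ^ m|)
      ≤ 20 / 3 * m ^ 2 * (p ^ 3 / n ^ 2) + |((1 - 4 * (p : ℝ) / (3 * n)) ^ p) ^ m - q ^ m| := by
  have := nonempty_glassCoupling hp
  have hn' : (0 : ℝ) < n := by exact_mod_cast hn
  have hpn : (p : ℝ) / n ≤ 1 := by
    rw [div_le_one hn']
    exact_mod_cast hp
  have h0 : (0 : ℝ) ≤ p / n := by positivity
  have e1 : 4 * (p : ℝ) / (3 * n) = 4 / 3 * (p / n) := by field_simp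
  set a : ℝ := 1 - 4 * p / (3 * n) with haa
  have ha : |a| ≤ 1 := by
    rw [haa, e1, abs_le]
    constructor <;> linarith
  have ha1 : |1 - a| = 4 / 3 * (p / n) := by
    rw [haa, e1, sub_sub_cancel, abs_of_nonneg (by positivity)]
  have h1 : ∀ L : List (GlassCoupling n p), L.length = m →
      |signAverage (glassSign n p) L - q ^ m|
        ≤ (16 / 3 * m ^ 2 * (p ^ 3 / n ^ 2) + |(a ^ p) ^ m - q ^ m|) + 4 / 3 * (p / n)
          * ((m : ℝ) * p - (stringSupport (productString glassString L)).card) := by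
    intro L hL
    set W := stringSupport (productString glassString L)
    have hW : W.card ≤ m * p := by
      refine (Finset.card_le_card (stringSupport_productString_subset glassString L)).trans ?_
      rw [← hL]
      exact card_supportUnion_le glassString card_stringSupport_glassString L
    have h2 := abs_subsetMean_sub_pow_le p hn hp hm W hW
    rw [← haa] at h2
    have h3 := abs_pow_sub_pow_le_of_le ha hW
    rw [ha1] at h3
    have h4 : (W.card : ℝ) * (16 / 3 * (((m * p : ℕ) : ℝ) * p / n ^ 2))
        ≤ 16 / 3 * m ^ 2 * (p ^ 3 / n ^ 2) := by
      have h5 : (W.card : ℝ) ≤ m * p := by exact_mod_cast hW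
      refine (mul_le_mul_of_nonneg_right h5 (by positivity)).trans (le_of_eq ?_)
      push_cast
      ring
    rw [signAverage_glassSign]
    have e2 : subsetMean p (-1 / 3) W - q ^ m = (subsetMean p (-1 / 3) W - a ^ W.card)
        + (a ^ W.card - a ^ (m * p)) + ((a ^ p) ^ m - q ^ m) := by
      rw [← pow_mul, mul_comm p m]
      ring
    rw [e2]
    refine (abs_add_three _ _ _).trans ?_
    push_cast at h3
    linarith
  refine (listAverage_mono h1).trans ?_
  rw [listAverage_add, listAverage_const, listAverage_const_mul]
  have h6 := mul_le_mul_of_nonneg_left (listAverage_card_stringSupport_le hn hp m)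
    (show 0 ≤ 4 / 3 * ((p : ℝ) / n) by positivity)
  have e3 : 4 / 3 * ((p : ℝ) / n) * (m ^ 2 * (p ^ 2 / n)) = 4 / 3 * m ^ 2 * (p ^ 3 / n ^ 2) := by
    field_simp
  rw [e3] at h6
  linarith

end Glass

/-! ### Average signs in the regimes of `p / √n`. -/

section Limit

variable {p : ℕ → ℕ}

theorem tendsto_signAverage_glass_of_isLittleO (hp : ∀ᶠ n in atTop, 1 ≤ p n ∧ p n ≤ n)
    (h : (fun n : ℕ => √(n : ℝ)) =o[atTop] fun n => (p n : ℝ)) (m : ℕ) :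
    Tendsto (fun n => listAverage m fun L => |signAverage (glassSign n (p n)) L - 0 ^ m|) atTop
      (𝓝 0) := by
  cases m with
  | zero =>
    -- The empty list has average sign `1`, which agrees with `0 ^ 0 = 1`.
    refine tendsto_const_nhds.congr' ?_
    filter_upwards [hp] with n hn
    have := nonempty_glassCoupling hn.2
    have hc : (Fintype.card (GlassCoupling n (p n)) : ℝ) ≠ 0 := by
      exact_mod_cast Fintype.card_ne_zero
    have h1 : signAverage (glassSign n (p n)) [] = 1 := by
      simp only [signAverage, List.map_nil, List.prod_nil, Finset.sum_const, Finset.card_univ,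
        nsmul_eq_mul, mul_one]
      exact inv_mul_cancel₀ hc
    simp [listAverage, h1]
  | succ m =>
    have h1 : Tendsto (fun n : ℕ => √(n : ℝ) / p n) atTop (𝓝[>] 0) := by
      refine tendsto_nhdsWithin_iff.2 ⟨h.tendsto_div_nhds_zero, ?_⟩
      filter_upwards [hp] with n hn
      have h2 : (0 : ℝ) < p n := by exact_mod_cast hn.1
      have h3 : (0 : ℝ) < n := by exact_mod_cast (hn.1.trans hn.2)
      exact div_pos (Real.sqrt_pos.2 h3) h2
    have h4 : Tendsto (fun n : ℕ => (p n : ℝ) / √(n : ℝ)) atTop atTop := by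
      refine h1.inv_tendsto_nhdsGT_zero.congr fun n => ?_
      simp
    have h5 : Tendsto (fun n : ℕ => Real.exp (-(4 / 9 * ((p n : ℝ) / √(n : ℝ)) ^ 2))) atTop (𝓝 0) :=
      Real.tendsto_exp_neg_atTop_nhds_zero.comp
        (((tendsto_pow_atTop two_ne_zero).comp h4).const_mul_atTop (by norm_num))
    refine tendsto_of_tendsto_of_tendsto_of_le_of_le' tendsto_const_nhds h5
      (.of_forall fun n => listAverage_nonneg fun L _ => abs_nonneg _) ?_
    filter_upwards [hp] with n hn
    simp only [ne_eq, Nat.add_eq_zero_iff, one_ne_zero, and_false, not_false_eq_true, zero_pow,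
      sub_zero]
    exact listAverage_abs_signAverage_glassSign_le (by omega) hn.2 m

/-- The value `l = 0` is allowed and gives `q = 1`, so the Gaussian regime is included. All errors
are of order `p³ / n²`, which is `(p² / n) (p / n)` and tends to `0`. -/
theorem tendsto_signAverage_glass_of_tendsto (hp : ∀ᶠ n in atTop, 1 ≤ p n ∧ p n ≤ n) {l : ℝ}
    (h : Tendsto (fun n : ℕ => (p n : ℝ) / √(n : ℝ)) atTop (𝓝 l)) (m : ℕ) :
    Tendsto (fun n => listAverage m fun L =>
      |signAverage (glassSign n (p n)) L - Real.exp (-(4 * l ^ 2 / 3)) ^ m|) atTop (𝓝 0) := by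
  set q := Real.exp (-(4 * l ^ 2 / 3))
  have hs : Tendsto (fun n : ℕ => (√(n : ℝ))⁻¹) atTop (𝓝 0) :=
    (Real.tendsto_sqrt_atTop.comp tendsto_natCast_atTop_atTop).inv_tendsto_atTop
  have hpos : ∀ᶠ n : ℕ in atTop, (0 : ℝ) < n := by
    filter_upwards [eventually_gt_atTop 0] with n hn
    exact_mod_cast hn
  have h1 : Tendsto (fun n : ℕ => (p n : ℝ) / n) atTop (𝓝 0) := by
    have := h.mul hs
    rw [mul_zero] at this
    refine this.congr' ?_
    filter_upwards [hpos] with n hn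
    rw [← div_eq_mul_inv, div_div, Real.mul_self_sqrt hn.le]
  have h2 : Tendsto (fun n : ℕ => (p n : ℝ) ^ 2 / n) atTop (𝓝 (l ^ 2)) := by
    refine (h.pow 2).congr' ?_
    filter_upwards [hpos] with n hn
    rw [div_pow, Real.sq_sqrt hn.le]
  have h3 : Tendsto (fun n : ℕ => (p n : ℝ) ^ 3 / n ^ 2) atTop (𝓝 0) := by
    have := h2.mul h1
    rw [mul_zero] at this
    refine this.congr fun n => ?_
    rw [div_mul_div_comm]
    ring
  have h4 : Tendsto (fun n : ℕ => (1 - 4 * (p n : ℝ) / (3 * n)) ^ p n) atTop (𝓝 q) := by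
    have h5 : Tendsto (fun n : ℕ => Real.exp (-(4 / 3 * ((p n : ℝ) ^ 2 / n)))) atTop (𝓝 q) := by
      have := (Real.continuous_exp.tendsto _).comp (h2.const_mul (4 / 3)).neg
      refine this.trans (le_of_eq ?_)
      congr 2
      ring
    -- Replacing `1 - t` by `exp (-t)` with `t = 4p/(3n)` costs `t²` per factor, hence `p t² = 16/9
    -- · p³ / n²` for the power.
    have h6 : Tendsto (fun n : ℕ => (16 / 9 : ℝ) * ((p n : ℝ) ^ 3 / n ^ 2)) atTop (𝓝 0) := by
      simpa using h3.const_mul (16 / 9 : ℝ)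
    refine (tendsto_iff_of_dist (squeeze_zero' (.of_forall fun n => dist_nonneg) ?_ h6)).1 h5
    filter_upwards [hpos, hp, h1.eventually (gt_mem_nhds (show (0 : ℝ) < 1 / 2 by norm_num))]
      with n hn hpn hsmall
    have h0 : (0 : ℝ) ≤ p n / n := by positivity
    set t : ℝ := 4 / 3 * (p n / n) with ht
    have e1 : 4 * (p n : ℝ) / (3 * n) = t := by rw [ht]; field_simp
    have e2 : Real.exp (-(4 / 3 * ((p n : ℝ) ^ 2 / n))) = Real.exp (-t) ^ p n := by
      rw [← Real.exp_nat_mul]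
      congr 1
      rw [ht]
      ring
    have ht0 : 0 ≤ t := by positivity
    have ht1 : t ≤ 1 := by rw [ht]; linarith
    rw [e1, e2, Real.dist_eq]
    refine (abs_pow_sub_pow_le_mul ?_ ?_ _).trans ?_
    · rw [abs_of_nonneg (Real.exp_pos _).le]
      exact Real.exp_le_one_iff.2 (by linarith)
    · rw [abs_le]
      constructor <;> linarith
    · have h7 := Real.abs_exp_sub_one_sub_id_le (x := -t) (by rw [abs_neg, abs_of_nonneg ht0]; exact ht1)
      have e3 : Real.exp (-t) - (1 - t) = Real.exp (-t) - 1 - -t := by ring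
      rw [e3]
      refine (mul_le_mul_of_nonneg_left h7 (by positivity)).trans (le_of_eq ?_)
      rw [ht]
      ring
  have h8 : Tendsto (fun n : ℕ => 20 / 3 * (m : ℝ) ^ 2 * ((p n : ℝ) ^ 3 / n ^ 2)
      + |((1 - 4 * (p n : ℝ) / (3 * n)) ^ p n) ^ m - q ^ m|) atTop (𝓝 0) := by
    have := (h3.const_mul (20 / 3 * (m : ℝ) ^ 2)).add ((h4.pow m).sub_const (q ^ m)).abs
    simpa using this
  refine tendsto_of_tendsto_of_tendsto_of_le_of_le' tendsto_const_nhds h8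
    (.of_forall fun n => listAverage_nonneg fun L _ => abs_nonneg _) ?_
  have h9 : Tendsto (fun n : ℕ => 2 * ((m : ℝ) * ((p n : ℝ) / n))) atTop (𝓝 0) := by
    simpa using (h1.const_mul (m : ℝ)).const_mul 2
  filter_upwards [hp, hpos, h9.eventually (gt_mem_nhds one_pos)] with n hpn hn hlt
  refine listAverage_abs_signAverage_glassSign_sub_le (by omega) hpn.2 ?_ q
  have h10 : 2 * ((m : ℝ) * p n) < n := by
    have : 2 * ((m : ℝ) * ((p n : ℝ) / n)) = 2 * ((m : ℝ) * p n) / n := by ring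
    rwa [this, div_lt_one hn] at hlt
  exact_mod_cast h10.le

theorem summable_exp_neg_card_glassCoupling (hp : ∀ᶠ n in atTop, 1 ≤ p n ∧ p n ≤ n) {s : ℝ}
    (hs : 0 < s) :
    Summable fun n => Real.exp (-s * Fintype.card (GlassCoupling n (p n))) := by
  have h1 : Summable fun n : ℕ => Real.exp (-s * n) := by
    have := Real.summable_exp_nat_mul_iff.2 (neg_lt_zero.2 hs)
    simpa [mul_comm] using this
  refine summable_of_isBigO_nat h1 (Asymptotics.IsBigO.of_bound 1 ?_)
  filter_upwards [hp] with n hn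
  rw [one_mul, Real.norm_of_nonneg (Real.exp_pos _).le, Real.norm_of_nonneg (Real.exp_pos _).le]
  refine Real.exp_le_exp.2 ?_
  -- Linear growth of the number of couplings is enough for summability. The condition `p ≥ 1` is
  -- essential, as `p = 0` gives a single coupling.
  have h2 : n ≤ 3 ^ p n * n.choose (p n) := by
    obtain ⟨k, hk⟩ : ∃ k, n = k + 1 := ⟨n - 1, by omega⟩
    obtain ⟨j, hj⟩ : ∃ j, p n = j + 1 := ⟨p n - 1, by omega⟩
    rw [hj]
    subst hk
    have h3 := Nat.add_one_mul_choose_eq k j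
    have h4 : 1 ≤ k.choose j := Nat.choose_pos (by omega)
    have h5 : j + 1 ≤ 3 ^ (j + 1) := (Nat.lt_pow_self (by norm_num)).le
    calc k + 1 ≤ (k + 1) * k.choose j := Nat.le_mul_of_pos_right _ h4
      _ = (k + 1).choose (j + 1) * (j + 1) := h3
      _ ≤ (k + 1).choose (j + 1) * 3 ^ (j + 1) := Nat.mul_le_mul_left _ h5
      _ = _ := mul_comm _ _
  have h6 : (n : ℝ) ≤ Fintype.card (GlassCoupling n (p n)) := by
    rw [card_glassCoupling]
    exact_mod_cast h2
  nlinarith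

end Limit

end SpinGlass

namespace SpinGlass

/-! ### Orthogonal polynomials and moments -/

/-- The `q`-Hermite polynomials. -/
noncomputable def qHermite (q : ℝ) : ℕ → ℝ → ℝ
  | 0, _ => 1
  | 1, x => x
  | j + 2, x => x * qHermite q (j + 1) x - (∑ i ∈ Finset.range (j + 1), q ^ i) * qHermite q j x

theorem integrable_pow_mul_qHermite (q : ℝ) {ν : Measure ℝ}
    (hint : ∀ k : ℕ, Integrable (fun x => x ^ k) ν) :
    ∀ j k : ℕ, Integrable (fun x => x ^ k * qHermite q j x) ν
  | 0, k => by simpa [qHermite] using hint k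
  | 1, k => by simpa [qHermite, pow_succ] using hint (k + 1)
  | j + 2, k => by
    have h1 := integrable_pow_mul_qHermite q hint (j + 1) (k + 1)
    have h2 := (integrable_pow_mul_qHermite q hint j k).const_mul (∑ i ∈ Finset.range (j + 1), q ^ i)
    refine (h1.sub h2).congr (.of_forall fun x => ?_)
    simp only [qHermite, Pi.sub_apply]
    ring

theorem integrable_qHermite (q : ℝ) {ν : Measure ℝ}
    (hint : ∀ k : ℕ, Integrable (fun x => x ^ k) ν) (j : ℕ) : Integrable (qHermite q j) ν := by
  simpa using integrable_pow_mul_qHermite q hint j 0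

/-- Multiplication by `x` acts on the `q`-Hermite polynomials by their three-term recurrence; after
division by the `q`-factorials this is the recursion of `qMoment`. The only input is that positive
degrees integrate to `0`. -/
theorem integral_pow_mul_qHermite (q : ℝ) {ν : Measure ℝ} [IsProbabilityMeasure ν]
    (hint : ∀ k : ℕ, Integrable (fun x => x ^ k) ν)
    (h0 : ∀ j, ∫ x, qHermite q (j + 1) x ∂ν = 0) (k j : ℕ) :
    ∫ x, x ^ k * qHermite q j x ∂ν
      = (∏ l ∈ Finset.range j, ∑ i ∈ Finset.range (l + 1), q ^ i) * qMoment q k j := by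
  have hI := integrable_pow_mul_qHermite q hint
  induction k generalizing j with
  | zero =>
    cases j with
    | zero => simp [qHermite, qMoment]
    | succ j => simp [h0, qMoment]
  | succ k ih =>
    cases j with
    | zero =>
      have h1 := ih 1
      simp only [qHermite, Finset.prod_range_one] at h1
      simpa [qHermite, qMoment, pow_succ] using h1
    | succ j =>
      have e : ∀ x : ℝ, x ^ (k + 1) * qHermite q (j + 1) x
          = x ^ k * qHermite q (j + 2) x
            + (∑ i ∈ Finset.range (j + 1), q ^ i) * (x ^ k * qHermite q j x) := by
        intro x
        simp only [qHermite]
        ring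
      simp only [e]
      rw [integral_add (hI _ _) ((hI _ _).const_mul _), integral_const_mul, ih, ih, qMoment,
        Finset.prod_range_succ _ (j + 1), Finset.prod_range_succ _ j]
      ring

/-- The moments of a measure that is orthogonal to the `q`-Hermite polynomials of positive
degree. -/
theorem integral_pow_eq_qMoment (q : ℝ) {ν : Measure ℝ} [IsProbabilityMeasure ν]
    (hint : ∀ k : ℕ, Integrable (fun x => x ^ k) ν)
    (h0 : ∀ j, ∫ x, qHermite q (j + 1) x ∂ν = 0) (k : ℕ) :
    ∫ x, x ^ k ∂ν = qMoment q k 0 := by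
  have := integral_pow_mul_qHermite q hint h0 k 0
  simpa [qHermite] using this

/-! ### The Gaussian law -/

theorem hasDerivAt_qHermite_one : ∀ (j : ℕ) (x : ℝ),
    HasDerivAt (qHermite 1 (j + 1)) (((j : ℝ) + 1) * qHermite 1 j x) x
  | 0, x => by simpa [qHermite] using hasDerivAt_id' x
  | 1, x => by
    have h := ((hasDerivAt_id x).mul (hasDerivAt_qHermite_one 0 x)).sub
      (hasDerivAt_const x (1 : ℝ))
    refine (h.congr_deriv ?_).congr_of_eventuallyEq (.of_forall fun y => ?_)
    · simp [qHermite]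
      ring
    · simp [qHermite]
  | j + 2, x => by
    have h := ((hasDerivAt_id x).mul (hasDerivAt_qHermite_one (j + 1) x)).sub
      ((hasDerivAt_qHermite_one j x).const_mul (∑ i ∈ Finset.range (j + 2), (1 : ℝ) ^ i))
    refine (h.congr_deriv ?_).congr_of_eventuallyEq (.of_forall fun y => ?_)
    · simp [qHermite]
      ring
    · simp [qHermite]
      norm_num [add_assoc]

/-- Since the derivative of degree `j + 1` is `j + 1` times degree `j`, integration by parts cancels
the two terms of the recurrence. -/
theorem integral_qHermite_one_gaussianReal (j : ℕ) :
    ∫ x, qHermite 1 (j + 1) x ∂gaussianReal 0 1 = 0 := by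
  have hI := integrable_qHermite 1 integrable_pow_gaussianReal
  cases j with
  | zero => simp [qHermite]
  | succ j =>
    have h1 : Integrable (fun x => x * qHermite 1 (j + 1) x) (gaussianReal 0 1) := by
      simpa using integrable_pow_mul_qHermite 1 integrable_pow_gaussianReal (j + 1) 1
    have h2 := integral_mul_deriv_gaussianReal (hasDerivAt_qHermite_one j) (hI _) h1
      ((hI j).const_mul _)
    rw [integral_const_mul] at h2
    simp only [qHermite]
    rw [integral_sub h1 ((hI j).const_mul _), integral_const_mul, h2]
    simp

theorem integral_pow_gaussianReal (k : ℕ) :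
    ∫ x, x ^ k ∂gaussianReal 0 1 = qMoment 1 k 0 :=
  integral_pow_eq_qMoment 1 integrable_pow_gaussianReal integral_qHermite_one_gaussianReal k

/-! ### Laws supported in an interval -/

theorem integral_cos_int_mul (k : ℤ) :
    ∫ θ in (0 : ℝ)..Real.pi, Real.cos (k * θ) = if k = 0 then Real.pi else 0 := by
  split_ifs with h
  · simp [h]
  · have hk : (k : ℝ) ≠ 0 := by exact_mod_cast h
    rw [intervalIntegral.integral_comp_mul_left _ hk, integral_cos]
    simp [Real.sin_int_mul_pi]

section Arcsine

variable {D w : ℝ → ℝ} {r : ℝ}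

theorem image_mul_cos_Ioo (hr : 0 < r) :
    (fun θ => r * Real.cos θ) '' Set.Ioo 0 Real.pi = Set.Ioo (-r) r := by
  ext x
  constructor
  · rintro ⟨θ, hθ, rfl⟩
    have h1 := Real.cos_lt_cos_of_nonneg_of_le_pi le_rfl hθ.2.le hθ.1
    have h2 := Real.cos_lt_cos_of_nonneg_of_le_pi hθ.1.le le_rfl hθ.2
    rw [Real.cos_zero] at h1
    rw [Real.cos_pi] at h2
    constructor <;> nlinarith
  · rintro ⟨h1, h2⟩
    have h3 : -1 < x / r := by rw [lt_div_iff₀ hr]; linarith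
    have h4 : x / r < 1 := by rw [div_lt_one hr]; exact h2
    refine ⟨Real.arccos (x / r), ⟨Real.arccos_pos.2 h4, ?_⟩, ?_⟩
    · refine lt_of_le_of_ne (Real.arccos_le_pi _) fun h => ?_
      rw [Real.arccos_eq_pi] at h
      linarith
    · simp only
      rw [Real.cos_arccos h3.le h4.le]
      field_simp

theorem hasDerivWithinAt_mul_cos (θ : ℝ) (s : Set ℝ) :
    HasDerivWithinAt (fun θ => r * Real.cos θ) (r * -Real.sin θ) s θ :=
  ((Real.hasDerivAt_cos θ).const_mul r).hasDerivWithinAt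

theorem injOn_mul_cos (hr : 0 < r) : Set.InjOn (fun θ => r * Real.cos θ) (Set.Ioo 0 Real.pi) :=
  fun _ hx _ hy h => Real.injOn_cos (Set.Ioo_subset_Icc_self hx) (Set.Ioo_subset_Icc_self hy)
    (mul_left_cancel₀ hr.ne' h)

theorem abs_mul_neg_sin (hr : 0 < r) {θ : ℝ} (hθ : θ ∈ Set.Ioo 0 Real.pi) :
    |r * -Real.sin θ| = r * Real.sin θ := by
  rw [mul_neg, abs_neg, abs_of_pos (mul_pos hr (Real.sin_pos_of_mem_Ioo hθ))]

theorem setIntegral_Ioo_eq_setIntegral_cos (hr : 0 < r) (g : ℝ → ℝ) :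
    ∫ x in Set.Ioo (-r) r, g x
      = ∫ θ in Set.Ioo 0 Real.pi, r * Real.sin θ * g (r * Real.cos θ) := by
  rw [← image_mul_cos_Ioo hr, integral_image_eq_integral_abs_deriv_smul measurableSet_Ioo
    (fun θ _ => hasDerivWithinAt_mul_cos θ _) (injOn_mul_cos hr)]
  refine setIntegral_congr_fun measurableSet_Ioo fun θ hθ => ?_
  simp only [smul_eq_mul, abs_mul_neg_sin hr hθ]

theorem integrable_of_comp_cos (hr : 0 < r) (hsupp : ∀ x, r ≤ |x| → D x = 0)
    (hw : ∀ θ ∈ Set.Ioo 0 Real.pi, r * Real.sin θ * D (r * Real.cos θ) = w θ)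
    (hwi : IntegrableOn w (Set.Ioo 0 Real.pi)) : Integrable D := by
  have h1 : IntegrableOn D (Set.Ioo (-r) r) := by
    rw [← image_mul_cos_Ioo hr, integrableOn_image_iff_integrableOn_abs_deriv_smul
      measurableSet_Ioo (fun θ _ => hasDerivWithinAt_mul_cos θ _) (injOn_mul_cos hr)]
    refine hwi.congr_fun (fun θ hθ => ?_) measurableSet_Ioo
    simp only [smul_eq_mul, abs_mul_neg_sin hr hθ, hw θ hθ]
  refine (integrableOn_iff_integrable_of_support_subset fun x hx => ?_).1 h1
  by_contra hx'
  refine hx (hsupp x ?_)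
  by_contra h
  exact hx' (abs_lt.1 (not_le.1 h))

/-- The substitution `x = r cos θ` absorbs the square roots of both compactly supported densities
and turns moments into trigonometric integrals; `w` is the density in the angle. -/
theorem integral_withDensity_comp_cos (hr : 0 < r) (hDm : Measurable D) (hD0 : ∀ x, 0 ≤ D x)
    (hsupp : ∀ x, r ≤ |x| → D x = 0)
    (hw : ∀ θ ∈ Set.Ioo 0 Real.pi, r * Real.sin θ * D (r * Real.cos θ) = w θ) (f : ℝ → ℝ) :
    ∫ x, f x ∂(volume.withDensity fun x => ENNReal.ofReal (D x))
      = ∫ θ in (0 : ℝ)..Real.pi, f (r * Real.cos θ) * w θ := by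
  rw [integral_withDensity_eq_integral_toReal_smul (by fun_prop)
    (.of_forall fun x => ENNReal.ofReal_lt_top)]
  simp only [ENNReal.toReal_ofReal (hD0 _), smul_eq_mul]
  rw [← setIntegral_eq_integral_of_forall_compl_eq_zero (s := Set.Ioo (-r) r),
    setIntegral_Ioo_eq_setIntegral_cos hr, intervalIntegral.integral_of_le Real.pi_pos.le,
    integral_Ioc_eq_integral_Ioo]
  · refine setIntegral_congr_fun measurableSet_Ioo fun θ hθ => ?_
    simp only [← hw θ hθ]
    ring
  · intro x hx
    rw [hsupp x, zero_mul]
    by_contra h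
    exact hx (abs_lt.1 (not_le.1 h))

theorem isProbabilityMeasure_withDensity_comp_cos (hr : 0 < r) (hDm : Measurable D)
    (hD0 : ∀ x, 0 ≤ D x) (hsupp : ∀ x, r ≤ |x| → D x = 0)
    (hw : ∀ θ ∈ Set.Ioo 0 Real.pi, r * Real.sin θ * D (r * Real.cos θ) = w θ)
    (hwi : IntegrableOn w (Set.Ioo 0 Real.pi)) (hw1 : ∫ θ in (0 : ℝ)..Real.pi, w θ = 1) :
    IsProbabilityMeasure (volume.withDensity fun x => ENNReal.ofReal (D x)) := by
  have h1 := integrable_of_comp_cos hr hsupp hw hwi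
  have h2 : IsFiniteMeasure (volume.withDensity fun x => ENNReal.ofReal (D x)) :=
    isFiniteMeasure_withDensity_ofReal h1.2
  have h3 := integral_withDensity_comp_cos hr hDm hD0 hsupp hw fun _ => 1
  simp only [one_mul, hw1, integral_const, smul_eq_mul, mul_one] at h3
  rw [measureReal_def, ENNReal.toReal_eq_one_iff] at h3
  exact ⟨h3⟩

theorem integrable_withDensity_of_continuous (hDm : Measurable D)
    (hsupp : ∀ x, r ≤ |x| → D x = 0)
    [IsFiniteMeasure (volume.withDensity fun x => ENNReal.ofReal (D x))] {f : ℝ → ℝ}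
    (hf : Continuous f) : Integrable f (volume.withDensity fun x => ENNReal.ofReal (D x)) := by
  obtain ⟨C, hC⟩ := (isCompact_Icc (a := -r) (b := r)).exists_bound_of_continuousOn hf.continuousOn
  refine Integrable.of_bound hf.aestronglyMeasurable C ?_
  rw [ae_withDensity_iff (by fun_prop)]
  refine .of_forall fun x hx => hC x ?_
  by_contra h
  refine hx ?_
  rw [hsupp x, ENNReal.ofReal_zero]
  by_contra h'
  exact h (Set.mem_Icc.2 (abs_le.1 (not_le.1 h').le))

end Arcsine

/-! ### The semicircle law -/

/-- At `q = 0` the recurrence is that of the Chebyshev polynomials of the second kind. -/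
theorem qHermite_zero_mul_sin (θ : ℝ) : ∀ j : ℕ,
    qHermite 0 j (2 * Real.cos θ) * Real.sin θ = Real.sin (((j : ℝ) + 1) * θ)
  | 0 => by simp [qHermite]
  | 1 => by
    rw [qHermite, show (((1 : ℕ) : ℝ) + 1) * θ = 2 * θ by norm_num, Real.sin_two_mul]
    ring
  | j + 2 => by
    have h1 : ∑ i ∈ Finset.range (j + 1), (0 : ℝ) ^ i = 1 := by
      rw [Finset.sum_range_succ']
      simp
    have h2 := qHermite_zero_mul_sin θ (j + 1)
    have h3 := qHermite_zero_mul_sin θ j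
    have h4 : Real.sin (((j + 2 : ℕ) + 1 : ℝ) * θ) + Real.sin (((j : ℝ) + 1) * θ)
        = 2 * Real.cos θ * Real.sin (((j + 1 : ℕ) + 1 : ℝ) * θ) := by
      push_cast
      rw [show ((j : ℝ) + 2 + 1) * θ = ((j : ℝ) + 1 + 1) * θ + θ by ring,
        show ((j : ℝ) + 1) * θ = ((j : ℝ) + 1 + 1) * θ - θ by ring, Real.sin_add, Real.sin_sub]
      ring
    rw [qHermite, h1, sub_mul, one_mul, h3, mul_assoc, h2]
    linarith

theorem semicircle_density_comp_cos (θ : ℝ) (hθ : θ ∈ Set.Ioo 0 Real.pi) :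
    2 * Real.sin θ * (√(4 - (2 * Real.cos θ) ^ 2) / (2 * Real.pi))
      = 2 / Real.pi * Real.sin θ ^ 2 := by
  have h1 : 4 - (2 * Real.cos θ) ^ 2 = (2 * Real.sin θ) ^ 2 := by
    nlinarith [Real.sin_sq_add_cos_sq θ]
  rw [h1, Real.sqrt_sq (by linarith [Real.sin_pos_of_mem_Ioo hθ])]
  ring

theorem semicircle_density_eq_zero (x : ℝ) (hx : 2 ≤ |x|) :
    √(4 - x ^ 2) / (2 * Real.pi) = 0 := by
  rw [Real.sqrt_eq_zero_of_nonpos, zero_div]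
  nlinarith [sq_abs x]

theorem integral_sin_mul_sin_succ (j : ℕ) :
    ∫ θ in (0 : ℝ)..Real.pi, Real.sin (((j : ℝ) + 1) * θ) * (2 / Real.pi * Real.sin θ)
      = if j = 0 then 1 else 0 := by
  have h1 : ∀ θ : ℝ, Real.sin (((j : ℝ) + 1) * θ) * (2 / Real.pi * Real.sin θ)
      = 1 / Real.pi * (Real.cos (((j : ℤ) : ℝ) * θ) - Real.cos (((j + 2 : ℤ) : ℝ) * θ)) := by
    intro θ
    push_cast
    rw [show (j : ℝ) * θ = ((j : ℝ) + 1) * θ - θ by ring,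
      show ((j : ℝ) + 2) * θ = ((j : ℝ) + 1) * θ + θ by ring, Real.cos_add, Real.cos_sub]
    ring
  simp only [h1]
  rw [intervalIntegral.integral_const_mul, intervalIntegral.integral_sub
    (Continuous.intervalIntegrable (by fun_prop) _ _)
    (Continuous.intervalIntegrable (by fun_prop) _ _), integral_cos_int_mul, integral_cos_int_mul,
    if_neg (by omega : ¬((j : ℤ) + 2 = 0))]
  by_cases hj : j = 0
  · simp [hj, Real.pi_ne_zero]
  · simp [hj]

theorem isProbabilityMeasure_semicircleLaw : IsProbabilityMeasure semicircleLaw := by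
  refine isProbabilityMeasure_withDensity_comp_cos two_pos (by fun_prop) (fun x => by positivity)
    semicircle_density_eq_zero semicircle_density_comp_cos ?_ ?_
  · exact (Continuous.integrableOn_Icc (by fun_prop)).mono_set Set.Ioo_subset_Icc_self
  · have := integral_sin_mul_sin_succ 0
    rw [if_pos rfl] at this
    refine Eq.trans (intervalIntegral.integral_congr fun θ _ => ?_) this
    simp
    ring

theorem integrable_semicircleLaw {f : ℝ → ℝ} (hf : Continuous f) : Integrable f semicircleLaw := by
  have : IsProbabilityMeasure (volume.withDensity fun x =>
    ENNReal.ofReal (√(4 - x ^ 2) / (2 * Real.pi))) := isProbabilityMeasure_semicircleLaw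
  exact integrable_withDensity_of_continuous (by fun_prop) semicircle_density_eq_zero hf

theorem integral_pow_semicircleLaw (k : ℕ) : ∫ x, x ^ k ∂semicircleLaw = qMoment 0 k 0 := by
  have := isProbabilityMeasure_semicircleLaw
  refine integral_pow_eq_qMoment 0 (fun k => integrable_semicircleLaw (by fun_prop)) (fun j => ?_) k
  rw [semicircleLaw, integral_withDensity_comp_cos two_pos (by fun_prop) (fun x => by positivity)
    semicircle_density_eq_zero semicircle_density_comp_cos]
  have h := integral_sin_mul_sin_succ (j + 1)
  rw [if_neg (Nat.succ_ne_zero j)] at h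
  refine Eq.trans (intervalIntegral.integral_congr fun θ _ => ?_) h
  simp only [← qHermite_zero_mul_sin]
  ring

end SpinGlass

namespace SpinGlass

/-! ### The triple product -/

/-- The coefficients `(-1) ^ s q ^ (s (s - 1) / 2)` of the theta function. -/
noncomputable def thetaCoeff (q : ℝ) (s : ℤ) : ℝ :=
  (-1) ^ s * q ^ (s * (s - 1) / 2)

theorem thetaCoeff_zero (q : ℝ) : thetaCoeff q 0 = 1 := by
  simp [thetaCoeff]

theorem thetaCoeff_add_one {q : ℝ} (hq : q ≠ 0) (s : ℤ) :
    thetaCoeff q (s + 1) = -(q ^ s * thetaCoeff q s) := by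
  have h1 : (s + 1) * (s + 1 - 1) / 2 = s * (s - 1) / 2 + s := by
    rw [show (s + 1) * (s + 1 - 1) = s * (s - 1) + s * 2 by ring]
    exact Int.add_mul_ediv_right _ _ two_ne_zero
  rw [thetaCoeff, thetaCoeff, h1, zpow_add₀ hq, zpow_add₀ (by norm_num), zpow_one]
  ring

theorem thetaCoeff_one_sub (q : ℝ) (s : ℤ) : thetaCoeff q (1 - s) = -thetaCoeff q s := by
  rw [thetaCoeff, thetaCoeff, show (1 - s) * (1 - s - 1) = s * (s - 1) by ring,
    zpow_sub₀ (by norm_num), zpow_one]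
  rcases Int.even_or_odd s with h | h
  · rw [h.neg_one_zpow]; ring
  · rw [h.neg_one_zpow]; ring

theorem thetaCoeff_neg (q : ℝ) (s : ℤ) : thetaCoeff q (-s) = -thetaCoeff q (s + 1) := by
  rw [← thetaCoeff_one_sub]
  congr 1
  ring

/-- The Gaussian binomial coefficients. -/
def qBinom (q : ℝ) : ℕ → ℕ → ℝ
  | _, 0 => 1
  | 0, _ + 1 => 0
  | n + 1, k + 1 => qBinom q n k + q ^ (k + 1) * qBinom q n (k + 1)

/-- The product `(1 - q) (1 - q ^ 2) ⋯ (1 - q ^ n)`. -/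
noncomputable def qFactorial (q : ℝ) (n : ℕ) : ℝ := ∏ i ∈ Finset.range n, (1 - q ^ (i + 1))

theorem qBinom_zero_right (q : ℝ) (n : ℕ) : qBinom q n 0 = 1 := by
  cases n <;> rfl

theorem qBinom_eq_zero (q : ℝ) {n k : ℕ} (h : n < k) : qBinom q n k = 0 := by
  induction n generalizing k with
  | zero =>
    obtain ⟨k, rfl⟩ : ∃ k', k = k' + 1 := ⟨k - 1, by omega⟩
    rfl
  | succ n ih =>
    obtain ⟨k, rfl⟩ : ∃ k', k = k' + 1 := ⟨k - 1, by omega⟩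
    rw [qBinom, ih (by omega), ih (by omega)]
    ring

theorem qBinom_self (q : ℝ) (n : ℕ) : qBinom q n n = 1 := by
  induction n with
  | zero => rfl
  | succ n ih => rw [qBinom, ih, qBinom_eq_zero q (Nat.lt_succ_self n)]; ring

theorem qBinom_mul_qFactorial (q : ℝ) (k j : ℕ) :
    qBinom q (k + j) k * (qFactorial q k * qFactorial q j) = qFactorial q (k + j) := by
  induction k generalizing j with
  | zero => simp [qBinom_zero_right, qFactorial]
  | succ k ihk =>
    induction j with
    | zero => simp [qBinom_self, qFactorial]
    | succ j ihj =>
      have h1 := ihk (j + 1)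
      have e1 : k + 1 + (j + 1) = k + (j + 1) + 1 := by ring
      have e2 : k + 1 + j = k + (j + 1) := by ring
      rw [e2] at ihj
      rw [e1, qBinom]
      have hs : ∀ n, qFactorial q (n + 1) = qFactorial q n * (1 - q ^ (n + 1)) := fun n =>
        Finset.prod_range_succ _ n
      rw [hs (k + (j + 1))]
      have e3 : q ^ (k + (j + 1) + 1) = q ^ (k + 1) * q ^ (j + 1) := by ring
      rw [e3]
      calc _ = qBinom q (k + (j + 1)) k * (qFactorial q k * qFactorial q (j + 1))
              * (1 - q ^ (k + 1))
            + q ^ (k + 1) * (qBinom q (k + (j + 1)) (k + 1)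
              * (qFactorial q (k + 1) * qFactorial q j)) * (1 - q ^ (j + 1)) := by
            rw [hs k, hs j]
            ring
        _ = _ := by
            rw [h1, ihj]
            ring

/-- The finite `q`-binomial theorem. -/
theorem prod_one_sub_mul_pow {q : ℝ} (hq : q ≠ 0) (n : ℕ) (x : ℂ) :
    ∏ i ∈ Finset.range n, (1 - (q : ℂ) ^ i * x)
      = ∑ k ∈ Finset.range (n + 1), ((qBinom q n k * thetaCoeff q k : ℝ) : ℂ) * x ^ k := by
  induction n generalizing x with
  | zero => simp [qBinom_zero_right, thetaCoeff_zero]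
  | succ n ih =>
    -- The factor `i = 0` is split off and the induction hypothesis is used at `q x`.
    have h1 : ∏ i ∈ Finset.range (n + 1), (1 - (q : ℂ) ^ i * x)
        = (1 - x) * ∏ i ∈ Finset.range n, (1 - (q : ℂ) ^ i * (q * x)) := by
      rw [Finset.prod_range_succ', mul_comm]
      congr 1
      · simp
      · exact Finset.prod_congr rfl fun i _ => by ring
    rw [h1, ih, sub_mul, one_mul]
    set f : ℕ → ℂ := fun k => ((qBinom q n k * thetaCoeff q k : ℝ) : ℂ) * (q * x) ^ k with hf
    have h2 : ∑ k ∈ Finset.range (n + 1), f k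
        = ∑ k ∈ Finset.range (n + 1), f (k + 1) + 1 := by
      have h3 : f (n + 1) = 0 := by simp [hf, qBinom_eq_zero q (Nat.lt_succ_self n)]
      have h4 := Finset.sum_range_succ f (n + 1)
      rw [h3, add_zero, Finset.sum_range_succ'] at h4
      rw [← h4]
      simp [hf, qBinom_zero_right, thetaCoeff_zero]
    nth_rewrite 1 [h2]
    rw [Finset.sum_range_succ' _ (n + 1), Finset.mul_sum]
    have h5 : ((qBinom q (n + 1) 0 * thetaCoeff q ((0 : ℕ) : ℤ) : ℝ) : ℂ) * x ^ 0 = 1 := by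
      simp [qBinom_zero_right, thetaCoeff_zero]
    rw [h5, add_sub_right_comm, ← Finset.sum_sub_distrib]
    congr 1
    refine Finset.sum_congr rfl fun k _ => ?_
    have h6 := thetaCoeff_add_one hq (k : ℤ)
    rw [zpow_natCast] at h6
    simp only [hf, qBinom, Nat.cast_add, Nat.cast_one, h6]
    push_cast
    ring

/-- Extracting `-q ^ (k + 1) / u` from each factor turns powers of `u⁻¹` into powers of `u`; the
extracted signs and powers of `q` multiply to `thetaCoeff q (-m)`. -/
theorem prod_one_sub_inv {q : ℝ} (hq : q ≠ 0) {u : ℂ} (hu : u ≠ 0) (m : ℕ) :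
    ∏ k ∈ Finset.range m, (1 - (q : ℂ) ^ (k + 1) * u⁻¹)
      = (thetaCoeff q (-m) : ℂ) * (u⁻¹) ^ m
        * ∏ k ∈ Finset.range m, (1 - ((q : ℂ) ^ (k + 1))⁻¹ * u) := by
  have hq' : (q : ℂ) ≠ 0 := by exact_mod_cast hq
  induction m with
  | zero => simp [thetaCoeff_zero]
  | succ m ih =>
    have h1 : thetaCoeff q (-((m + 1 : ℕ) : ℤ)) = -(q ^ (m + 1) * thetaCoeff q (-m)) := by
      have h2 := thetaCoeff_add_one hq (-((m + 1 : ℕ) : ℤ))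
      rw [show -((m + 1 : ℕ) : ℤ) + 1 = -m by push_cast; ring, zpow_neg, zpow_natCast] at h2
      rw [h2]
      have h3 : q ^ (m + 1) ≠ 0 := pow_ne_zero _ hq
      field_simp
    have h3 : (q : ℂ) ^ (m + 1) ≠ 0 := pow_ne_zero _ hq'
    have e : 1 - (q : ℂ) ^ (m + 1) * u⁻¹
        = -((q : ℂ) ^ (m + 1)) * u⁻¹ * (1 - ((q : ℂ) ^ (m + 1))⁻¹ * u) := by
      field_simp
      ring
    rw [Finset.prod_range_succ, Finset.prod_range_succ, ih, h1, e]
    push_cast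
    ring

/-- The finite form of Jacobi's triple product identity. -/
theorem finite_triple_product {q : ℝ} (hq : q ≠ 0) {u : ℂ} (hu : u ≠ 0) (m : ℕ) :
    (∏ k ∈ Finset.range (m + 1), (1 - (q : ℂ) ^ k * u))
        * ∏ k ∈ Finset.range m, (1 - (q : ℂ) ^ (k + 1) * u⁻¹)
      = ∑ k ∈ Finset.range (2 * m + 2),
        ((qBinom q (2 * m + 1) k * thetaCoeff q (k - m) : ℝ) : ℂ) * u ^ ((k : ℤ) - m) := by
  have hq' : (q : ℂ) ≠ 0 := by exact_mod_cast hq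
  have hqm : (q : ℂ) ^ m ≠ 0 := pow_ne_zero _ hq'
  rw [prod_one_sub_inv hq hu]
  -- Read in reverse order, the first product continues the second one downwards, so both merge into
  -- one `q`-binomial product of length `2 m + 1` in the variable `q ^ (-m) u`.
  have h1 : (∏ k ∈ Finset.range m, (1 - ((q : ℂ) ^ (k + 1))⁻¹ * u))
      * ∏ k ∈ Finset.range (m + 1), (1 - (q : ℂ) ^ k * u)
      = ∏ i ∈ Finset.range (2 * m + 1), (1 - (q : ℂ) ^ i * (((q : ℂ) ^ m)⁻¹ * u)) := by
    rw [show 2 * m + 1 = m + (m + 1) by ring,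
      Finset.prod_range_add (fun i => 1 - (q : ℂ) ^ i * (((q : ℂ) ^ m)⁻¹ * u)),
      ← Finset.prod_range_reflect (fun k => 1 - ((q : ℂ) ^ (k + 1))⁻¹ * u) m]
    congr 1
    · refine Finset.prod_congr rfl fun i hi => ?_
      have him := Finset.mem_range.1 hi
      have e : (q : ℂ) ^ m = q ^ i * q ^ (m - 1 - i + 1) := by
        rw [← pow_add]
        congr 1
        omega
      have h2 : (q : ℂ) ^ i ≠ 0 := pow_ne_zero _ hq'
      rw [e]
      field_simp
    · refine Finset.prod_congr rfl fun i _ => ?_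
      rw [pow_add]
      field_simp
  rw [mul_comm, mul_assoc, h1, prod_one_sub_mul_pow hq, Finset.mul_sum]
  refine Finset.sum_congr rfl fun k _ => ?_
  have h2 : thetaCoeff q (k - m) = thetaCoeff q (-m) * (thetaCoeff q k * ((q ^ m)⁻¹) ^ k) := by
    clear * - hq
    induction k with
    | zero => simp [thetaCoeff_zero]
    | succ k ih =>
      have e : ((k + 1 : ℕ) : ℤ) - m = (k - m) + 1 := by push_cast; ring
      rw [e, thetaCoeff_add_one hq, ih, zpow_sub₀ hq, zpow_natCast, zpow_natCast]
      have h3 := thetaCoeff_add_one hq (k : ℤ)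
      rw [zpow_natCast] at h3
      push_cast
      rw [h3]
      ring
  rw [h2, zpow_sub₀ hu, zpow_natCast, zpow_natCast]
  push_cast
  rw [mul_pow, inv_pow u, inv_pow]
  field_simp

/-- The partial products of the `q`-Gaussian density, expanded as cosine polynomials. -/
theorem prod_eq_sum_cos {q : ℝ} (hq : q ≠ 0) (m : ℕ) (θ : ℝ) :
    ∏ k ∈ Finset.range (m + 1), ((1 + q ^ k) ^ 2 - (2 * Real.cos θ) ^ 2 * q ^ k)
      = ∑ k ∈ Finset.range (2 * m + 2), qBinom q (2 * m + 1) k * thetaCoeff q (k - m)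
        * (Real.cos ((2 * ((k : ℤ) - m) : ℤ) * θ) - Real.cos ((2 * ((k : ℤ) - m - 1) : ℤ) * θ)) := by
  set u : ℂ := Complex.exp ((2 * θ : ℝ) * Complex.I) with hu
  have hu0 : u ≠ 0 := Complex.exp_ne_zero _
  have hinv : u⁻¹ = Complex.exp ((-(2 * θ) : ℝ) * Complex.I) := by
    rw [hu, ← Complex.exp_neg]
    congr 1
    push_cast
    ring
  have hadd : u + u⁻¹ = ((2 * Real.cos (2 * θ) : ℝ) : ℂ) := by
    rw [hinv, hu, Complex.exp_mul_I, Complex.exp_mul_I, ← Complex.ofReal_cos, ← Complex.ofReal_sin,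
      ← Complex.ofReal_cos, ← Complex.ofReal_sin, Real.cos_neg, Real.sin_neg]
    push_cast
    ring
  have hre : ∀ n : ℤ, (u ^ n).re = Real.cos ((2 * n : ℤ) * θ) := by
    intro n
    rw [hu, ← Complex.exp_int_mul]
    have e : (n : ℂ) * ((2 * θ : ℝ) * Complex.I) = (((2 * n : ℤ) * θ : ℝ) : ℂ) * Complex.I := by
      push_cast
      ring
    rw [e, Complex.exp_ofReal_mul_I_re]
  -- With `u = e^{2iθ}` each factor is `(1 - q^k u)(1 - q^k u⁻¹)`. The triple product has one factor
  -- in `u⁻¹` fewer, hence the additional `1 - u⁻¹`, whose expansion produces the differences of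
  -- cosines.
  have h1 : ((∏ k ∈ Finset.range (m + 1), ((1 + q ^ k) ^ 2 - (2 * Real.cos θ) ^ 2 * q ^ k) : ℝ) : ℂ)
      = ((∏ k ∈ Finset.range (m + 1), (1 - (q : ℂ) ^ k * u))
        * ∏ k ∈ Finset.range m, (1 - (q : ℂ) ^ (k + 1) * u⁻¹)) * (1 - u⁻¹) := by
    have h2 : (∏ k ∈ Finset.range m, (1 - (q : ℂ) ^ (k + 1) * u⁻¹)) * (1 - u⁻¹)
        = ∏ k ∈ Finset.range (m + 1), (1 - (q : ℂ) ^ k * u⁻¹) := by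
      rw [Finset.prod_range_succ']
      simp
    rw [mul_assoc, h2, ← Finset.prod_mul_distrib, Complex.ofReal_prod]
    refine Finset.prod_congr rfl fun k _ => ?_
    have e : (1 - (q : ℂ) ^ k * u) * (1 - (q : ℂ) ^ k * u⁻¹)
        = 1 - (q : ℂ) ^ k * (u + u⁻¹) + ((q : ℂ) ^ k) ^ 2 * (u * u⁻¹) := by ring
    rw [e, hadd, mul_inv_cancel₀ hu0, Real.cos_two_mul]
    push_cast
    ring
  rw [finite_triple_product hq hu0, Finset.sum_mul] at h1
  have h2 := congrArg Complex.re h1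
  rw [Complex.ofReal_re, Complex.re_sum] at h2
  rw [h2]
  refine Finset.sum_congr rfl fun k _ => ?_
  have e : u ^ ((k : ℤ) - m) * (1 - u⁻¹) = u ^ ((k : ℤ) - m) - u ^ ((k : ℤ) - m - 1) := by
    rw [zpow_sub_one₀ hu0]
    ring
  rw [mul_assoc, e, Complex.re_ofReal_mul, Complex.sub_re, hre, hre]

end SpinGlass

namespace SpinGlass

/-! ### The `q`-Gaussian law -/

/-- The infinite product in the density of the `q`-Gaussian law. -/
noncomputable def qProduct (q c : ℝ) : ℝ := ∏' k : ℕ, ((1 + q ^ k) ^ 2 - c * q ^ k)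

/-- The product `(1 - q) (1 - q ^ 2) ⋯`. -/
noncomputable def qFactorialLimit (q : ℝ) : ℝ := ∏' k : ℕ, (1 - q ^ (k + 1))

/-! ### Infinite products and limits of Gaussian binomials. -/

section Products

variable {q : ℝ} (hq0 : 0 < q) (hq1 : q < 1)

include hq0 hq1

theorem tendsto_qProduct (c : ℝ) :
    Tendsto (fun n => ∏ k ∈ Finset.range n, ((1 + q ^ k) ^ 2 - c * q ^ k)) atTop
      (𝓝 (qProduct q c)) := by
  have h1 : Summable fun k : ℕ => (2 - c) * q ^ k + (q ^ 2) ^ k :=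
    ((summable_geometric_of_lt_one hq0.le hq1).mul_left _).add
      (summable_geometric_of_lt_one (by positivity) (by nlinarith))
  have h2 := (Real.multipliable_one_add_of_summable h1).hasProd.tendsto_prod_nat
  have e : ∀ k : ℕ, 1 + ((2 - c) * q ^ k + (q ^ 2) ^ k) = (1 + q ^ k) ^ 2 - c * q ^ k := by
    intro k
    rw [← pow_mul, mul_comm 2 k, pow_mul]
    ring
  simp only [e] at h2
  exact h2

theorem tendsto_qFactorial : Tendsto (qFactorial q) atTop (𝓝 (qFactorialLimit q)) := by
  have h1 : Summable fun k : ℕ => -q ^ (k + 1) :=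
    ((summable_nat_add_iff 1).2 (summable_geometric_of_lt_one hq0.le hq1)).neg
  have h2 := (Real.multipliable_one_add_of_summable h1).hasProd.tendsto_prod_nat
  simp only [← sub_eq_add_neg] at h2
  exact h2

theorem qFactorial_ne_zero (n : ℕ) : qFactorial q n ≠ 0 :=
  Finset.prod_ne_zero_iff.2 fun k _ =>
    (sub_pos.2 (pow_lt_one₀ hq0.le hq1 (Nat.succ_ne_zero k))).ne'

theorem qFactorialLimit_pos : 0 < qFactorialLimit q := by
  have hpos : ∀ k : ℕ, 0 < 1 - q ^ (k + 1) := fun k =>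
    sub_pos.2 (pow_lt_one₀ hq0.le hq1 (Nat.succ_ne_zero k))
  refine lt_of_le_of_ne (ge_of_tendsto' (tendsto_qFactorial hq0 hq1) fun n =>
    Finset.prod_nonneg fun k _ => (hpos k).le) (Ne.symm ?_)
  have h1 : Summable fun k : ℕ => ‖-q ^ (k + 1)‖ :=
    ((summable_nat_add_iff 1).2 (summable_geometric_of_lt_one hq0.le hq1)).neg.norm
  have h2 := tprod_one_add_ne_zero_of_summable (f := fun k : ℕ => -q ^ (k + 1))
    (fun k => by rw [← sub_eq_add_neg]; exact (hpos k).ne') h1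
  simp only [← sub_eq_add_neg] at h2
  exact h2

theorem measurable_qProduct : Measurable (qProduct q) :=
  measurable_of_tendsto_metrizable
    (f := fun n c => ∏ k ∈ Finset.range n, ((1 + q ^ k) ^ 2 - c * q ^ k))
    (fun n => (by fun_prop : Continuous _).measurable)
    (tendsto_pi_nhds.2 fun c => tendsto_qProduct hq0 hq1 c)

omit hq1 in
theorem factor_nonneg {c : ℝ} (hc : c ≤ 4) (k : ℕ) : 0 ≤ (1 + q ^ k) ^ 2 - c * q ^ k := by
  have h1 : 0 < q ^ k := pow_pos hq0 k
  nlinarith [sq_nonneg (1 - q ^ k)]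

theorem qProduct_nonneg {c : ℝ} (hc : c ≤ 4) : 0 ≤ qProduct q c :=
  ge_of_tendsto' (tendsto_qProduct hq0 hq1 c) fun _ =>
    Finset.prod_nonneg fun k _ => factor_nonneg hq0 hc k

/-- From `(1 + y)² ≤ e^{2y}` and the geometric series. The bound is uniform in `n` and `c`, as
dominated convergence requires. -/
theorem abs_prod_factor_le {c : ℝ} (hc0 : 0 ≤ c) (hc : c ≤ 4) (n : ℕ) :
    |∏ k ∈ Finset.range n, ((1 + q ^ k) ^ 2 - c * q ^ k)| ≤ Real.exp (2 * (1 - q)⁻¹) := by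
  rw [abs_of_nonneg (Finset.prod_nonneg fun k _ => factor_nonneg hq0 hc k)]
  have h1 : ∀ k ∈ Finset.range n, (1 + q ^ k) ^ 2 - c * q ^ k ≤ Real.exp (2 * q ^ k) := by
    intro k _
    have h2 : 0 < q ^ k := pow_pos hq0 k
    have h3 := Real.add_one_le_exp (q ^ k)
    have e : Real.exp (2 * q ^ k) = Real.exp (q ^ k) ^ 2 := by
      rw [← Real.exp_nat_mul]
      norm_num
    rw [e]
    nlinarith [mul_nonneg hc0 h2.le]
  refine (Finset.prod_le_prod (fun k _ => factor_nonneg hq0 hc k) h1).trans ?_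
  rw [← Real.exp_sum, ← Finset.mul_sum]
  refine Real.exp_le_exp.2 (mul_le_mul_of_nonneg_left ?_ two_pos.le)
  rw [← tsum_geometric_of_lt_one hq0.le hq1]
  exact (summable_geometric_of_lt_one hq0.le hq1).sum_le_tsum _ fun k _ => by positivity

theorem abs_qProduct_le {c : ℝ} (hc0 : 0 ≤ c) (hc : c ≤ 4) :
    |qProduct q c| ≤ Real.exp (2 * (1 - q)⁻¹) :=
  le_of_tendsto' (tendsto_qProduct hq0 hq1 c).abs fun n => abs_prod_factor_le hq0 hq1 hc0 hc n

/-- The binomial is a quotient of `q`-factorials whose three indices all tend to infinity, so the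
limit is `P / (P · P)`. -/
theorem tendsto_qBinom (t : ℤ) :
    Tendsto (fun m : ℕ => qBinom q (2 * m + 1) (m + t).toNat) atTop (𝓝 (qFactorialLimit q)⁻¹) := by
  have hP := (qFactorialLimit_pos hq0 hq1).ne'
  have hF := tendsto_qFactorial hq0 hq1
  have h1 : Tendsto (fun m : ℕ => (m + t).toNat) atTop atTop :=
    tendsto_atTop.2 fun b => by
      filter_upwards [eventually_ge_atTop (b + t.natAbs)] with m hm
      omega
  have h2 : Tendsto (fun m : ℕ => 2 * m + 1 - (m + t).toNat) atTop atTop :=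
    tendsto_atTop.2 fun b => by
      filter_upwards [eventually_ge_atTop (b + t.natAbs)] with m hm
      omega
  have h3 : Tendsto (fun m : ℕ => 2 * m + 1) atTop atTop :=
    tendsto_atTop.2 fun b => by
      filter_upwards [eventually_ge_atTop b] with m hm
      omega
  have h4 := (hF.comp h3).div ((hF.comp h1).mul (hF.comp h2)) (mul_ne_zero hP hP)
  have e : qFactorialLimit q / (qFactorialLimit q * qFactorialLimit q) = (qFactorialLimit q)⁻¹ := by
    field_simp
  rw [e] at h4
  refine h4.congr' ?_
  filter_upwards [eventually_ge_atTop t.natAbs] with m hm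
  have h5 := qBinom_mul_qFactorial q (m + t).toNat (2 * m + 1 - (m + t).toNat)
  rw [show (m + t).toNat + (2 * m + 1 - (m + t).toNat) = 2 * m + 1 by omega] at h5
  have h6 := qFactorial_ne_zero hq0 hq1
  simp only [Function.comp_apply, Pi.div_apply]
  rw [div_eq_iff (mul_ne_zero (h6 _) (h6 _)), h5]

end Products

/-! ### Fourier coefficients -/

theorem integral_cos_mul_cos (M N : ℤ) :
    ∫ θ in (0 : ℝ)..Real.pi, Real.cos (M * θ) * Real.cos (N * θ)
      = Real.pi / 2 * ((if N = -M then 1 else 0) + if N = M then 1 else 0) := by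
  have h1 : ∀ θ : ℝ, Real.cos (M * θ) * Real.cos (N * θ)
      = 1 / 2 * (Real.cos ((M + N : ℤ) * θ) + Real.cos ((M - N : ℤ) * θ)) := by
    intro θ
    push_cast
    rw [add_mul, sub_mul, Real.cos_add, Real.cos_sub]
    ring
  simp only [h1]
  rw [intervalIntegral.integral_const_mul, intervalIntegral.integral_add
    (Continuous.intervalIntegrable (by fun_prop) _ _)
    (Continuous.intervalIntegrable (by fun_prop) _ _), integral_cos_int_mul, integral_cos_int_mul]
  have e1 : M + N = 0 ↔ N = -M := by omega
  have e2 : M - N = 0 ↔ N = M := by omega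
  simp only [e1, e2]
  split_ifs <;> ring

theorem integral_cos_mul_prod {q : ℝ} (hq : q ≠ 0) (m : ℕ) (M : ℤ) :
    ∫ θ in (0 : ℝ)..Real.pi, Real.cos (M * θ)
        * ∏ k ∈ Finset.range (m + 1), ((1 + q ^ k) ^ 2 - (2 * Real.cos θ) ^ 2 * q ^ k)
      = ∑ k ∈ Finset.range (2 * m + 2), qBinom q (2 * m + 1) k * thetaCoeff q (k - m)
        * (Real.pi / 2 * (((if 2 * ((k : ℤ) - m) = -M then 1 else 0)
            + if 2 * ((k : ℤ) - m) = M then 1 else 0)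
          - ((if 2 * ((k : ℤ) - m - 1) = -M then 1 else 0)
            + if 2 * ((k : ℤ) - m - 1) = M then 1 else 0))) := by
  simp only [prod_eq_sum_cos hq, Finset.mul_sum]
  rw [intervalIntegral.integral_finsetSum fun k _ =>
    Continuous.intervalIntegrable (by fun_prop) _ _]
  refine Finset.sum_congr rfl fun k _ => ?_
  rw [mul_sub (Real.pi / 2), ← integral_cos_mul_cos, ← integral_cos_mul_cos,
    ← intervalIntegral.integral_sub (Continuous.intervalIntegrable (by fun_prop) _ _)
      (Continuous.intervalIntegrable (by fun_prop) _ _), ← intervalIntegral.integral_const_mul]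
  refine intervalIntegral.integral_congr fun θ _ => ?_
  ring

theorem sum_qBinom_ite (q : ℝ) {m : ℕ} {t : ℤ} (h1 : -(m : ℤ) ≤ t) (h2 : t ≤ m + 1) :
    ∑ k ∈ Finset.range (2 * m + 2), qBinom q (2 * m + 1) k * thetaCoeff q (k - m)
        * (if (k : ℤ) - m = t then 1 else 0)
      = qBinom q (2 * m + 1) (m + t).toNat * thetaCoeff q t := by
  rw [Finset.sum_eq_single (m + t).toNat]
  · have e : (((m + t).toNat : ℕ) : ℤ) - m = t := by omega
    rw [e, if_pos rfl, mul_one]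
  · intro k _ hk
    rw [if_neg (by omega), mul_zero]
  · intro h
    exact absurd (Finset.mem_range.2 (by omega)) h

/-- Orthogonality of cosines selects the four exponents `±s`, `1 - s` and `s + 1`. The condition
`|s| ≤ m` keeps all of them in the range `-m, …, m + 1` of the expansion. -/
theorem integral_cos_two_mul_mul_prod {q : ℝ} (hq : q ≠ 0) {m : ℕ} {s : ℤ} (hs : s.natAbs ≤ m) :
    ∫ θ in (0 : ℝ)..Real.pi, Real.cos ((2 * s : ℤ) * θ)
        * ∏ k ∈ Finset.range (m + 1), ((1 + q ^ k) ^ 2 - (2 * Real.cos θ) ^ 2 * q ^ k)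
      = Real.pi / 2 * (qBinom q (2 * m + 1) (m + -s).toNat * thetaCoeff q (-s)
        + qBinom q (2 * m + 1) (m + s).toNat * thetaCoeff q s
        - qBinom q (2 * m + 1) (m + (1 - s)).toNat * thetaCoeff q (1 - s)
        - qBinom q (2 * m + 1) (m + (s + 1)).toNat * thetaCoeff q (s + 1)) := by
  rw [integral_cos_mul_prod hq, ← sum_qBinom_ite q (t := -s) (by omega) (by omega),
    ← sum_qBinom_ite q (t := s) (by omega) (by omega),
    ← sum_qBinom_ite q (t := 1 - s) (by omega) (by omega),
    ← sum_qBinom_ite q (t := s + 1) (by omega) (by omega), ← Finset.sum_add_distrib,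
    ← Finset.sum_sub_distrib, ← Finset.sum_sub_distrib, Finset.mul_sum]
  refine Finset.sum_congr rfl fun k _ => ?_
  have e1 : 2 * ((k : ℤ) - m) = -(2 * s) ↔ (k : ℤ) - m = -s := by omega
  have e2 : 2 * ((k : ℤ) - m) = 2 * s ↔ (k : ℤ) - m = s := by omega
  have e3 : 2 * ((k : ℤ) - m - 1) = -(2 * s) ↔ (k : ℤ) - m = 1 - s := by omega
  have e4 : 2 * ((k : ℤ) - m - 1) = 2 * s ↔ (k : ℤ) - m = s + 1 := by omega
  simp only [e1, e2, e3, e4]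
  ring

theorem integral_cos_odd_mul_prod {q : ℝ} (hq : q ≠ 0) (m : ℕ) (s : ℤ) :
    ∫ θ in (0 : ℝ)..Real.pi, Real.cos ((2 * s + 1 : ℤ) * θ)
        * ∏ k ∈ Finset.range (m + 1), ((1 + q ^ k) ^ 2 - (2 * Real.cos θ) ^ 2 * q ^ k) = 0 := by
  rw [integral_cos_mul_prod hq]
  refine Finset.sum_eq_zero fun k _ => ?_
  rw [if_neg (by omega), if_neg (by omega), if_neg (by omega), if_neg (by omega)]
  ring

theorem sq_two_mul_cos_le (θ : ℝ) : (2 * Real.cos θ) ^ 2 ≤ 4 := by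
  nlinarith [Real.cos_sq_le_one θ]

/-! ### Fourier coefficients of the limiting weight. -/

section Weight

variable {q : ℝ} (hq0 : 0 < q) (hq1 : q < 1)

include hq0 hq1

theorem tendsto_integral_cos_mul_prod (M : ℤ) :
    Tendsto (fun m : ℕ => ∫ θ in (0 : ℝ)..Real.pi, Real.cos (M * θ)
        * ∏ k ∈ Finset.range (m + 1), ((1 + q ^ k) ^ 2 - (2 * Real.cos θ) ^ 2 * q ^ k)) atTop
      (𝓝 (∫ θ in (0 : ℝ)..Real.pi, Real.cos (M * θ) * qProduct q ((2 * Real.cos θ) ^ 2))) := by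
  refine intervalIntegral.tendsto_integral_filter_of_dominated_convergence
    (fun _ => Real.exp (2 * (1 - q)⁻¹)) (.of_forall fun m => ?_) (.of_forall fun m => ?_)
    intervalIntegrable_const (.of_forall fun θ _ => ?_)
  · exact (by fun_prop : Continuous _).aestronglyMeasurable
  · refine .of_forall fun θ _ => ?_
    rw [norm_mul, Real.norm_eq_abs, Real.norm_eq_abs]
    exact (mul_le_of_le_one_left (abs_nonneg _) (Real.abs_cos_le_one _)).trans
      (abs_prod_factor_le hq0 hq1 (sq_nonneg _) (sq_two_mul_cos_le θ) _)
  · exact ((tendsto_qProduct hq0 hq1 _).comp (tendsto_add_atTop_nat 1)).const_mul _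

/-- In the limit all four binomials become `1 / P`. The reflection `s ↦ 1 - s` of the theta
coefficients identifies the four terms in pairs, which cancels the factor `1/2`. -/
theorem integral_cos_mul_qProduct (s : ℤ) :
    ∫ θ in (0 : ℝ)..Real.pi, Real.cos ((2 * s : ℤ) * θ) * qProduct q ((2 * Real.cos θ) ^ 2)
      = Real.pi / qFactorialLimit q * (thetaCoeff q s - thetaCoeff q (s + 1)) := by
  refine tendsto_nhds_unique (tendsto_integral_cos_mul_prod hq0 hq1 (2 * s)) ?_
  have hB := tendsto_qBinom hq0 hq1
  have h1 := (((((hB (-s)).mul_const (thetaCoeff q (-s))).add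
    ((hB s).mul_const (thetaCoeff q s))).sub
    ((hB (1 - s)).mul_const (thetaCoeff q (1 - s)))).sub
    ((hB (s + 1)).mul_const (thetaCoeff q (s + 1)))).const_mul (Real.pi / 2)
  rw [thetaCoeff_neg, thetaCoeff_one_sub] at h1
  have e : Real.pi / 2 * ((qFactorialLimit q)⁻¹ * -thetaCoeff q (s + 1)
      + (qFactorialLimit q)⁻¹ * thetaCoeff q s - (qFactorialLimit q)⁻¹ * -thetaCoeff q s
      - (qFactorialLimit q)⁻¹ * thetaCoeff q (s + 1))
      = Real.pi / qFactorialLimit q * (thetaCoeff q s - thetaCoeff q (s + 1)) := by ring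
  rw [e] at h1
  refine h1.congr' ?_
  filter_upwards [eventually_ge_atTop s.natAbs] with m hm
  rw [integral_cos_two_mul_mul_prod hq0.ne' hm, thetaCoeff_neg, thetaCoeff_one_sub]

theorem integral_cos_odd_mul_qProduct (s : ℤ) :
    ∫ θ in (0 : ℝ)..Real.pi, Real.cos ((2 * s + 1 : ℤ) * θ)
      * qProduct q ((2 * Real.cos θ) ^ 2) = 0 := by
  refine tendsto_nhds_unique (tendsto_integral_cos_mul_prod hq0 hq1 (2 * s + 1)) ?_
  simp only [integral_cos_odd_mul_prod hq0.ne']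
  exact tendsto_const_nhds

theorem intervalIntegrable_qProduct {f : ℝ → ℝ} (hf : Continuous f) (a b : ℝ) :
    IntervalIntegrable (fun θ => f θ * qProduct q ((2 * Real.cos θ) ^ 2)) volume a b := by
  refine IntervalIntegrable.continuousOn_mul ?_ hf.continuousOn
  refine (intervalIntegrable_const (c := Real.exp (2 * (1 - q)⁻¹))).mono_fun
    ((measurable_qProduct hq0 hq1).comp (by fun_prop)).aestronglyMeasurable
    (.of_forall fun θ => ?_)
  simp only [Real.norm_eq_abs, abs_of_pos (Real.exp_pos _)]
  exact abs_qProduct_le hq0 hq1 (sq_nonneg _) (sq_two_mul_cos_le θ)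

end Weight

/-! ### Orthogonality -/

/-- The continuous `q`-Hermite polynomials as functions of the angle. -/
noncomputable def cosHermite (q : ℝ) : ℕ → ℝ → ℝ
  | 0, _ => 1
  | 1, θ => 2 * Real.cos θ
  | j + 2, θ => 2 * Real.cos θ * cosHermite q (j + 1) θ - (1 - q ^ (j + 1)) * cosHermite q j θ

theorem continuous_cosHermite (q : ℝ) : ∀ j, Continuous (cosHermite q j)
  | 0 => continuous_const
  | 1 => by
    change Continuous fun θ => 2 * Real.cos θ
    fun_prop
  | j + 2 => by
    have h1 := continuous_cosHermite q (j + 1)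
    have h2 := continuous_cosHermite q j
    change Continuous fun θ => 2 * Real.cos θ * cosHermite q (j + 1) θ
      - (1 - q ^ (j + 1)) * cosHermite q j θ
    fun_prop

theorem cosHermite_eq {q : ℝ} (hq1 : q < 1) (θ : ℝ) : ∀ j,
    cosHermite q j θ = √(1 - q) ^ j * qHermite q j (2 / √(1 - q) * Real.cos θ)
  | 0 => by simp [cosHermite, qHermite]
  | 1 => by
    have h1 : √(1 - q) ≠ 0 := (Real.sqrt_pos.2 (sub_pos.2 hq1)).ne'
    simp only [cosHermite, qHermite]
    field_simp
  | j + 2 => by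
    have h1 : √(1 - q) ≠ 0 := (Real.sqrt_pos.2 (sub_pos.2 hq1)).ne'
    have h2 : √(1 - q) ^ 2 = 1 - q := Real.sq_sqrt (sub_pos.2 hq1).le
    have h3 := mul_neg_geom_sum q (j + 1)
    rw [cosHermite, cosHermite_eq hq1 θ (j + 1), cosHermite_eq hq1 θ j, qHermite, ← h3]
    set S := √(1 - q)
    rw [← h2]
    field_simp
    ring

/-- The numbers through which the Fourier coefficients of the `q`-Hermite polynomials are
expressed. -/
noncomputable def hermiteCoeff (q : ℝ) (j : ℕ) (s : ℤ) : ℝ :=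
  thetaCoeff q s * ∏ i ∈ Finset.range j, (1 - q ^ (1 - s + i))

theorem thetaCoeff_sub_one {q : ℝ} (hq : q ≠ 0) (s : ℤ) :
    thetaCoeff q (s - 1) = -(q ^ (1 - s) * thetaCoeff q s) := by
  have h := thetaCoeff_add_one hq (s - 1)
  rw [sub_add_cancel] at h
  rw [h, mul_neg, neg_neg, ← mul_assoc, ← zpow_add₀ hq]
  simp

theorem hermiteCoeff_one {q : ℝ} (hq : q ≠ 0) (s : ℤ) :
    hermiteCoeff q 1 s = hermiteCoeff q 0 s + hermiteCoeff q 0 (s - 1) := by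
  simp only [hermiteCoeff, Finset.prod_range_one, Finset.prod_range_zero, thetaCoeff_sub_one hq]
  simp
  ring

/-- The closed product satisfies the recursion that the recurrence of `cosHermite` imposes on
Fourier coefficients, so it need not be derived, only verified. -/
theorem hermiteCoeff_add_two {q : ℝ} (hq : q ≠ 0) (j : ℕ) (s : ℤ) :
    hermiteCoeff q (j + 2) s = hermiteCoeff q (j + 1) s + hermiteCoeff q (j + 1) (s - 1)
      - (1 - q ^ (j + 1)) * hermiteCoeff q j (s - 1) := by
  have h1 : ∏ i ∈ Finset.range (j + 1), (1 - q ^ (1 - s + (i : ℤ)))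
      = (∏ i ∈ Finset.range j, (1 - q ^ (1 - (s - 1) + (i : ℤ)))) * (1 - q ^ (1 - s)) := by
    rw [Finset.prod_range_succ']
    congr 1
    · refine Finset.prod_congr rfl fun i _ => ?_
      congr 2
      push_cast
      ring
    · simp
  have h2 : q ^ (1 - s + ((j + 1 : ℕ) : ℤ)) = q ^ (1 - s) * q ^ (j + 1) := by
    rw [zpow_add₀ hq, zpow_natCast]
  have h3 : q ^ (1 - (s - 1) + (j : ℤ)) = q ^ (1 - s) * q ^ (j + 1) := by
    rw [← h2]
    congr 1
    push_cast
    ring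
  simp only [hermiteCoeff]
  rw [Finset.prod_range_succ _ (j + 1), h1, h2, Finset.prod_range_succ _ j, h3,
    thetaCoeff_sub_one hq]
  ring

theorem hermiteCoeff_eq_zero (q : ℝ) {j : ℕ} {s : ℤ} (h1 : 1 ≤ s) (h2 : s ≤ j) :
    hermiteCoeff q j s = 0 := by
  refine mul_eq_zero_of_right _ (Finset.prod_eq_zero
    (Finset.mem_range.2 (show (s - 1).toNat < j by omega)) ?_)
  rw [show 1 - s + ((s - 1).toNat : ℤ) = 0 by omega, zpow_zero, sub_self]

section Orthogonality

variable {q : ℝ} (hq0 : 0 < q) (hq1 : q < 1)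

include hq0 hq1

theorem integral_cosHermite_add_two (j : ℕ) (M : ℤ) :
    ∫ θ in (0 : ℝ)..Real.pi, cosHermite q (j + 2) θ * Real.cos (M * θ)
        * qProduct q ((2 * Real.cos θ) ^ 2)
      = (∫ θ in (0 : ℝ)..Real.pi, cosHermite q (j + 1) θ * Real.cos ((M + 1 : ℤ) * θ)
          * qProduct q ((2 * Real.cos θ) ^ 2))
        + (∫ θ in (0 : ℝ)..Real.pi, cosHermite q (j + 1) θ * Real.cos ((M - 1 : ℤ) * θ)
          * qProduct q ((2 * Real.cos θ) ^ 2))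
        - (1 - q ^ (j + 1)) * ∫ θ in (0 : ℝ)..Real.pi, cosHermite q j θ * Real.cos (M * θ)
          * qProduct q ((2 * Real.cos θ) ^ 2) := by
  have hI : ∀ (i : ℕ) (N : ℤ), IntervalIntegrable (fun θ => cosHermite q i θ * Real.cos (N * θ)
      * qProduct q ((2 * Real.cos θ) ^ 2)) volume 0 Real.pi := fun i N =>
    intervalIntegrable_qProduct hq0 hq1
      ((continuous_cosHermite q i).mul (by fun_prop : Continuous fun θ : ℝ => Real.cos (N * θ))) _ _
  rw [← intervalIntegral.integral_add (hI _ _) (hI _ _), ← intervalIntegral.integral_const_mul,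
    ← intervalIntegral.integral_sub ((hI _ _).add (hI _ _)) ((hI _ _).const_mul _)]
  refine intervalIntegral.integral_congr fun θ _ => ?_
  simp only [cosHermite]
  push_cast
  rw [add_mul (M : ℝ), sub_mul (M : ℝ), one_mul θ, Real.cos_add, Real.cos_sub]
  ring

theorem integral_cosHermite_one (M : ℤ) :
    ∫ θ in (0 : ℝ)..Real.pi, cosHermite q 1 θ * Real.cos (M * θ)
        * qProduct q ((2 * Real.cos θ) ^ 2)
      = (∫ θ in (0 : ℝ)..Real.pi, cosHermite q 0 θ * Real.cos ((M + 1 : ℤ) * θ)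
          * qProduct q ((2 * Real.cos θ) ^ 2))
        + ∫ θ in (0 : ℝ)..Real.pi, cosHermite q 0 θ * Real.cos ((M - 1 : ℤ) * θ)
          * qProduct q ((2 * Real.cos θ) ^ 2) := by
  have hI : ∀ N : ℤ, IntervalIntegrable (fun θ => cosHermite q 0 θ * Real.cos (N * θ)
      * qProduct q ((2 * Real.cos θ) ^ 2)) volume 0 Real.pi := fun N =>
    intervalIntegrable_qProduct hq0 hq1
      ((continuous_cosHermite q 0).mul (by fun_prop : Continuous fun θ : ℝ => Real.cos (N * θ))) _ _
  rw [← intervalIntegral.integral_add (hI _) (hI _)]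
  refine intervalIntegral.integral_congr fun θ _ => ?_
  simp only [cosHermite]
  push_cast
  rw [add_mul (M : ℝ), sub_mul (M : ℝ), one_mul θ, Real.cos_add, Real.cos_sub]
  ring

/-- Both sides obey the same recursion in `j`, because multiplication by `2 cos θ` shifts the
frequency by `±1`. The weight has even frequencies only, so degree `j` sees the frequencies `2 s -
j` of its own parity. -/
theorem integral_cosHermite_mul_cos : ∀ (j : ℕ) (s : ℤ),
    ∫ θ in (0 : ℝ)..Real.pi, cosHermite q j θ * Real.cos ((2 * s - j : ℤ) * θ)
        * qProduct q ((2 * Real.cos θ) ^ 2)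
      = Real.pi / qFactorialLimit q * (hermiteCoeff q j s - hermiteCoeff q j (s + 1))
  | 0, s => by
    have h := integral_cos_mul_qProduct hq0 hq1 s
    simpa [cosHermite, hermiteCoeff] using h
  | 1, s => by
    rw [integral_cosHermite_one hq0 hq1]
    have h1 := integral_cosHermite_mul_cos 0 s
    have h2 := integral_cosHermite_mul_cos 0 (s - 1)
    rw [show 2 * s - ((1 : ℕ) : ℤ) + 1 = 2 * s - ((0 : ℕ) : ℤ) by omega,
      show 2 * s - ((1 : ℕ) : ℤ) - 1 = 2 * (s - 1) - ((0 : ℕ) : ℤ) by omega, h1, h2,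
      hermiteCoeff_one hq0.ne', hermiteCoeff_one hq0.ne', sub_add_cancel, add_sub_cancel_right]
    ring
  | j + 2, s => by
    rw [integral_cosHermite_add_two hq0 hq1]
    have h1 := integral_cosHermite_mul_cos (j + 1) s
    have h2 := integral_cosHermite_mul_cos (j + 1) (s - 1)
    have h3 := integral_cosHermite_mul_cos j (s - 1)
    rw [show 2 * s - ((j + 2 : ℕ) : ℤ) + 1 = 2 * s - ((j + 1 : ℕ) : ℤ) by omega,
      show 2 * s - ((j + 2 : ℕ) : ℤ) - 1 = 2 * (s - 1) - ((j + 1 : ℕ) : ℤ) by omega,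
      show 2 * s - ((j + 2 : ℕ) : ℤ) = 2 * (s - 1) - (j : ℤ) by omega, h1, h2, h3,
      hermiteCoeff_add_two hq0.ne', hermiteCoeff_add_two hq0.ne', sub_add_cancel,
      add_sub_cancel_right]
    ring

theorem integral_cosHermite_mul_cos_odd : ∀ (j : ℕ) (s : ℤ),
    ∫ θ in (0 : ℝ)..Real.pi, cosHermite q j θ * Real.cos ((2 * s + 1 - j : ℤ) * θ)
        * qProduct q ((2 * Real.cos θ) ^ 2) = 0
  | 0, s => by
    have h := integral_cos_odd_mul_qProduct hq0 hq1 s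
    simpa [cosHermite] using h
  | 1, s => by
    rw [integral_cosHermite_one hq0 hq1]
    have h1 := integral_cosHermite_mul_cos_odd 0 s
    have h2 := integral_cosHermite_mul_cos_odd 0 (s - 1)
    rw [show 2 * s + 1 - ((1 : ℕ) : ℤ) + 1 = 2 * s + 1 - ((0 : ℕ) : ℤ) by omega,
      show 2 * s + 1 - ((1 : ℕ) : ℤ) - 1 = 2 * (s - 1) + 1 - ((0 : ℕ) : ℤ) by omega, h1,
      h2, add_zero]
  | j + 2, s => by
    rw [integral_cosHermite_add_two hq0 hq1]
    have h1 := integral_cosHermite_mul_cos_odd (j + 1) s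
    have h2 := integral_cosHermite_mul_cos_odd (j + 1) (s - 1)
    have h3 := integral_cosHermite_mul_cos_odd j (s - 1)
    rw [show 2 * s + 1 - ((j + 2 : ℕ) : ℤ) + 1 = 2 * s + 1 - ((j + 1 : ℕ) : ℤ) by omega,
      show 2 * s + 1 - ((j + 2 : ℕ) : ℤ) - 1 = 2 * (s - 1) + 1 - ((j + 1 : ℕ) : ℤ) by omega,
      show 2 * s + 1 - ((j + 2 : ℕ) : ℤ) = 2 * (s - 1) + 1 - (j : ℤ) by omega, h1, h2,
      h3]
    ring

/-- Frequency `0` in even degree `2 l` is the case `s = l`, and both `l` and `l + 1` lie in `1, …, 2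
l`, where `hermiteCoeff` has a vanishing factor. In odd degree frequency `0` has the wrong parity.
-/
theorem integral_cosHermite (j : ℕ) :
    ∫ θ in (0 : ℝ)..Real.pi, cosHermite q (j + 1) θ * qProduct q ((2 * Real.cos θ) ^ 2) = 0 := by
  rcases Nat.even_or_odd' (j + 1) with ⟨l, hl | hl⟩
  · have h := integral_cosHermite_mul_cos hq0 hq1 (j + 1) l
    rw [show 2 * (l : ℤ) - ((j + 1 : ℕ) : ℤ) = 0 by omega,
      hermiteCoeff_eq_zero q (by omega) (by omega),
      hermiteCoeff_eq_zero q (by omega) (by omega)] at h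
    simpa using h
  · have h := integral_cosHermite_mul_cos_odd hq0 hq1 (j + 1) l
    rw [show 2 * (l : ℤ) + 1 - ((j + 1 : ℕ) : ℤ) = 0 by omega] at h
    simpa using h

/-! ### Moments of the `q`-Gaussian law -/

theorem measurable_qGaussianDensity : Measurable (qGaussianDensity q) := by
  have h1 : Measurable fun x : ℝ => qProduct q ((1 - q) * x ^ 2) :=
    (measurable_qProduct hq0 hq1).comp (by fun_prop)
  exact Measurable.ite (measurableSet_lt (by fun_prop) (by fun_prop))
    (((by fun_prop : Measurable fun x : ℝ =>
      √(1 - q) / (2 * Real.pi * √(4 - (1 - q) * x ^ 2))).mul h1).mul_const _) measurable_const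

theorem qGaussianDensity_nonneg (x : ℝ) : 0 ≤ qGaussianDensity q x := by
  unfold qGaussianDensity
  split_ifs with h
  · exact mul_nonneg (mul_nonneg (by positivity) (qProduct_nonneg hq0 hq1 h.le))
      (qFactorialLimit_pos hq0 hq1).le
  · exact le_rfl

omit hq0 in
theorem qGaussianDensity_eq_zero (x : ℝ) (hx : 2 / √(1 - q) ≤ |x|) : qGaussianDensity q x = 0 := by
  have h1 : 0 < √(1 - q) := Real.sqrt_pos.2 (sub_pos.2 hq1)
  refine if_neg (not_lt.2 ?_)
  rw [div_le_iff₀ h1] at hx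
  have h2 : (1 - q) * x ^ 2 = (|x| * √(1 - q)) ^ 2 := by
    rw [mul_pow, Real.sq_sqrt (sub_pos.2 hq1).le, sq_abs]
    ring
  rw [h2]
  nlinarith

omit hq0 in
theorem qGaussianDensity_comp_cos (θ : ℝ) (hθ : θ ∈ Set.Ioo 0 Real.pi) :
    2 / √(1 - q) * Real.sin θ * qGaussianDensity q (2 / √(1 - q) * Real.cos θ)
      = qFactorialLimit q / (2 * Real.pi) * qProduct q ((2 * Real.cos θ) ^ 2) := by
  have h1 : √(1 - q) ≠ 0 := (Real.sqrt_pos.2 (sub_pos.2 hq1)).ne'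
  have hs := Real.sin_pos_of_mem_Ioo hθ
  have h2 : (1 - q) * (2 / √(1 - q) * Real.cos θ) ^ 2 = (2 * Real.cos θ) ^ 2 := by
    nth_rewrite 1 [← Real.sq_sqrt (sub_pos.2 hq1).le]
    field_simp
  have h3 : 4 - (2 * Real.cos θ) ^ 2 = (2 * Real.sin θ) ^ 2 := by
    nlinarith [Real.sin_sq_add_cos_sq θ]
  have h4 : (2 * Real.cos θ) ^ 2 < 4 := by
    have : 0 < (2 * Real.sin θ) ^ 2 := by positivity
    linarith
  unfold qGaussianDensity
  rw [h2, if_pos h4, h3, Real.sqrt_sq (by positivity)]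
  change _ * (_ * qProduct q ((2 * Real.cos θ) ^ 2) * qFactorialLimit q) = _
  field_simp

theorem isProbabilityMeasure_qGaussianLaw : IsProbabilityMeasure (qGaussianLaw q) := by
  have hP := (qFactorialLimit_pos hq0 hq1).ne'
  refine isProbabilityMeasure_withDensity_comp_cos
    (div_pos two_pos (Real.sqrt_pos.2 (sub_pos.2 hq1))) (measurable_qGaussianDensity hq0 hq1)
    (qGaussianDensity_nonneg hq0 hq1) (qGaussianDensity_eq_zero hq1)
    (qGaussianDensity_comp_cos hq1) ?_ ?_
  · have h := intervalIntegrable_qProduct hq0 hq1 (f := fun _ => qFactorialLimit q / (2 * Real.pi))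
      continuous_const 0 Real.pi
    rw [intervalIntegrable_iff_integrableOn_Ioo_of_le Real.pi_pos.le] at h
    exact h
  -- Since `thetaCoeff q 1 = -1`, the total mass of the weight is `2 π / P`, the inverse of the
  -- normalising constant.
  · have h := integral_cos_mul_qProduct hq0 hq1 0
    have h1 := thetaCoeff_add_one hq0.ne' 0
    rw [thetaCoeff_zero, zpow_zero] at h1
    rw [thetaCoeff_zero, h1] at h
    simp only [mul_zero, Int.cast_zero, zero_mul, Real.cos_zero, one_mul] at h
    rw [intervalIntegral.integral_const_mul, h]
    field_simp
    norm_num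

theorem integrable_qGaussianLaw {f : ℝ → ℝ} (hf : Continuous f) :
    Integrable f (qGaussianLaw q) := by
  have : IsProbabilityMeasure (volume.withDensity fun x =>
    ENNReal.ofReal (qGaussianDensity q x)) := isProbabilityMeasure_qGaussianLaw hq0 hq1
  exact integrable_withDensity_of_continuous (measurable_qGaussianDensity hq0 hq1)
    (qGaussianDensity_eq_zero hq1) hf

theorem integral_pow_qGaussianLaw (k : ℕ) : ∫ x, x ^ k ∂qGaussianLaw q = qMoment q k 0 := by
  have := isProbabilityMeasure_qGaussianLaw hq0 hq1
  have hs : √(1 - q) ≠ 0 := (Real.sqrt_pos.2 (sub_pos.2 hq1)).ne'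
  refine integral_pow_eq_qMoment q (fun k => integrable_qGaussianLaw hq0 hq1 (by fun_prop))
    (fun j => ?_) k
  rw [qGaussianLaw, integral_withDensity_comp_cos
    (div_pos two_pos (Real.sqrt_pos.2 (sub_pos.2 hq1))) (measurable_qGaussianDensity hq0 hq1)
    (qGaussianDensity_nonneg hq0 hq1) (qGaussianDensity_eq_zero hq1)
    (qGaussianDensity_comp_cos hq1)]
  have h := integral_cosHermite hq0 hq1 j
  have e : ∀ θ : ℝ, qHermite q (j + 1) (2 / √(1 - q) * Real.cos θ)
        * (qFactorialLimit q / (2 * Real.pi) * qProduct q ((2 * Real.cos θ) ^ 2))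
      = qFactorialLimit q / (2 * Real.pi) / √(1 - q) ^ (j + 1)
        * (cosHermite q (j + 1) θ * qProduct q ((2 * Real.cos θ) ^ 2)) := by
    intro θ
    rw [cosHermite_eq hq1]
    field_simp
  simp only [e]
  rw [intervalIntegral.integral_const_mul, h, mul_zero]

end Orthogonality

end SpinGlass

namespace SpinGlass

/-! ### Spectral measures of the two models -/

section Graph

variable {n : ℕ} (Γ : SimpleGraph (Fin n)) [DecidableRel Γ.Adj]

theorem abs_dBL_graphSpectral_sub_le_sqrt (ρ : ProbabilityMeasure ℝ) (x y : GraphCoupling Γ → ℝ) :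
    |dBL (graphSpectral Γ x) ρ - dBL (graphSpectral Γ y) ρ|
      ≤ 1 / (3 * √(Γ.edgeFinset.card : ℝ)) * √(∑ c, (x c - y c) ^ 2) := by
  rw [graphSpectral_eq, graphSpectral_eq, ← one_div_sqrt_card_graphCoupling]
  exact (graph_isSpinFamily Γ).abs_dBL_spectral_sub_le ρ x y

theorem abs_dBL_graphSpectral_sub_le (ρ : ProbabilityMeasure ℝ)
    (x y : EuclideanSpace ℝ (GraphCoupling Γ)) :
    |dBL (graphSpectral Γ fun c => x c) ρ - dBL (graphSpectral Γ fun c => y c) ρ|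
      ≤ 1 / (3 * √(Γ.edgeFinset.card : ℝ)) * ‖x - y‖ := by
  refine (abs_dBL_graphSpectral_sub_le_sqrt Γ ρ _ _).trans (le_of_eq ?_)
  simp [EuclideanSpace.norm_eq]

variable {Ω : Type*} [MeasurableSpace Ω] (P : Measure Ω) [IsProbabilityMeasure P]
  {α : GraphCoupling Γ → Ω → ℝ}

theorem integrable_dBL_graphSpectral (hα : IsStdGaussianFamily P α) (ρ : ProbabilityMeasure ℝ) :
    Integrable (fun ω => dBL (graphSpectral Γ fun i => α i ω) ρ) P := by
  have h := stdGaussianPi_integrable (abs_dBL_graphSpectral_sub_le_sqrt Γ ρ)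
  rw [← hα.hasLaw.map_eq] at h
  exact h.comp_aemeasurable hα.hasLaw.aemeasurable

theorem measureReal_lt_abs_dBL_graphSpectral_le (hα : IsStdGaussianFamily P α)
    (ρ : ProbabilityMeasure ℝ) {t : ℝ} (ht : 0 ≤ t) :
    P.real {ω | t < |dBL (graphSpectral Γ fun i => α i ω) ρ
        - ∫ ω', dBL (graphSpectral Γ fun i => α i ω') ρ ∂P|}
      ≤ 2 * Real.exp (-(9 / 4) * (Γ.edgeFinset.card : ℝ) * t ^ 2) := by
  have hF := abs_dBL_graphSpectral_sub_le_sqrt Γ ρ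
  have h := hα.measureReal_lt_abs_le (by positivity) hF ht
  have he : ∫ ω, dBL (graphSpectral Γ fun i => α i ω) ρ ∂P
      = ∫ y, dBL (graphSpectral Γ y) ρ ∂stdGaussianPi (GraphCoupling Γ) :=
    hα.hasLaw.integral_comp (f := fun y => dBL (graphSpectral Γ y) ρ)
      (continuous_of_abs_sub_le hF).aestronglyMeasurable
  rw [he]
  refine h.trans (le_of_eq ?_)
  congr 2
  rw [div_pow, mul_pow, Real.sq_sqrt (Nat.cast_nonneg _)]
  rcases Nat.eq_zero_or_pos Γ.edgeFinset.card with h0 | h0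
  · simp [h0]
  · have : (Γ.edgeFinset.card : ℝ) ≠ 0 := by exact_mod_cast h0.ne'
    field_simp
    ring

end Graph

theorem ae_convergesWeakly_graphSpectral {Ω : Type*} [MeasurableSpace Ω] (P : Measure Ω)
    [IsProbabilityMeasure P] {Γ : ∀ n : ℕ, SimpleGraph (Fin n)} [∀ n, DecidableRel (Γ n).Adj]
    {α : ∀ n : ℕ, GraphCoupling (Γ n) → Ω → ℝ} (hα : ∀ n, IsStdGaussianFamily P (α n))
    (hdeg : (fun n => ((Γ n).maxDegree : ℝ)) =o[atTop] fun n => ((Γ n).edgeFinset.card : ℝ))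
    (hsum : ∀ s : ℝ, 0 < s → Summable fun n => Real.exp (-s * ((Γ n).edgeFinset.card : ℝ))) :
    ∀ᵐ ω ∂P, ConvergesWeakly (fun n => graphSpectral (Γ n) fun i => α n i ω)
      (gaussianReal 0 1) := by
  have hsum' : ∀ s : ℝ, 0 < s →
      Summable fun n => Real.exp (-s * Fintype.card (GraphCoupling (Γ n))) := by
    intro s hs
    refine (hsum (s * 9) (by positivity)).congr fun n => ?_
    rw [card_graphCoupling]
    ring_nf
  simp only [graphSpectral_eq]
  exact ae_convergesWeakly P (fun n => graph_isSpinFamily (Γ n))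
    (fun n c d => (abs_stringSign _ _).le) hα hsum'
    (tendsto_signAverage_graph hdeg (eventually_nonempty_of_summable hsum')) _
    (fun t => integrable_exp_mul_gaussianReal t) integral_pow_gaussianReal

theorem abs_dBL_glassSpectral_sub_le (n p : ℕ) (ρ : ProbabilityMeasure ℝ)
    (x y : EuclideanSpace ℝ (GlassCoupling n p)) :
    |dBL (glassSpectral n p fun c => x c) ρ - dBL (glassSpectral n p fun c => y c) ρ|
      ≤ (3 : ℝ) ^ (-(p : ℝ) / 2) * (n.choose p : ℝ) ^ (-(1 : ℝ) / 2) * ‖x - y‖ := by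
  rw [glassSpectral_eq, glassSpectral_eq, ← one_div_sqrt_card_glassCoupling]
  refine ((glass_isSpinFamily n p).abs_dBL_spectral_sub_le ρ _ _).trans (le_of_eq ?_)
  simp [EuclideanSpace.norm_eq]

theorem ae_convergesWeakly_glassSpectral {Ω : Type*} [MeasurableSpace Ω] (P : Measure Ω)
    [IsProbabilityMeasure P] {p : ℕ → ℕ} (hp : ∀ᶠ n in atTop, 1 ≤ p n ∧ p n ≤ n)
    {α : ∀ n : ℕ, GlassCoupling n (p n) → Ω → ℝ} (hα : ∀ n, IsStdGaussianFamily P (α n)) {q : ℝ}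
    (hq : ∀ m, Tendsto (fun n => listAverage m fun L =>
      |signAverage (glassSign n (p n)) L - q ^ m|) atTop (𝓝 0))
    (ν : Measure ℝ) [IsProbabilityMeasure ν]
    (hexp : ∀ t : ℝ, Integrable (fun x => Real.exp (t * x)) ν)
    (hmom : ∀ k, ∫ x, x ^ k ∂ν = qMoment q k 0) :
    ∀ᵐ ω ∂P, ConvergesWeakly (fun n => glassSpectral n (p n) fun i => α n i ω) ν := by
  simp only [glassSpectral_eq]
  exact ae_convergesWeakly P (ε := fun n => glassSign n (p n))
    (fun n => glass_isSpinFamily n (p n)) (fun n c d => (abs_stringSign _ _).le) hα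
    (fun s hs => summable_exp_neg_card_glassCoupling hp hs) hq ν hexp hmom

end SpinGlass
-- Assembly of the five statements.
theorem mainTheorem8 :
    -- Lipschitz estimate for arbitrary coupling graphs
    (∀ (n : ℕ) (Γ : SimpleGraph (Fin n)) [DecidableRel Γ.Adj] (ρ : ProbabilityMeasure ℝ)
      (x y : EuclideanSpace ℝ (GraphCoupling Γ)),
      |dBL (graphSpectral Γ fun c => x c) ρ - dBL (graphSpectral Γ fun c => y c) ρ|
        ≤ 1 / (3 * √(Γ.edgeFinset.card : ℝ)) * ‖x - y‖) ∧
    -- concentration for arbitrary coupling graphs, with universal constants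
    (∃ C c : ℝ, 0 < C ∧ 0 < c ∧
      ∀ (Ω : Type*) [MeasurableSpace Ω] (P : Measure Ω) [IsProbabilityMeasure P]
        (n : ℕ) (Γ : SimpleGraph (Fin n)) [DecidableRel Γ.Adj] (α : GraphCoupling Γ → Ω → ℝ),
        IsStdGaussianFamily P α →
        ∀ ρ : ProbabilityMeasure ℝ,
          Integrable (fun ω => dBL (graphSpectral Γ fun i => α i ω) ρ) P ∧
          ∀ t : ℝ, 0 ≤ t →
            P.real {ω | t < |dBL (graphSpectral Γ fun i => α i ω) ρ
                - ∫ ω', dBL (graphSpectral Γ fun i => α i ω') ρ ∂P|}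
              ≤ C * Real.exp (-c * (Γ.edgeFinset.card : ℝ) * t ^ 2)) ∧
    -- almost sure convergence for coupling graphs; the joint law over different `n` is arbitrary
    (∀ (Ω : Type*) [MeasurableSpace Ω] (P : Measure Ω) [IsProbabilityMeasure P]
      (Γ : ∀ n : ℕ, SimpleGraph (Fin n)) [∀ n, DecidableRel (Γ n).Adj]
      (α : ∀ n : ℕ, GraphCoupling (Γ n) → Ω → ℝ),
      (∀ n, IsStdGaussianFamily P (α n)) →
      ((fun n => ((Γ n).maxDegree : ℝ)) =o[atTop] fun n => ((Γ n).edgeFinset.card : ℝ)) →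
      (∀ s : ℝ, 0 < s → Summable fun n => Real.exp (-s * ((Γ n).edgeFinset.card : ℝ))) →
      ∀ᵐ ω ∂P, ConvergesWeakly (fun n => graphSpectral (Γ n) fun i => α n i ω)
        (gaussianReal 0 1)) ∧
    -- Lipschitz estimate for the `p`-spin model
    (∀ (n p : ℕ) (ρ : ProbabilityMeasure ℝ) (x y : EuclideanSpace ℝ (GlassCoupling n p)),
      |dBL (glassSpectral n p fun c => x c) ρ - dBL (glassSpectral n p fun c => y c) ρ|
        ≤ (3 : ℝ) ^ (-(p : ℝ) / 2) * (n.choose p : ℝ) ^ (-(1 : ℝ) / 2) * ‖x - y‖) ∧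
    -- almost sure convergence for the `p`-spin model in the three regimes
    (∀ (Ω : Type*) [MeasurableSpace Ω] (P : Measure Ω) [IsProbabilityMeasure P]
      (p : ℕ → ℕ) (α : ∀ n : ℕ, GlassCoupling n (p n) → Ω → ℝ),
      (∀ᶠ n in atTop, 1 ≤ p n ∧ p n ≤ n) →
      (∀ n, IsStdGaussianFamily P (α n)) →
      (((fun n => (p n : ℝ)) =o[atTop] fun n : ℕ => √(n : ℝ)) →
        ∀ᵐ ω ∂P, ConvergesWeakly (fun n => glassSpectral n (p n) fun i => α n i ω)
          (gaussianReal 0 1)) ∧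
      (((fun n : ℕ => √(n : ℝ)) =o[atTop] fun n => (p n : ℝ)) →
        ∀ᵐ ω ∂P, ConvergesWeakly (fun n => glassSpectral n (p n) fun i => α n i ω)
          semicircleLaw) ∧
      (∀ l : ℝ, 0 < l → Tendsto (fun n : ℕ => (p n : ℝ) / √(n : ℝ)) atTop (𝓝 l) →
        ∀ᵐ ω ∂P, ConvergesWeakly (fun n => glassSpectral n (p n) fun i => α n i ω)
          (qGaussianLaw (Real.exp (-(4 * l ^ 2 / 3)))))) := by
  -- The exponent `t² / (4 K²)` with `K = 1 / (3 √e)` is `(9/4) e t²`.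
  refine ⟨fun n Γ _ ρ x y => ?_, ⟨2, 9 / 4, two_pos, by norm_num,
    fun Ω _ P _ n Γ _ α hα ρ => ⟨?_, fun t ht => ?_⟩⟩, fun Ω _ P _ Γ _ α hα hdeg hsum => ?_,
    fun n p ρ x y => ?_, fun Ω _ P _ p α hp hα => ⟨fun h => ?_, fun h => ?_, fun l hl h => ?_⟩⟩
  · exact abs_dBL_graphSpectral_sub_le Γ ρ x y
  · exact integrable_dBL_graphSpectral Γ P hα ρ
  · exact measureReal_lt_abs_dBL_graphSpectral_le Γ P hα ρ ht
  · exact ae_convergesWeakly_graphSpectral P hα hdeg hsum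
  · exact abs_dBL_glassSpectral_sub_le n p ρ x y
  · refine ae_convergesWeakly_glassSpectral P hp hα (q := 1) (fun m => ?_) (gaussianReal 0 1)
      (fun t => integrable_exp_mul_gaussianReal t) integral_pow_gaussianReal
    -- The case `l = 0`, in which `exp (-(4 * 0 ^ 2 / 3)) = 1`.
    simpa using tendsto_signAverage_glass_of_tendsto hp h.tendsto_div_nhds_zero m
  · have := isProbabilityMeasure_semicircleLaw
    exact ae_convergesWeakly_glassSpectral P hp hα
      (tendsto_signAverage_glass_of_isLittleO hp h) semicircleLaw
      (fun t => integrable_semicircleLaw (by fun_prop)) integral_pow_semicircleLaw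
  · have hq0 : 0 < Real.exp (-(4 * l ^ 2 / 3)) := Real.exp_pos _
    have hq1 : Real.exp (-(4 * l ^ 2 / 3)) < 1 := Real.exp_lt_one_iff.2 (by nlinarith [pow_pos hl 2])
    have := isProbabilityMeasure_qGaussianLaw hq0 hq1
    exact ae_convergesWeakly_glassSpectral P hp hα (tendsto_signAverage_glass_of_tendsto hp h)
      (qGaussianLaw _) (fun t => integrable_qGaussianLaw hq0 hq1 (by fun_prop))
      (integral_pow_qGaussianLaw hq0 hq1)
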